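/- **Setting.** Fix $p\in(1,\infty)$. For $i=1,2$ a rod is given by: a length $L_i>0$; compact, simply connected cross-sections $\mathcal A_i(s)\subset\mathbb R^2$, $s\in[0,L_i]$, such that $|\zeta_1|,|\zeta_2|<R_i$ on $\mathcal A_i(s)$, such that for some $\varepsilon_i>0$ every $\mathcal A_i(s)$ contains the square $\{|\zeta_1|,|\zeta_2|<\varepsilon_i\}$, and such that $\Omega_i=\{(s,\zeta_1,\zeta_2): s\in[0,L_i],\ (\zeta_1,\zeta_2)\in\mathcal A_i(s)\}$ is the closure of its interior; a number $\tau_i\in(0,\varepsilon_i)$; an integrable mass density $\rho_i>0$ on $[0,L_i]$; and an energy density $f_i:\mathbb R^3\times[0,L_i]\to[0,+\infty]$ with $f_i(\cdot,s)$ continuous and convex, $f_i(a,\cdot)$ measurable, $f_i(a,s)\ge C_i|a|^p+D_i$ for constants $C_i>0$, $D_i\ge0$, and $f_i(a,s)\to+\infty$ as $g_i(a_1,a_2,s)\to1^-$, where $g_i(\xi_1,\xi_2,s)=\max_{\zeta\in\mathcal A_i(s)}(\zeta_1\xi_1+\zeta_2\xi_2)$. Let $\mathbf g\in\mathbb R^3$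 be the acceleration of gravity. Let $V_1=L^p([0,L_1];\mathbb R^3)$ and $V_2=L^p([0,L_2];\mathbb R^3)\times(\mathbb R^3)^3$. An element of $V=V_1\times V_2$ is $\mathbf z=(\mathbf z_1,\mathbf z_2,\hat r_2,\hat u_2,\hat v_2)$ with $\mathbf z_i=(k_i',k_i'',\omega_i)$, where $k_i',k_i''$ are the flexural densities and $\omega_i$ the twist density. It determines $(r_i,u_i,v_i)$ on $[0,L_i]$ as the unique absolutely continuous solution of $$\dot r_i=w_i,\qquad \dot u_i=-k_i'w_i-\omega_iv_i,\qquad \dot v_i=\omega_iu_i-k_i''w_i,\qquad w_i=u_i\times v_i,$$ with initial value $(\hat r_i,\hat u_i,\hat v_i)$ at $s=0$, where $(\hat r_1,\hat u_1,\hat v_1)$ is prescribed, $\hat u_1,\hat v_1$ being orthonormal. Put $p_i(s,\zeta_1,\zeta_2)=r_i(s)+\zeta_1u_i(s)+\zeta_2v_i(s)$ on $\Omega_i$. The loop energy is $$E_{\rm loop}[\mathbf z]=\sum_{i=1}^2\Big(\int_0^{L_i}f_i(\mathbf z_i(s),s)\,ds-\int_0^{L_i}\rho_i(s)\,\mathbf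 g\cdot r_i(s)\,ds\Big)\in\mathbb R\cup\{+\infty\}.$$ The linking number of two disjoint closed absolutely continuous curves $\gamma_1,\gamma_2$ is $\frac1{4\pi}\iint\frac{\gamma_1(s)-\gamma_2(t)}{|\gamma_1(s)-\gamma_2(t)|^3}\cdot(\gamma_1'(s)\times\gamma_2'(t))\,ds\,dt$. Two pairs of closed curves are isotopic if there are open neighbourhoods $N,N'$ of the unions of the curves of each pair and a continuous $\Phi:N\times[0,1]\to\mathbb R^3$ such that each $\Phi(\cdot,\tau)$ is a homeomorphism onto its image, $\Phi(\cdot,0)=\mathrm{id}$, $\Phi(N,1)=N'$, and $\Phi(\cdot,1)$ maps the first (second) curve of the first pair onto the first (second) curve of the other pair. Given $M\in\mathbb R$, $n_1,n_2\in\mathbb Z$ and continuous closed curves $\eta_i:[0,L_i]\to\mathbb R^3$ (for instance circles), let $U_{M,n,\eta}$ be the set of all $\mathbf z\in V$, with $\hat u_2,\hat v_2$ orthonormal, such that 1. $E_{\rm loop}[\mathbf z]<M$; 2. $r_i(0)=r_i(L_i)$ and $w_i(0)=w_i(L_i)$ for $i=1,2$; 3. $g_i(k_i'(s),k_i''(s),s)\le1$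 for a.e. $s\in[0,L_i]$, $i=1,2$; 4. $\int_{\Omega_i}(1-\zeta_1k_i'(s)-\zeta_2k_i''(s))\,d(s,\zeta_1,\zeta_2)\le\mathcal L^3(p_i(\Omega_i))$ for $i=1,2$; 5. $p_1(\mathrm{int}\,\Omega_1)\cap p_2(\mathrm{int}\,\Omega_2)=\emptyset$ (the rods may touch but not overlap); 6. for $i=1,2$ the curve $r_i+\tau_iu_i$, closed up by a shortest arc of the circle of radius $\tau_i$ around $r_i(L_i)$ in the plane of $u_i(L_i),v_i(L_i)$ (one of the two shortest arcs if there are two), is disjoint from $r_i$ and has linking number $n_i$ with $r_i$; 7. the midlines $r_1,r_2$ are disjoint and have linking number $1$; 8. $(r_1,r_2)$ is isotopic to $(\eta_1,\eta_2)$. **Theorem.** If $U_{M,n,\eta}\neq\emptyset$, then $E_{\rm loop}$ has a minimizer in $U_{M,n,\eta}$: there is $\mathbf z\in U_{M,n,\eta}$ with $E_{\rm loop}[\mathbf z]\le E_{\rm loop}[\mathbf z']$ for all $\mathbf z'\in U_{M,n,\eta}$. -/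

import Mathlib

open Set Filter Topology MeasureTheory

open scoped NNReal ENNReal

noncomputable section

namespace KirchhoffLink

/-- Euclidean three-space, with the fixed point `O` as origin. -/
abbrev E3 : Type := EuclideanSpace ℝ (Fin 3)

/-- The vector product of Euclidean three-space. -/
def cross (x y : E3) : E3 :=
  WithLp.toLp 2 (crossProduct (WithLp.ofLp x) (WithLp.ofLp y))

/-- The Gauss double integral of the curves `c₁ : [0, ℓ₁] → ℝ³`, `c₂ : [0, ℓ₂] → ℝ³`. -/
def gaussIntegral (ℓ₁ ℓ₂ : ℝ) (c₁ c₂ : ℝ → E3) : ℝ :=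
  1 / (4 * Real.pi) *
    ∫ s in (0 : ℝ)..ℓ₁, ∫ t in (0 : ℝ)..ℓ₂,
      inner ℝ (c₁ s - c₂ t) (cross (deriv c₁ s) (deriv c₂ t)) / ‖c₁ s - c₂ t‖ ^ 3

/-- The curves `c₁ : [0, ℓ₁] → ℝ³` and `c₂ : [0, ℓ₂] → ℝ³` are disjoint and their linking number
is `n`. (Closedness and absolute continuity hold wherever this is used.) -/
def HasLinkingNumber (ℓ₁ ℓ₂ : ℝ) (c₁ c₂ : ℝ → E3) (n : ℤ) : Prop :=
  Disjoint (c₁ '' Icc 0 ℓ₁) (c₂ '' Icc 0 ℓ₂) ∧ gaussIntegral ℓ₁ ℓ₂ c₁ c₂ = n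

/-- The pair of sets `(K₁, K₂)` is isotopic to the pair `(H₁, H₂)`: an open neighbourhood `N` of
`K₁ ∪ K₂` is deformed, starting from the identity, through homeomorphisms `Φ τ` onto their images,
to an open neighbourhood `N'` of `H₁ ∪ H₂`, carrying each `Kᵢ` onto `Hᵢ`. -/
def LinkIsotopic (K₁ K₂ H₁ H₂ : Set E3) : Prop :=
  ∃ (N N' : Set E3) (Φ : ℝ → E3 → E3),
    IsOpen N ∧ IsOpen N' ∧ K₁ ∪ K₂ ⊆ N ∧ H₁ ∪ H₂ ⊆ N' ∧
    ContinuousOn (fun q : ℝ × E3 => Φ q.1 q.2) (Icc 0 1 ×ˢ N) ∧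
    (∀ τ ∈ Icc (0 : ℝ) 1, IsEmbedding (N.domRestrict (Φ τ))) ∧
    (∀ x ∈ N, Φ 0 x = x) ∧
    Φ 1 '' N = N' ∧ Φ 1 '' K₁ = H₁ ∧ Φ 1 '' K₂ = H₂

/-- The material set `{(s, ζ₁, ζ₂) | s ∈ [0, ℓ], (ζ₁, ζ₂) ∈ A(s)}`. -/
def materialSet (ℓ : ℝ) (A : ℝ → Set (ℝ × ℝ)) : Set (ℝ × ℝ × ℝ) :=
  {x | x.1 ∈ Icc 0 ℓ ∧ x.2 ∈ A x.1}

/-- The support function of the cross-section: `g(ξ₁, ξ₂, s) = sup_{ζ ∈ A(s)} (ζ₁ ξ₁ + ζ₂ ξ₂)`.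
It is convex and positively homogeneous, `g(0, 0, s) = 0`, and `g(k', k'', s) < 1` says that the
Jacobian `1 - ζ₁ k' - ζ₂ k''` is positive on the compact section `A(s)`. -/
def compression (A : ℝ → Set (ℝ × ℝ)) (ξ₁ ξ₂ s : ℝ) : ℝ :=
  sSup ((fun ζ : ℝ × ℝ => ζ.1 * ξ₁ + ζ.2 * ξ₂) '' A s)

/-- The material data of one rod, for the exponent `p`. -/
structure Rod (p : ℝ) where
  /-- the length -/
  ℓ : ℝ
  ℓ_pos : 0 < ℓ
  /-- the cross-sections -/
  A : ℝ → Set (ℝ × ℝ)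
  A_compact : ∀ s ∈ Icc 0 ℓ, IsCompact (A s)
  A_simplyConnected : ∀ s ∈ Icc 0 ℓ, SimplyConnectedSpace (A s)
  closure_interior : closure (interior (materialSet ℓ A)) = materialSet ℓ A
  /-- the maximal thickness -/
  R : ℝ
  A_lt : ∀ s ∈ Icc 0 ℓ, ∀ ζ ∈ A s, |ζ.1| < R ∧ |ζ.2| < R
  /-- the thickness of the rod around its axis is nonzero -/
  ε : ℝ
  A_thick : ∀ s ∈ Icc 0 ℓ, ∀ ζ : ℝ × ℝ, |ζ.1| < ε → |ζ.2| < ε → ζ ∈ A s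
  /-- the distance from the axis of the material curve whose linking with the midline is fixed -/
  τ : ℝ
  τ_pos : 0 < τ
  τ_lt : τ < ε
  /-- the elastic energy density; its argument `a` is `(k', k'', ω)` -/
  f : E3 → ℝ → ℝ≥0∞
  f_continuous : ∀ s ∈ Icc 0 ℓ, Continuous fun a => f a s
  f_convex : ∀ s ∈ Icc 0 ℓ, ConvexOn ℝ≥0 univ fun a => f a s
  f_measurable : ∀ a, AEMeasurable (f a) (volume.restrict (Icc 0 ℓ))
  f_coercive : ∃ C D : ℝ, 0 < C ∧ 0 ≤ D ∧
    ∀ a, ∀ s ∈ Icc 0 ℓ, ENNReal.ofReal (C * ‖a‖ ^ p + D) ≤ f a s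
  f_compression : ∀ s ∈ Icc 0 ℓ,
    Tendsto (fun a => f a s) (comap (fun a : E3 => compression A (a 0) (a 1) s) (𝓝[<] 1)) (𝓝 ⊤)
  /-- the mass of the cross-sections -/
  ρ : ℝ → ℝ
  ρ_pos : ∀ s ∈ Icc 0 ℓ, 0 < ρ s
  ρ_integrable : IntegrableOn ρ (Icc 0 ℓ)

/-- The space `L^p([0, ℓ]; ℝ³)` of densities `(k', k'', ω)`. -/
abbrev Density (p ℓ : ℝ) : Type := Lp E3 (ENNReal.ofReal p) (volume.restrict (Icc (0 : ℝ) ℓ))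

/-- An initial value: position, and the first two directors. -/
structure InitialValue where
  r : E3
  u : E3
  v : E3

/-- The two given directors are orthonormal (the third one is their vector product). -/
def InitialValue.IsOrthonormal (b : InitialValue) : Prop :=
  ‖b.u‖ = 1 ∧ ‖b.v‖ = 1 ∧ inner ℝ b.u b.v = 0

/-- A midline with its directors `u, v`. -/
structure FramedCurve where
  r : ℝ → E3
  u : ℝ → E3
  v : ℝ → E3

instance : Inhabited FramedCurve := ⟨⟨fun _ => 0, fun _ => 0, fun _ => 0⟩⟩

namespace FramedCurve

/-- The third director `w = u × v`, tangent to the midline. -/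
def w (F : FramedCurve) (s : ℝ) : E3 := cross (F.u s) (F.v s)

/-- `F` solves on `[0, ℓ]`, with initial value `b` and in integrated (Carathéodory) form, the system
`r' = w`, `u' = -k' w - ω v`, `v' = ω u - k'' w` with `(k', k'', ω) = k`. -/
def Solves (F : FramedCurve) (ℓ : ℝ) (k : ℝ → E3) (b : InitialValue) : Prop :=
  ContinuousOn F.r (Icc 0 ℓ) ∧ ContinuousOn F.u (Icc 0 ℓ) ∧ ContinuousOn F.v (Icc 0 ℓ) ∧
  ∀ s ∈ Icc 0 ℓ,
    F.r s = b.r + (∫ t in (0 : ℝ)..s, F.w t) ∧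
    F.u s = b.u + (∫ t in (0 : ℝ)..s, (-(k t 0) • F.w t - k t 2 • F.v t)) ∧
    F.v s = b.v + (∫ t in (0 : ℝ)..s, (k t 2 • F.u t - k t 1 • F.w t))

/-- The spatial position `r(s) + ζ₁ u(s) + ζ₂ v(s)` of the material point `(s, ζ₁, ζ₂)`. -/
def position (F : FramedCurve) (x : ℝ × ℝ × ℝ) : E3 :=
  F.r x.1 + x.2.1 • F.u x.1 + x.2.2 • F.v x.1

/-- The curve `r + τ u` on `[0, ℓ]`, followed on `[ℓ, ℓ + 1]` by the circular arc of radius `τ`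
around `r(ℓ)`, in the plane of `u(ℓ), v(ℓ)`, that starts at `r(ℓ) + τ u(ℓ)` and turns by the
angle `φ`. -/
def nearbyCurve (F : FramedCurve) (ℓ τ φ t : ℝ) : E3 :=
  if t ≤ ℓ then F.r t + τ • F.u t
  else F.r ℓ + τ • (Real.cos (φ * (t - ℓ)) • F.u ℓ + Real.sin (φ * (t - ℓ)) • F.v ℓ)

/-- The curve `r + τ u`, closed up by a shortest circular arc around the end point of the midline,
has linking number `n` with the midline `r`. (Two arcs are shortest only if `u(ℓ) = -u(0)`.) -/
def SelfLinking (F : FramedCurve) (ℓ τ : ℝ) (n : ℤ) : Prop :=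
  ∃ φ ∈ Icc (-Real.pi) Real.pi,
    Real.cos φ • F.u ℓ + Real.sin φ • F.v ℓ = F.u 0 ∧
    HasLinkingNumber ℓ (ℓ + 1) F.r (F.nearbyCurve ℓ τ φ) n

end FramedCurve

namespace Rod

variable {p : ℝ}

/-- The material set `Ω` of the rod. -/
def Ω (B : Rod p) : Set (ℝ × ℝ × ℝ) := materialSet B.ℓ B.A

/-- The framed midline of the rod with densities `z` and initial value `b`: the solution of the
system of ordinary differential equations, which exists and is unique on `[0, ℓ]`. -/
def frame (B : Rod p) (z : Density p B.ℓ) (b : InitialValue) : FramedCurve :=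
  Classical.epsilon fun F => F.Solves B.ℓ z b

/-- The elastic energy `∫₀^ℓ f(z(s), s) ds`. -/
def elasticEnergy (B : Rod p) (z : Density p B.ℓ) : ℝ≥0∞ :=
  ∫⁻ s in Icc 0 B.ℓ, B.f (z s) s

/-- The potential energy of the weight, `-∫₀^ℓ ρ(s) grav · r(s) ds`. -/
def weightEnergy (B : Rod p) (grav : E3) (z : Density p B.ℓ) (b : InitialValue) : ℝ :=
  -∫ s in Icc 0 B.ℓ, B.ρ s * inner ℝ grav ((B.frame z b).r s)

/-- The constraints that concern one rod only. -/
structure Admissible (B : Rod p) (z : Density p B.ℓ) (b : InitialValue) (n : ℤ) : Prop where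
  /-- the midline is closed -/
  closed : (B.frame z b).r 0 = (B.frame z b).r B.ℓ
  /-- the tangent closes up -/
  tangent : (B.frame z b).w 0 = (B.frame z b).w B.ℓ
  /-- local non-interpenetration -/
  local_noninterpenetration :
    ∀ᵐ s ∂(volume.restrict (Icc 0 B.ℓ)), compression B.A (z s 0) (z s 1) s ≤ 1
  /-- global non-interpenetration of the rod with itself -/
  global_noninterpenetration :
    (∫ x in B.Ω, (1 - x.2.1 * z x.1 0 - x.2.2 * z x.1 1)) ≤
      volume.real ((B.frame z b).position '' B.Ω)
  /-- the gluing of the end sections -/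
  selfLinking : (B.frame z b).SelfLinking B.ℓ B.τ n

end Rod

/-- The space `V = V₁ × V₂`: the densities of both rods, and the initial value of the second one. -/
structure Config {p : ℝ} (B₁ B₂ : Rod p) where
  z₁ : Density p B₁.ℓ
  z₂ : Density p B₂.ℓ
  b₂ : InitialValue

variable {p : ℝ} {B₁ B₂ : Rod p}

/-- The loop energy, elastic plus gravitational, with values in `ℝ ∪ {+∞}`; `b₁` is the clamping
value of the first rod and `grav` the acceleration of gravity. -/
def loopEnergy (b₁ : InitialValue) (grav : E3) (z : Config B₁ B₂) : EReal :=
  (B₁.elasticEnergy z.z₁ : EReal) + (B₁.weightEnergy grav z.z₁ b₁ : EReal) +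
    (B₂.elasticEnergy z.z₂ : EReal) + (B₂.weightEnergy grav z.z₂ z.b₂ : EReal)

/-- The class `U_{M,n,η}` of admissible configurations. The loops may touch each other along their
surfaces, but their interiors do not overlap. -/
def admissibleClass (b₁ : InitialValue) (grav : E3) (M : ℝ) (n₁ n₂ : ℤ) (η₁ η₂ : ℝ → E3) :
    Set (Config B₁ B₂) :=
  {z | z.b₂.IsOrthonormal ∧
    loopEnergy b₁ grav z < (M : EReal) ∧
    B₁.Admissible z.z₁ b₁ n₁ ∧
    B₂.Admissible z.z₂ z.b₂ n₂ ∧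
    Disjoint ((B₁.frame z.z₁ b₁).position '' interior B₁.Ω)
      ((B₂.frame z.z₂ z.b₂).position '' interior B₂.Ω) ∧
    HasLinkingNumber B₁.ℓ B₂.ℓ (B₁.frame z.z₁ b₁).r (B₂.frame z.z₂ z.b₂).r 1 ∧
    LinkIsotopic ((B₁.frame z.z₁ b₁).r '' Icc 0 B₁.ℓ) ((B₂.frame z.z₂ z.b₂).r '' Icc 0 B₂.ℓ)
      (η₁ '' Icc 0 B₁.ℓ) (η₂ '' Icc 0 B₂.ℓ)}

end KirchhoffLink

end

/-!
The minimizer comes from the direct method of the calculus of variations: a minimizing sequence has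
a subsequence whose rods converge, the loop energy is lower semicontinuous along it, and every
constraint other than the strict energy bound is closed; that bound holds in the limit because the
infimum lies below it (`exists_admissible_realLoopEnergy_le`).

*Compactness.* The coercivity of the energy bounds the densities in `L^p`. Gravity is no obstacle,
because linking number `1` makes the rods come near to each other, so that the position of the
second rod is bounded (`Rod.norm_initial_le_of_linked`). As `p > 1`, the primitives of the
densities, the midlines and the directors are equicontinuous and converge uniformly along a
subsequence.

*Weak limits without the weak topology.* The limit densities are a strong limit of convex
combinations of the tails of the sequence (`ConvexLimit`). It exists since almost minimizers of the
strictly convex functional `∫ √(1 + ‖y‖²)` on the decreasing convex hulls of the tails form a Cauchy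
sequence in `L¹` (`exists_convexLimit`). Convexity and Fatou's lemma give the lower semicontinuity of
the elastic energy (`Rod.elasticEnergy_le_of_convexLimit`), and the local constraint and the total
Jacobian, being convex and affine in the densities, pass to the limit. Integration by parts
(`tendsto_integral_mul`) passes to the limit in the differential equation, so that the limit curves
are the rod of the limit densities (`Rod.TendstoRod.tendstoFrame`).

*Global injectivity.* By the local constraint the height of a fixed point over the plane of the
cross-section decreases strictly along the rod near an interior material point. A sign change of
the height persists under perturbation, hence so does the covering of a point by nearby
cross-sections (`Rod.eventually_mem_tube`, `Rod.eventually_mem_image_interior`). If two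
cross-sections of the tube of radius `ε` around the midline had a common point, then a ball would
be covered twice, and the volume of the deformed rod would be less than the integral of the Jacobian
by the area formula (`IsFrame.volume_image_le`), contrary to the volume constraint. So the tube is
embedded (`Rod.Impenetrable.tube_injective`). In particular the midline is simple, and the curve at
distance `τ < ε` does not meet it. The same persistence shows that the limits of rods that do not
overlap do not overlap, and that their midlines are disjoint (`Rod.disjoint_midlines`).

*Topological constraints.* As the limit curves are disjoint, the Gauss integral is continuous at
the limit, under `C¹` convergence of one curve and uniform convergence with bounded lengths of the
other one (`tendsto_gaussIntegral`); this keeps the linking number and the self-linking numbers.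
The limit midlines are simple closed `C¹` curves and satisfy a chord–arc condition, so that the
displacement to a late member of the sequence is a map on the link with a small Lipschitz constant.
It extends to a Lipschitz map of the space with constant less than `1`, and adding multiples of it
to the identity is an isotopy (`eventually_linkIsotopic`). Isotopies compose
(`LinkIsotopic.trans`), so the isotopy class is kept.
-/


namespace KirchhoffLink

/-! ### Absolutely continuous functions, as indefinite integrals -/

/-- `x` is absolutely continuous on `[0, ℓ]` with density `x'`: the density is integrable and `x` is
its indefinite integral. -/
structure IsPrimitive {E : Type*} [NormedAddCommGroup E] [NormedSpace ℝ E] (ℓ : ℝ)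
    (x x' : ℝ → E) : Prop where
  nonneg : 0 ≤ ℓ
  integrable : IntervalIntegrable x' volume 0 ℓ
  eq_integral : ∀ s ∈ Icc 0 ℓ, x s = x 0 + ∫ t in (0 : ℝ)..s, x' t

namespace IsPrimitive

variable {E : Type*} [NormedAddCommGroup E] [NormedSpace ℝ E] {ℓ : ℝ} {x x' y y' : ℝ → E}

lemma zero_mem (h : IsPrimitive ℓ x x') : (0 : ℝ) ∈ Icc 0 ℓ := ⟨le_rfl, h.nonneg⟩

lemma intervalIntegrable (h : IsPrimitive ℓ x x') {s t : ℝ} (hs : s ∈ Icc 0 ℓ)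
    (ht : t ∈ Icc 0 ℓ) : IntervalIntegrable x' volume s t :=
  h.integrable.mono_set (by
    rw [uIcc_of_le (hs.1.trans hs.2)]
    exact (convex_Icc 0 ℓ).ordConnected.uIcc_subset hs ht)

lemma sub_eq_integral (h : IsPrimitive ℓ x x') {s t : ℝ} (hs : s ∈ Icc 0 ℓ)
    (ht : t ∈ Icc 0 ℓ) : x t - x s = ∫ τ in s..t, x' τ := by
  have h0 := h.zero_mem
  rw [h.eq_integral s hs, h.eq_integral t ht, add_sub_add_left_eq_sub,
    intervalIntegral.integral_interval_sub_left (h.intervalIntegrable h0 ht)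
      (h.intervalIntegrable h0 hs)]

lemma continuousOn (h : IsPrimitive ℓ x x') : ContinuousOn x (Icc 0 ℓ) := by
  have h1 := intervalIntegral.continuousOn_primitive_interval' h.integrable
    (left_mem_uIcc : (0 : ℝ) ∈ uIcc 0 ℓ)
  rw [uIcc_of_le h.nonneg] at h1
  exact (continuousOn_const.add h1).congr fun s hs => h.eq_integral s hs

lemma congr_ae (h : IsPrimitive ℓ x x') (hxy : ∀ᵐ t, t ∈ Ioc 0 ℓ → x' t = y' t) :
    IsPrimitive ℓ x y' := by
  refine ⟨h.nonneg, h.integrable.congr_ae ?_, fun s hs => ?_⟩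
  · rw [uIoc_of_le h.nonneg]
    exact (ae_restrict_iff' measurableSet_Ioc).2 hxy
  · rw [h.eq_integral s hs]
    congr 1
    apply intervalIntegral.integral_congr_ae
    filter_upwards [hxy] with t ht hts
    rw [uIoc_of_le hs.1] at hts
    exact ht ⟨hts.1, hts.2.trans hs.2⟩

lemma congr_density (h : IsPrimitive ℓ x x') (hxy : ∀ t, x' t = y' t) : IsPrimitive ℓ x y' :=
  (funext hxy : x' = y') ▸ h

lemma congr (h : IsPrimitive ℓ x x') (hxy : ∀ t ∈ Icc 0 ℓ, x t = y t) :
    IsPrimitive ℓ y x' :=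
  ⟨h.nonneg, h.integrable, fun s hs => by rw [← hxy s hs, ← hxy 0 h.zero_mem, h.eq_integral s hs]⟩

lemma add (h : IsPrimitive ℓ x x') (h' : IsPrimitive ℓ y y') :
    IsPrimitive ℓ (fun s => x s + y s) (fun s => x' s + y' s) := by
  refine ⟨h.nonneg, h.integrable.add h'.integrable, fun s hs => ?_⟩
  have h0 := h.zero_mem
  rw [h.eq_integral s hs, h'.eq_integral s hs, intervalIntegral.integral_add (h.intervalIntegrable h0 hs)
    (h'.intervalIntegrable h0 hs)]
  abel

lemma comp_clm {F : Type*} [NormedAddCommGroup F] [NormedSpace ℝ F] [CompleteSpace E]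
    [CompleteSpace F] (h : IsPrimitive ℓ x x') (L : E →L[ℝ] F) :
    IsPrimitive ℓ (fun s => L (x s)) (fun s => L (x' s)) := by
  refine ⟨h.nonneg, ⟨L.integrable_comp h.integrable.1, L.integrable_comp h.integrable.2⟩,
    fun s hs => ?_⟩
  have h0 := h.zero_mem
  rw [h.eq_integral s hs, map_add, L.intervalIntegral_comp_comm (h.intervalIntegrable h0 hs)]

lemma const (hℓ : 0 ≤ ℓ) (c : E) : IsPrimitive ℓ (fun _ => c) (fun _ => 0) :=
  ⟨hℓ, by simp, by simp⟩

lemma sub (h : IsPrimitive ℓ x x') (h' : IsPrimitive ℓ y y') :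
    IsPrimitive ℓ (fun s => x s - y s) (fun s => x' s - y' s) := by
  refine ⟨h.nonneg, h.integrable.sub h'.integrable, fun s hs => ?_⟩
  have h0 := h.zero_mem
  rw [h.eq_integral s hs, h'.eq_integral s hs, intervalIntegral.integral_sub (h.intervalIntegrable h0 hs)
    (h'.intervalIntegrable h0 hs)]
  abel

lemma ae_hasDerivAt [CompleteSpace E] (h : IsPrimitive ℓ x x') :
    ∀ᵐ s, s ∈ Ioo 0 ℓ → HasDerivAt x (x' s) s := by
  filter_upwards [h.integrable.ae_hasDerivAt_integral] with s hs hsℓ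
  have hle : (0 : ℝ) ≤ ℓ := (hsℓ.1.trans hsℓ.2).le
  rw [uIcc_of_le hle] at hs
  have := (hs (Ioo_subset_Icc_self hsℓ) 0 ⟨le_rfl, hle⟩).const_add (x 0)
  refine this.congr_of_eventuallyEq ?_
  filter_upwards [Ioo_mem_nhds hsℓ.1 hsℓ.2] with t ht using h.eq_integral t (Ioo_subset_Icc_self ht)

lemma hasDerivAt_of_continuousOn [CompleteSpace E] (h : IsPrimitive ℓ x x')
    (hc : ContinuousOn x' (Icc 0 ℓ)) {s : ℝ} (hs : s ∈ Ioo 0 ℓ) : HasDerivAt x (x' s) s := by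
  have hn : Icc 0 ℓ ∈ 𝓝 s := Icc_mem_nhds hs.1 hs.2
  have h0 := h.zero_mem
  have := (intervalIntegral.integral_hasDerivAt_right
    (h.intervalIntegrable h0 (Ioo_subset_Icc_self hs))
    (hc.stronglyMeasurableAtFilter_nhdsWithin measurableSet_Icc s |>.filter_mono
      (by rw [nhdsWithin_eq_nhds.2 hn])) (hc.continuousAt hn)).const_add (x 0)
  refine this.congr_of_eventuallyEq ?_
  filter_upwards [hn] with t ht using h.eq_integral t ht

/-- The product rule. -/
lemma mul {x x' y y' : ℝ → ℝ} (h : IsPrimitive ℓ x x') (h' : IsPrimitive ℓ y y') :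
    IsPrimitive ℓ (fun s => x s * y s) (fun s => x' s * y s + x s * y' s) := by
  have hu : uIcc 0 ℓ = Icc 0 ℓ := uIcc_of_le h.nonneg
  have h0 : (0 : ℝ) ∈ uIcc 0 ℓ := left_mem_uIcc
  have hint : IntervalIntegrable (fun s => x' s * y s + x s * y' s) volume 0 ℓ :=
    (h.integrable.mul_continuousOn (hu ▸ h'.continuousOn)).add
      (h'.integrable.continuousOn_mul (hu ▸ h.continuousOn))
  refine ⟨h.nonneg, hint, ?_⟩
  have ac : ∀ (c : ℝ) {z : ℝ → ℝ}, IntervalIntegrable z volume 0 ℓ →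
      AbsolutelyContinuousOnInterval (fun s => c + ∫ t in (0 : ℝ)..s, z t) 0 ℓ := fun c z hz =>
    (LipschitzOnWith.absolutelyContinuousOnInterval
      (LipschitzWith.const c).lipschitzOnWith).fun_add
      (hz.absolutelyContinuousOnInterval_intervalIntegral h0)
  obtain ⟨C, hC⟩ := (((ac (x 0) h.integrable).fun_mul (ac (y 0) h'.integrable)).fun_sub
    (hint.absolutelyContinuousOnInterval_intervalIntegral h0)).const_of_ae_hasDerivAt_zero (by
      filter_upwards [h.integrable.ae_hasDerivAt_integral, h'.integrable.ae_hasDerivAt_integral,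
        hint.ae_hasDerivAt_integral] with s h1 h2 h3 hs
      have := (((h1 hs 0 h0).const_add (x 0)).mul ((h2 hs 0 h0).const_add (y 0))).sub
        (h3 hs 0 h0)
      rw [← h.eq_integral s (hu ▸ hs), ← h'.eq_integral s (hu ▸ hs), sub_self] at this
      exact this)
  intro s hs
  have e1 := hC s (hu ▸ hs)
  have e2 := hC 0 h0
  simp only [intervalIntegral.integral_same, sub_zero, add_zero] at e1 e2
  rw [← h.eq_integral s hs, ← h'.eq_integral s hs] at e1
  rw [e2, ← e1]
  ring

end IsPrimitive

/-! ### Existence and uniqueness for equations with integrable Lipschitz constant -/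

/-- If `a` is an integrable density with indefinite integral `m`, then `∫₀ˢ a mⁿ = mⁿ⁺¹ / (n + 1)`. -/
lemma IsPrimitive.integral_mul_pow {ℓ : ℝ} {m a : ℝ → ℝ} (h : IsPrimitive ℓ m a) (hm : m 0 = 0)
    (n : ℕ) {s : ℝ} (hs : s ∈ Icc 0 ℓ) :
    ∫ t in (0 : ℝ)..s, a t * m t ^ n = m s ^ (n + 1) / (n + 1) := by
  have key : ∀ n : ℕ, IsPrimitive ℓ (fun t => m t ^ (n + 1))
      (fun t => (n + 1) * (a t * m t ^ n)) := by
    intro n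
    induction n with
    | zero => simpa using h
    | succ n ih =>
      refine ((ih.mul h).congr fun t _ => ?_).congr_density fun t => ?_
      · ring
      · push_cast; ring
  have := (key n).eq_integral s hs
  simp only [hm, intervalIntegral.integral_const_mul] at this
  rw [this]
  have : (n : ℝ) + 1 ≠ 0 := by positivity
  simp [this]

section Volterra

variable {E : Type*} [NormedAddCommGroup E]

/-- The Picard iterates of an equation whose right-hand side has the integrable Lipschitz constant
`a` at time `t`, measured against the powers of the indefinite integral of `a`. -/
lemma dist_iterate_le_of_integral_le {ℓ : ℝ} {a m : ℝ → ℝ} (hm : IsPrimitive ℓ m a)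
    (hm0 : m 0 = 0) (ha : ∀ t, 0 ≤ a t) (T : C(Icc (0 : ℝ) ℓ, E) → C(Icc (0 : ℝ) ℓ, E))
    (hT : ∀ X Y (s : Icc (0 : ℝ) ℓ), ‖T X s - T Y s‖ ≤
      ∫ t in (0 : ℝ)..s, a t * ‖X (projIcc 0 ℓ hm.nonneg t) - Y (projIcc 0 ℓ hm.nonneg t)‖)
    (n : ℕ) (X Y : C(Icc (0 : ℝ) ℓ, E)) (s : Icc (0 : ℝ) ℓ) :
    ‖T^[n] X s - T^[n] Y s‖ ≤ m s ^ n / n.factorial * dist X Y := by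
  induction n generalizing s with
  | zero => simpa [dist_eq_norm] using ContinuousMap.norm_coe_le_norm (X - Y) s
  | succ n ih =>
    rw [Function.iterate_succ_apply', Function.iterate_succ_apply']
    refine (hT _ _ s).trans ?_
    have hsub : Icc 0 (s : ℝ) ⊆ Icc 0 ℓ := Icc_subset_Icc le_rfl s.2.2
    have hi : IntervalIntegrable a volume 0 s := hm.intervalIntegrable hm.zero_mem s.2
    have hu : uIcc (0 : ℝ) s = Icc 0 (s : ℝ) := uIcc_of_le s.2.1
    calc _ ≤ ∫ t in (0 : ℝ)..s, a t * m t ^ n * (dist X Y / n.factorial) := by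
          apply intervalIntegral.integral_mono_on s.2.1
          · apply hi.mul_continuousOn
            apply Continuous.continuousOn
            fun_prop
          · exact (hi.mul_continuousOn (hu ▸ (hm.continuousOn.mono hsub).pow n)).mul_const _
          · intro t ht
            have := ih ⟨t, hsub ht⟩
            rw [projIcc_of_mem hm.nonneg (hsub ht), mul_assoc]
            refine mul_le_mul_of_nonneg_left (this.trans_eq ?_) (ha t)
            ring
      _ = _ := by
          rw [intervalIntegral.integral_mul_const, hm.integral_mul_pow hm0 n s.2,
            Nat.factorial_succ]
          push_cast
          field_simp

variable {ℓ : ℝ} {f : ℝ → E → E} {a : ℝ → ℝ}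

/-- Existence for the equation `y' = f(t, y)` in integrated form, when `f(t, ·)` is Lipschitz with
constant `a(t)` and `a` is integrable. -/
theorem exists_solution_of_integrable_lipschitz [NormedSpace ℝ E] [CompleteSpace E] (hℓ : 0 ≤ ℓ)
    (ha : IntervalIntegrable a volume 0 ℓ) (ha0 : ∀ t, 0 ≤ a t)
    (hf : ∀ t x y, ‖f t x - f t y‖ ≤ a t * ‖x - y‖)
    (hfi : ∀ Y : ℝ → E, Continuous Y → IntervalIntegrable (fun t => f t (Y t)) volume 0 ℓ)
    (y₀ : E) :
    ∃ Y : ℝ → E, Y 0 = y₀ ∧ IsPrimitive ℓ Y (fun t => f t (Y t)) := by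
  have hmem : (0 : ℝ) ∈ Icc 0 ℓ := ⟨le_rfl, hℓ⟩
  have hprim : ∀ X : C(Icc (0 : ℝ) ℓ, E),
      IsPrimitive ℓ (fun s => y₀ + ∫ t in (0 : ℝ)..s, f t (X (projIcc 0 ℓ hℓ t)))
        (fun t => f t (X (projIcc 0 ℓ hℓ t))) := fun X =>
    ⟨hℓ, hfi _ (by fun_prop), fun s _ => by simp⟩
  let T : C(Icc (0 : ℝ) ℓ, E) → C(Icc (0 : ℝ) ℓ, E) := fun X =>
    ⟨fun s => y₀ + ∫ t in (0 : ℝ)..s, f t (X (projIcc 0 ℓ hℓ t)),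
      continuousOn_iff_continuous_domRestrict.1 (hprim X).continuousOn⟩
  have hm : IsPrimitive ℓ (fun s => ∫ t in (0 : ℝ)..s, a t) a := ⟨hℓ, ha, fun s _ => by simp⟩
  have hT : ∀ X Y (s : Icc (0 : ℝ) ℓ), ‖T X s - T Y s‖ ≤
      ∫ t in (0 : ℝ)..s, a t * ‖X (projIcc 0 ℓ hℓ t) - Y (projIcc 0 ℓ hℓ t)‖ := by
    intro X Y s
    change ‖(y₀ + _) - (y₀ + _)‖ ≤ _
    rw [add_sub_add_left_eq_sub, ← intervalIntegral.integral_sub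
      ((hprim X).intervalIntegrable hmem s.2) ((hprim Y).intervalIntegrable hmem s.2)]
    refine intervalIntegral.norm_integral_le_of_norm_le s.2.1
      (Eventually.of_forall fun t _ => hf _ _ _) ?_
    apply (hm.intervalIntegrable hmem s.2).mul_continuousOn
    apply Continuous.continuousOn
    fun_prop
  have hiter := dist_iterate_le_of_integral_le hm (by simp) ha0 T hT
  set Λ := ∫ t in (0 : ℝ)..ℓ, a t with hΛ
  have hΛ0 : 0 ≤ Λ := intervalIntegral.integral_nonneg hℓ fun t _ => ha0 t
  obtain ⟨n, hn⟩ := (FloorSemiring.tendsto_pow_div_factorial_atTop Λ).eventually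
    (gt_mem_nhds zero_lt_one) |>.exists
  have hnn : 0 ≤ Λ ^ n / n.factorial := by positivity
  have hcontr : ContractingWith (Real.toNNReal (Λ ^ n / n.factorial)) T^[n] := by
    refine ⟨Real.toNNReal_lt_one.2 hn, LipschitzWith.of_dist_le_mul fun X Y => ?_⟩
    rw [Real.coe_toNNReal _ hnn, ContinuousMap.dist_le (mul_nonneg hnn dist_nonneg)]
    intro s
    rw [dist_eq_norm]
    refine (hiter n X Y s).trans ?_
    have h1 : 0 ≤ ∫ t in (0 : ℝ)..s, a t :=
      intervalIntegral.integral_nonneg s.2.1 fun t _ => ha0 t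
    have h2 : ∫ t in (0 : ℝ)..s, a t ≤ Λ :=
      intervalIntegral.integral_mono_interval le_rfl s.2.1 s.2.2
        (Eventually.of_forall ha0) ha
    gcongr
  have : Nonempty (Icc (0 : ℝ) ℓ) := ⟨⟨0, hmem⟩⟩
  have hfix := hcontr.isFixedPt_fixedPoint_iterate
  set X := ContractingWith.fixedPoint T^[n] hcontr
  refine ⟨fun s => X (projIcc 0 ℓ hℓ s), ?_, hℓ, (hprim X).integrable, fun s hs => ?_⟩
  · have := DFunLike.congr_fun hfix (⟨0, hmem⟩ : Icc (0 : ℝ) ℓ)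
    beta_reduce
    rw [projIcc_of_mem hℓ hmem, ← this]
    change y₀ + _ = _
    simp
  · have h1 := DFunLike.congr_fun hfix (⟨0, hmem⟩ : Icc (0 : ℝ) ℓ)
    have h2 := DFunLike.congr_fun hfix (⟨s, hs⟩ : Icc (0 : ℝ) ℓ)
    beta_reduce
    rw [projIcc_of_mem hℓ hmem, projIcc_of_mem hℓ hs, ← h1, ← h2]
    change y₀ + _ = y₀ + _ + _
    simp

/-- Gronwall's inequality, with an integrable coefficient and without inhomogeneity. -/
theorem eq_zero_of_norm_le_integral (hℓ : 0 ≤ ℓ) (ha : IntervalIntegrable a volume 0 ℓ)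
    (ha0 : ∀ t, 0 ≤ a t) {D : ℝ → E} (hD : ContinuousOn D (Icc 0 ℓ))
    (hle : ∀ s ∈ Icc 0 ℓ, ‖D s‖ ≤ ∫ t in (0 : ℝ)..s, a t * ‖D t‖) :
    ∀ s ∈ Icc 0 ℓ, D s = 0 := by
  have hm : IsPrimitive ℓ (fun s => ∫ t in (0 : ℝ)..s, a t) a := ⟨hℓ, ha, fun s _ => by simp⟩
  obtain ⟨C, hC⟩ := isCompact_Icc.exists_bound_of_continuousOn hD
  have key : ∀ n : ℕ, ∀ s ∈ Icc 0 ℓ,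
      ‖D s‖ ≤ (∫ t in (0 : ℝ)..s, a t) ^ n / n.factorial * C := by
    intro n
    induction n with
    | zero => simpa using hC
    | succ n ih =>
      intro s hs
      have hsub : Icc 0 s ⊆ Icc 0 ℓ := Icc_subset_Icc le_rfl hs.2
      have hi : IntervalIntegrable a volume 0 s := hm.intervalIntegrable hm.zero_mem hs
      have hu : uIcc (0 : ℝ) s = Icc 0 s := uIcc_of_le hs.1
      refine (hle s hs).trans ?_
      calc _ ≤ ∫ t in (0 : ℝ)..s, a t * (∫ t in (0 : ℝ)..t, a t) ^ n * (C / n.factorial) := by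
            apply intervalIntegral.integral_mono_on hs.1
            · exact hi.mul_continuousOn (hu ▸ (hD.mono hsub).norm)
            · exact (hi.mul_continuousOn (hu ▸ (hm.continuousOn.mono hsub).pow n)).mul_const _
            · intro t ht
              rw [mul_assoc]
              refine mul_le_mul_of_nonneg_left ((ih t (hsub ht)).trans_eq ?_) (ha0 t)
              ring
        _ = _ := by
            rw [intervalIntegral.integral_mul_const, hm.integral_mul_pow (by simp) n hs,
              Nat.factorial_succ]
            push_cast
            field_simp
  intro s hs
  have hlim := (FloorSemiring.tendsto_pow_div_factorial_atTop
    (∫ t in (0 : ℝ)..s, a t)).mul_const C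
  rw [zero_mul] at hlim
  exact norm_le_zero_iff.1 (ge_of_tendsto' hlim fun n => key n s hs)

end Volterra

/-! ### The vector product -/

lemma cross_zero (x y : E3) : cross x y 0 = x 1 * y 2 - x 2 * y 1 := by
  simp [cross, cross_apply]

lemma cross_one (x y : E3) : cross x y 1 = x 2 * y 0 - x 0 * y 2 := by
  simp [cross, cross_apply]

lemma cross_two (x y : E3) : cross x y 2 = x 0 * y 1 - x 1 * y 0 := by
  simp [cross, cross_apply]

lemma inner_eq_coord (x y : E3) : inner ℝ x y = x 0 * y 0 + x 1 * y 1 + x 2 * y 2 := by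
  simp [PiLp.inner_apply, Fin.sum_univ_three, mul_comm]

lemma norm_sq_eq_coord (x : E3) : ‖x‖ ^ 2 = x 0 ^ 2 + x 1 ^ 2 + x 2 ^ 2 := by
  rw [← real_inner_self_eq_norm_sq, inner_eq_coord]; ring

lemma ext_coord {x y : E3} (h0 : x 0 = y 0) (h1 : x 1 = y 1) (h2 : x 2 = y 2) : x = y := by
  ext i; fin_cases i <;> assumption

lemma abs_coord_le (x : E3) (i : Fin 3) : |x i| ≤ ‖x‖ := PiLp.norm_apply_le x i

lemma norm_cross_sq (x y : E3) : ‖cross x y‖ ^ 2 = ‖x‖ ^ 2 * ‖y‖ ^ 2 - inner ℝ x y ^ 2 := by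
  simp only [norm_sq_eq_coord, inner_eq_coord, cross_zero, cross_one, cross_two]; ring

lemma norm_cross_le (x y : E3) : ‖cross x y‖ ≤ ‖x‖ * ‖y‖ := by
  refine abs_le_of_sq_le_sq' ?_ (by positivity) |>.2
  rw [norm_cross_sq, mul_pow]
  nlinarith [sq_nonneg (inner ℝ x y)]

lemma cross_sub_cross (x y x' y' : E3) :
    cross x y - cross x' y' = cross (x - x') y + cross x' (y - y') := by
  apply ext_coord <;> simp [cross_zero, cross_one, cross_two] <;> ring

lemma continuous_cross : Continuous fun q : E3 × E3 => cross q.1 q.2 := by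
  unfold cross
  apply (PiLp.continuous_toLp 2 _).comp
  simp only [cross_apply]
  fun_prop

lemma _root_.ContinuousOn.cross {α : Type*} [TopologicalSpace α] {f g : α → E3} {s : Set α}
    (hf : ContinuousOn f s) (hg : ContinuousOn g s) :
    ContinuousOn (fun a => KirchhoffLink.cross (f a) (g a)) s :=
  continuous_cross.comp_continuousOn (hf.prodMk hg)

/-- The Gram matrix of three vectors is the identity if and only if the sum of their dyadic squares
is. -/
lemma gram_eq_one_iff (u v w : E3) :
    (∀ i j, u i * u j + v i * v j + w i * w j = if i = j then 1 else 0) ↔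
      ‖u‖ = 1 ∧ ‖v‖ = 1 ∧ ‖w‖ = 1 ∧ inner ℝ u v = 0 ∧ inner ℝ u w = 0 ∧ inner ℝ v w = 0 := by
  let N : Matrix (Fin 3) (Fin 3) ℝ := !![u 0, u 1, u 2; v 0, v 1, v 2; w 0, w 1, w 2]
  have h1 : (∀ i j, u i * u j + v i * v j + w i * w j = if i = j then 1 else 0) ↔
      N.transpose * N = 1 := by
    rw [← Matrix.ext_iff]
    refine forall_congr' fun i => forall_congr' fun j => ?_
    rw [Matrix.one_apply]
    fin_cases i <;> fin_cases j <;> simp [N, Matrix.mul_apply, Fin.sum_univ_three]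
  have n1 : ∀ x : E3, ‖x‖ = 1 ↔ x 0 * x 0 + x 1 * x 1 + x 2 * x 2 = 1 := fun x => by
    rw [← inner_eq_coord, real_inner_self_eq_norm_sq,
      pow_eq_one_iff_of_nonneg (norm_nonneg x) two_ne_zero]
  rw [h1, mul_eq_one_comm, ← Matrix.ext_iff]
  simp only [n1, inner_eq_coord, Fin.forall_fin_succ, Matrix.one_apply, N]
  simp [Matrix.mul_apply, Fin.sum_univ_three]
  constructor
  · rintro ⟨⟨a, b, c⟩, ⟨d, e, f⟩, g, h, i⟩
    exact ⟨a, e, i, b, c, f⟩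
  · rintro ⟨a, e, i, b, c, f⟩
    exact ⟨⟨a, b, c⟩, ⟨by linarith, e, f⟩, by linarith, by linarith, i⟩

lemma norm_cross_of_orthonormal {u v : E3} (hu : ‖u‖ = 1) (hv : ‖v‖ = 1)
    (huv : inner ℝ u v = 0) : ‖cross u v‖ = 1 := by
  have := norm_cross_sq u v
  rw [hu, hv, huv] at this
  exact (pow_eq_one_iff_of_nonneg (norm_nonneg _) two_ne_zero).1 (by linarith)

/-- An orthonormal pair and its vector product form a basis, in which every vector is expanded. -/
lemma orthonormal_expansion {u v : E3} (hu : ‖u‖ = 1) (hv : ‖v‖ = 1) (huv : inner ℝ u v = 0)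
    (x : E3) :
    x = inner ℝ x u • u + inner ℝ x v • v + inner ℝ x (cross u v) • cross u v := by
  have hw := norm_cross_of_orthonormal hu hv huv
  have h := (gram_eq_one_iff u v (cross u v)).2 ⟨hu, hv, hw, huv, by
    simp only [inner_eq_coord, cross_zero, cross_one, cross_two]; ring, by
    simp only [inner_eq_coord, cross_zero, cross_one, cross_two]; ring⟩
  have key : ∀ j, x j = (inner ℝ x u • u + inner ℝ x v • v +
      inner ℝ x (cross u v) • cross u v) j := by
    intro j
    have e0 := h 0 j
    have e1 := h 1 j
    have e2 := h 2 j
    simp only [PiLp.add_apply, PiLp.smul_apply, smul_eq_mul, inner_eq_coord]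
    have : x j = x 0 * (if 0 = j then 1 else 0) + x 1 * (if 1 = j then 1 else 0)
        + x 2 * (if 2 = j then 1 else 0) := by
      fin_cases j <;> simp
    rw [this, ← e0, ← e1, ← e2]
    ring
  exact ext_coord (key 0) (key 1) (key 2)

lemma inner_self_cross (u v : E3) : inner ℝ u (cross u v) = 0 := by
  simp only [inner_eq_coord, cross_zero, cross_one, cross_two]; ring

lemma inner_cross_self (u v : E3) : inner ℝ v (cross u v) = 0 := by
  simp only [inner_eq_coord, cross_zero, cross_one, cross_two]; ring

namespace IsPrimitive

variable {ℓ : ℝ}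

lemma coord {x x' : ℝ → E3} (h : IsPrimitive ℓ x x') (i : Fin 3) :
    IsPrimitive ℓ (fun s => x s i) (fun s => x' s i) :=
  h.comp_clm (EuclideanSpace.proj i : E3 →L[ℝ] ℝ)

lemma of_coord {x x' : ℝ → E3} (h : ∀ i, IsPrimitive ℓ (fun s => x s i) (fun s => x' s i)) :
    IsPrimitive ℓ x x' := by
  have key : ∀ {y : ℝ → E3},
      y = fun s => ∑ i, y s i • (EuclideanSpace.single i (1 : ℝ) : E3) := fun {y} => by
    funext s
    apply ext_coord <;> simp [Fin.sum_univ_three]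
  have h2 : ∀ i, IsPrimitive ℓ (fun s => x s i • (EuclideanSpace.single i (1 : ℝ) : E3))
      (fun s => x' s i • (EuclideanSpace.single i (1 : ℝ) : E3)) := fun i =>
    (h i).comp_clm ((ContinuousLinearMap.id ℝ ℝ).smulRight (EuclideanSpace.single i (1 : ℝ) : E3))
  rw [key (y := x), key (y := x')]
  simp only [Fin.sum_univ_three]
  exact ((h2 0).add (h2 1)).add (h2 2)

lemma inner {x x' y y' : ℝ → E3} (h : IsPrimitive ℓ x x') (h' : IsPrimitive ℓ y y') :
    IsPrimitive ℓ (fun s => inner ℝ (x s) (y s))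
      (fun s => inner ℝ (x' s) (y s) + inner ℝ (x s) (y' s)) := by
  refine (((((h.coord 0).mul (h'.coord 0)).add ((h.coord 1).mul (h'.coord 1))).add
    ((h.coord 2).mul (h'.coord 2))).congr fun t _ => ?_).congr_density fun t => ?_
  · rw [inner_eq_coord]
  · rw [inner_eq_coord, inner_eq_coord]; ring

lemma cross {x x' y y' : ℝ → E3} (h : IsPrimitive ℓ x x') (h' : IsPrimitive ℓ y y') :
    IsPrimitive ℓ (fun s => cross (x s) (y s))
      (fun s => KirchhoffLink.cross (x' s) (y s) + KirchhoffLink.cross (x s) (y' s)) := by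
  refine of_coord fun i => ?_
  fin_cases i
  · refine ((((h.coord 1).mul (h'.coord 2)).sub ((h.coord 2).mul (h'.coord 1))).congr
      fun t _ => ?_).congr_density fun t => ?_
    · simp [cross_zero]
    · simp [cross_zero]; ring
  · refine ((((h.coord 2).mul (h'.coord 0)).sub ((h.coord 0).mul (h'.coord 2))).congr
      fun t _ => ?_).congr_density fun t => ?_
    · simp [cross_one]
    · simp [cross_one]; ring
  · refine ((((h.coord 0).mul (h'.coord 1)).sub ((h.coord 1).mul (h'.coord 0))).congr
      fun t _ => ?_).congr_density fun t => ?_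
    · simp [cross_two]
    · simp [cross_two]; ring

/-- A primitive of a density that vanishes is constant. -/
lemma eq_of_density_zero {x x' : ℝ → ℝ} (h : IsPrimitive ℓ x x') (h0 : ∀ t, x' t = 0) {s : ℝ}
    (hs : s ∈ Icc 0 ℓ) : x s = x 0 := by
  simp [h.eq_integral s hs, h0]

end IsPrimitive

/-! ### The framed midline determined by the densities -/

/-- `F` is an orthonormally framed curve on `[0, ℓ]` with densities `k`: all three directors are
absolutely continuous and satisfy the system of the rod. -/
structure IsFrame (F : FramedCurve) (ℓ : ℝ) (k : ℝ → E3) : Prop where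
  r_prim : IsPrimitive ℓ F.r F.w
  u_prim : IsPrimitive ℓ F.u (fun t => -(k t 0) • F.w t - k t 2 • F.v t)
  v_prim : IsPrimitive ℓ F.v (fun t => k t 2 • F.u t - k t 1 • F.w t)
  w_prim : IsPrimitive ℓ F.w (fun t => k t 0 • F.u t + k t 1 • F.v t)
  norm_u : ∀ s ∈ Icc 0 ℓ, ‖F.u s‖ = 1
  norm_v : ∀ s ∈ Icc 0 ℓ, ‖F.v s‖ = 1
  inner_uv : ∀ s ∈ Icc 0 ℓ, inner ℝ (F.u s) (F.v s) = 0

lemma IsFrame.norm_w {F : FramedCurve} {ℓ : ℝ} {k : ℝ → E3} (h : IsFrame F ℓ k) {s : ℝ}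
    (hs : s ∈ Icc 0 ℓ) : ‖F.w s‖ = 1 :=
  norm_cross_of_orthonormal (h.norm_u s hs) (h.norm_v s hs) (h.inner_uv s hs)

lemma intervalIntegrable_coord {k : ℝ → E3} {a b : ℝ} (hk : IntervalIntegrable k volume a b)
    (i : Fin 3) : IntervalIntegrable (fun t => k t i) volume a b :=
  ⟨(EuclideanSpace.proj i : E3 →L[ℝ] ℝ).integrable_comp hk.1,
    (EuclideanSpace.proj i : E3 →L[ℝ] ℝ).integrable_comp hk.2⟩

/-- The linear system for the three directors is solved by an orthonormal frame. -/
lemma exists_orthonormal_solution {ℓ : ℝ} (hℓ : 0 ≤ ℓ) {k : ℝ → E3}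
    (hk : IntervalIntegrable k volume 0 ℓ) {b : InitialValue} (hb : b.IsOrthonormal) :
    ∃ u v w : ℝ → E3, u 0 = b.u ∧ v 0 = b.v ∧
      IsPrimitive ℓ u (fun t => -(k t 0) • w t - k t 2 • v t) ∧
      IsPrimitive ℓ v (fun t => k t 2 • u t - k t 1 • w t) ∧
      IsPrimitive ℓ w (fun t => k t 0 • u t + k t 1 • v t) ∧
      ∀ s ∈ Icc 0 ℓ, ‖u s‖ = 1 ∧ ‖v s‖ = 1 ∧ inner ℝ (u s) (v s) = 0 ∧
        w s = cross (u s) (v s) := by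
  let f : ℝ → E3 × E3 × E3 → E3 × E3 × E3 := fun t X =>
    (-(k t 0) • X.2.2 - k t 2 • X.2.1, k t 2 • X.1 - k t 1 • X.2.2, k t 0 • X.1 + k t 1 • X.2.1)
  have hk' := intervalIntegrable_coord hk
  have aux : ∀ (t : ℝ) (i j : Fin 3) (x y : E3) (d : ℝ), ‖x‖ ≤ d → ‖y‖ ≤ d →
      ‖k t i • x‖ + ‖k t j • y‖ ≤ 2 * ‖k t‖ * d := by
    intro t i j x y d hx hy
    rw [norm_smul, norm_smul, Real.norm_eq_abs, Real.norm_eq_abs]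
    have := mul_le_mul (abs_coord_le (k t) i) hx (norm_nonneg _) (norm_nonneg _)
    have := mul_le_mul (abs_coord_le (k t) j) hy (norm_nonneg _) (norm_nonneg _)
    linarith
  obtain ⟨Y, hY0, hY⟩ := exists_solution_of_integrable_lipschitz (f := f)
    (a := fun t => 2 * ‖k t‖) hℓ (hk.norm.const_mul 2) (fun t => by positivity)
    (by
      intro t X Z
      have h1 : ‖X.1 - Z.1‖ ≤ ‖X - Z‖ := norm_fst_le (X - Z)
      have h2 : ‖X.2.1 - Z.2.1‖ ≤ ‖X - Z‖ :=
        (norm_fst_le (X.2 - Z.2)).trans (norm_snd_le (X - Z))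
      have h3 : ‖X.2.2 - Z.2.2‖ ≤ ‖X - Z‖ :=
        (norm_snd_le (X.2 - Z.2)).trans (norm_snd_le (X - Z))
      simp only [f, Prod.mk_sub_mk, Prod.norm_mk]
      refine max_le ?_ (max_le ?_ ?_)
      · rw [show -(k t 0) • X.2.2 - k t 2 • X.2.1 - (-(k t 0) • Z.2.2 - k t 2 • Z.2.1) =
          -(k t 0 • (X.2.2 - Z.2.2)) - k t 2 • (X.2.1 - Z.2.1) by module]
        exact (norm_sub_le _ _).trans ((norm_neg (k t 0 • (X.2.2 - Z.2.2))).symm ▸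
          aux t 0 2 _ _ _ h3 h2)
      · rw [show k t 2 • X.1 - k t 1 • X.2.2 - (k t 2 • Z.1 - k t 1 • Z.2.2) =
          k t 2 • (X.1 - Z.1) - k t 1 • (X.2.2 - Z.2.2) by module]
        exact (norm_sub_le _ _).trans (aux t 2 1 _ _ _ h1 h3)
      · rw [show k t 0 • X.1 + k t 1 • X.2.1 - (k t 0 • Z.1 + k t 1 • Z.2.1) =
          k t 0 • (X.1 - Z.1) + k t 1 • (X.2.1 - Z.2.1) by module]
        exact (norm_add_le _ _).trans (aux t 0 1 _ _ _ h1 h2))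
    (by
      intro X hX
      have c1 : ContinuousOn (fun t => (X t).1) (uIcc 0 ℓ) := hX.fst.continuousOn
      have c2 : ContinuousOn (fun t => (X t).2.1) (uIcc 0 ℓ) := hX.snd.fst.continuousOn
      have c3 : ContinuousOn (fun t => (X t).2.2) (uIcc 0 ℓ) := hX.snd.snd.continuousOn
      have i1 := ((hk' 0).neg.smul_continuousOn c3).sub ((hk' 2).smul_continuousOn c2)
      have i2 := ((hk' 2).smul_continuousOn c1).sub ((hk' 1).smul_continuousOn c3)
      have i3 := ((hk' 0).smul_continuousOn c1).add ((hk' 1).smul_continuousOn c2)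
      exact ⟨i1.1.prodMk (i2.1.prodMk i3.1), i1.2.prodMk (i2.2.prodMk i3.2)⟩)
    (b.u, b.v, cross b.u b.v)
  set u : ℝ → E3 := fun t => (Y t).1 with hu
  set v : ℝ → E3 := fun t => (Y t).2.1 with hv
  set w : ℝ → E3 := fun t => (Y t).2.2 with hw
  have pu : IsPrimitive ℓ u (fun t => -(k t 0) • w t - k t 2 • v t) :=
    hY.comp_clm (ContinuousLinearMap.fst ℝ E3 (E3 × E3))
  have pv : IsPrimitive ℓ v (fun t => k t 2 • u t - k t 1 • w t) :=
    hY.comp_clm ((ContinuousLinearMap.fst ℝ E3 E3).comp (ContinuousLinearMap.snd ℝ E3 (E3 × E3)))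
  have pw : IsPrimitive ℓ w (fun t => k t 0 • u t + k t 1 • v t) :=
    hY.comp_clm ((ContinuousLinearMap.snd ℝ E3 E3).comp (ContinuousLinearMap.snd ℝ E3 (E3 × E3)))
  have u0 : u 0 = b.u := by simp [hu, hY0]
  have v0 : v 0 = b.v := by simp [hv, hY0]
  have w0 : w 0 = cross b.u b.v := by simp [hw, hY0]
  refine ⟨u, v, w, u0, v0, pu, pv, pw, fun s hs => ?_⟩
  -- The coefficient matrix is skew, so the sum of the dyadic squares of the directors is constant.
  have gram : ∀ i j, u s i * u s j + v s i * v s j + w s i * w s j = if i = j then 1 else 0 := by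
    intro i j
    have := ((((pu.coord i).mul (pu.coord j)).add ((pv.coord i).mul (pv.coord j))).add
      ((pw.coord i).mul (pw.coord j))).eq_of_density_zero (fun t => by
        simp only [PiLp.sub_apply, PiLp.add_apply, PiLp.smul_apply, smul_eq_mul]; ring) hs
    rw [this, u0, v0, w0]
    exact (gram_eq_one_iff b.u b.v (cross b.u b.v)).2 ⟨hb.1, hb.2.1,
      norm_cross_of_orthonormal hb.1 hb.2.1 hb.2.2, hb.2.2, inner_self_cross _ _,
      inner_cross_self _ _⟩ i j
  obtain ⟨nu, nv, nw, iuv, iuw, ivw⟩ := (gram_eq_one_iff _ _ _).1 gram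
  refine ⟨nu, nv, iuv, ?_⟩
  -- It is also traceless, so the determinant of the directors is constant.
  have det := ((pw.inner (pu.cross pv)).congr_density (y' := fun _ => 0) (fun t => by
    simp only [inner_eq_coord, cross_zero, cross_one, cross_two, PiLp.sub_apply, PiLp.add_apply,
      PiLp.smul_apply, smul_eq_mul]; ring)).eq_of_density_zero (fun _ => rfl) hs
  rw [u0, v0, w0, real_inner_self_eq_norm_sq,
    norm_cross_of_orthonormal hb.1 hb.2.1 hb.2.2] at det
  rw [← sub_eq_zero, ← norm_eq_zero, ← sq_eq_zero_iff, norm_sub_sq_real, det, nw,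
    norm_cross_of_orthonormal nu nv iuv]
  norm_num

lemma exists_isFrame {ℓ : ℝ} (hℓ : 0 ≤ ℓ) {k : ℝ → E3}
    (hk : IntervalIntegrable k volume 0 ℓ) {b : InitialValue} (hb : b.IsOrthonormal) :
    ∃ F : FramedCurve, IsFrame F ℓ k ∧ F.r 0 = b.r ∧ F.u 0 = b.u ∧ F.v 0 = b.v := by
  obtain ⟨u, v, w, u0, v0, pu, pv, pw, h⟩ := exists_orthonormal_solution hℓ hk hb
  have hsub : ∀ t ∈ Ioc 0 ℓ, w t = cross (u t) (v t) := fun t ht =>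
    (h t (Ioc_subset_Icc_self ht)).2.2.2
  let F : FramedCurve := ⟨fun s => b.r + ∫ t in (0 : ℝ)..s, cross (u t) (v t), u, v⟩
  have hw : IsPrimitive ℓ F.w (fun t => k t 0 • F.u t + k t 1 • F.v t) :=
    pw.congr fun t ht => (h t ht).2.2.2
  refine ⟨F, ⟨⟨hℓ, ?_, fun s _ => by simp [F]; rfl⟩, ?_, ?_, hw, fun s hs => (h s hs).1,
    fun s hs => (h s hs).2.1, fun s hs => (h s hs).2.2.1⟩, by simp [F], u0, v0⟩
  · apply ContinuousOn.intervalIntegrable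
    rw [uIcc_of_le hℓ]
    exact hw.continuousOn
  · exact pu.congr_ae (Eventually.of_forall fun t ht => by rw [hsub t ht]; rfl)
  · exact pv.congr_ae (Eventually.of_forall fun t ht => by rw [hsub t ht]; rfl)

lemma IsFrame.solves {F : FramedCurve} {ℓ : ℝ} {k : ℝ → E3} (h : IsFrame F ℓ k)
    {b : InitialValue} (hr : F.r 0 = b.r) (hu : F.u 0 = b.u) (hv : F.v 0 = b.v) :
    F.Solves ℓ k b :=
  ⟨h.r_prim.continuousOn, h.u_prim.continuousOn, h.v_prim.continuousOn, fun s hs =>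
    ⟨hr ▸ h.r_prim.eq_integral s hs, hu ▸ h.u_prim.eq_integral s hs,
      hv ▸ h.v_prim.eq_integral s hs⟩⟩

namespace FramedCurve.Solves

variable {F G : FramedCurve} {ℓ : ℝ} {k : ℝ → E3} {b : InitialValue}

lemma continuousOn_w (h : F.Solves ℓ k b) : ContinuousOn F.w (Icc 0 ℓ) := h.2.1.cross h.2.2.1

lemma r_zero (h : F.Solves ℓ k b) (hℓ : 0 ≤ ℓ) : F.r 0 = b.r := by
  simpa using (h.2.2.2 0 ⟨le_rfl, hℓ⟩).1

lemma u_zero (h : F.Solves ℓ k b) (hℓ : 0 ≤ ℓ) : F.u 0 = b.u := by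
  simpa using (h.2.2.2 0 ⟨le_rfl, hℓ⟩).2.1

lemma v_zero (h : F.Solves ℓ k b) (hℓ : 0 ≤ ℓ) : F.v 0 = b.v := by
  simpa using (h.2.2.2 0 ⟨le_rfl, hℓ⟩).2.2

lemma r_prim (h : F.Solves ℓ k b) (hℓ : 0 ≤ ℓ) : IsPrimitive ℓ F.r F.w :=
  ⟨hℓ, (uIcc_of_le hℓ ▸ h.continuousOn_w : ContinuousOn F.w (uIcc 0 ℓ)).intervalIntegrable,
    fun s hs => h.r_zero hℓ ▸ (h.2.2.2 s hs).1⟩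

lemma u_prim (h : F.Solves ℓ k b) (hℓ : 0 ≤ ℓ) (hk : IntervalIntegrable k volume 0 ℓ) :
    IsPrimitive ℓ F.u (fun t => -(k t 0) • F.w t - k t 2 • F.v t) := by
  have hu := uIcc_of_le hℓ
  have hk' := intervalIntegrable_coord hk
  exact ⟨hℓ, ((hk' 0).neg.smul_continuousOn (hu ▸ h.continuousOn_w)).sub
    ((hk' 2).smul_continuousOn (hu ▸ h.2.2.1)), fun s hs => h.u_zero hℓ ▸ (h.2.2.2 s hs).2.1⟩

lemma v_prim (h : F.Solves ℓ k b) (hℓ : 0 ≤ ℓ) (hk : IntervalIntegrable k volume 0 ℓ) :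
    IsPrimitive ℓ F.v (fun t => k t 2 • F.u t - k t 1 • F.w t) := by
  have hu := uIcc_of_le hℓ
  have hk' := intervalIntegrable_coord hk
  exact ⟨hℓ, ((hk' 2).smul_continuousOn (hu ▸ h.2.1)).sub
    ((hk' 1).smul_continuousOn (hu ▸ h.continuousOn_w)),
    fun s hs => h.v_zero hℓ ▸ (h.2.2.2 s hs).2.2⟩

/-- Uniqueness for the system of the rod. -/
lemma unique (hF : F.Solves ℓ k b) (hG : G.Solves ℓ k b) (hℓ : 0 ≤ ℓ)
    (hk : IntervalIntegrable k volume 0 ℓ) :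
    ∀ s ∈ Icc 0 ℓ, F.r s = G.r s ∧ F.u s = G.u s ∧ F.v s = G.v s := by
  obtain ⟨C₁, hC₁⟩ := isCompact_Icc.exists_bound_of_continuousOn hF.2.2.1
  obtain ⟨C₂, hC₂⟩ := isCompact_Icc.exists_bound_of_continuousOn hG.2.1
  set C := max 1 (max C₁ C₂)
  have hC : 0 ≤ C := zero_le_one.trans (le_max_left _ _)
  set D : ℝ → E3 × E3 := fun s => (F.u s - G.u s, F.v s - G.v s) with hD
  have hprim : IsPrimitive ℓ D (fun t =>
      (-(k t 0) • (F.w t - G.w t) - k t 2 • (F.v t - G.v t),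
        k t 2 • (F.u t - G.u t) - k t 1 • (F.w t - G.w t))) := by
    have h1 := ((hF.u_prim hℓ hk).sub (hG.u_prim hℓ hk)).comp_clm
      (ContinuousLinearMap.inl ℝ E3 E3)
    have h2 := ((hF.v_prim hℓ hk).sub (hG.v_prim hℓ hk)).comp_clm
      (ContinuousLinearMap.inr ℝ E3 E3)
    refine ((h1.add h2).congr fun t _ => ?_).congr_density fun t => ?_
    · simp [hD]
    · simp only [ContinuousLinearMap.inl_apply, ContinuousLinearMap.inr_apply, Prod.mk_add_mk,
        add_zero, zero_add]
      refine Prod.ext ?_ ?_ <;> module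
  have hw : ∀ t ∈ Icc 0 ℓ, ‖F.w t - G.w t‖ ≤ 2 * C * ‖D t‖ := by
    intro t ht
    have e1 : ‖F.u t - G.u t‖ ≤ ‖D t‖ := norm_fst_le (D t)
    have e2 : ‖F.v t - G.v t‖ ≤ ‖D t‖ := norm_snd_le (D t)
    have e3 : ‖F.v t‖ ≤ C := (hC₁ t ht).trans ((le_max_left _ _).trans (le_max_right _ _))
    have e4 : ‖G.u t‖ ≤ C := (hC₂ t ht).trans ((le_max_right _ _).trans (le_max_right _ _))
    rw [FramedCurve.w, FramedCurve.w, cross_sub_cross]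
    refine (norm_add_le _ _).trans ?_
    have e5 := (norm_cross_le (F.u t - G.u t) (F.v t)).trans
      (mul_le_mul e1 e3 (norm_nonneg _) (norm_nonneg _))
    have e6 := (norm_cross_le (G.u t) (F.v t - G.v t)).trans
      (mul_le_mul e4 e2 (norm_nonneg _) hC)
    linarith
  have h0 : ∀ s ∈ Icc 0 ℓ, D s = 0 := by
    refine eq_zero_of_norm_le_integral (a := fun t => 3 * C * ‖k t‖) hℓ (hk.norm.const_mul _)
      (fun t => by positivity) hprim.continuousOn fun s hs => ?_
    have hD0 : D 0 = 0 := by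
      simp [hD, hF.u_zero hℓ, hG.u_zero hℓ, hF.v_zero hℓ, hG.v_zero hℓ]
    have hsub : Icc 0 s ⊆ Icc 0 ℓ := Icc_subset_Icc le_rfl hs.2
    rw [hprim.eq_integral s hs, hD0, zero_add]
    refine intervalIntegral.norm_integral_le_of_norm_le hs.1
      (Eventually.of_forall fun t ht => ?_) ?_
    · have ht' : t ∈ Icc 0 ℓ := hsub (Ioc_subset_Icc_self ht)
      have hwt := hw t ht'
      have e1 : ‖F.u t - G.u t‖ ≤ ‖D t‖ := norm_fst_le (D t)
      have e2 : ‖F.v t - G.v t‖ ≤ ‖D t‖ := norm_snd_le (D t)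
      have hDC : ‖D t‖ ≤ C * ‖D t‖ := le_mul_of_one_le_left (norm_nonneg _) (le_max_left _ _)
      have a : ∀ (i : Fin 3) {x : E3} {d : ℝ}, ‖x‖ ≤ d → ‖k t i • x‖ ≤ ‖k t‖ * d := by
        intro i x d hx
        rw [norm_smul]
        exact mul_le_mul (abs_coord_le (k t) i) hx (norm_nonneg _) (norm_nonneg _)
      have b0 := a 0 hwt
      have b1 := a 1 hwt
      have b2 := a 2 (e1.trans hDC)
      have b3 := a 2 (e2.trans hDC)
      rw [Prod.norm_mk]
      refine max_le ?_ ?_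
      · rw [neg_smul]
        refine (norm_sub_le _ _).trans ?_
        rw [norm_neg]
        linarith
      · refine (norm_sub_le _ _).trans ?_
        linarith
    · refine ((hk.norm.const_mul (3 * C)).mono_set ?_).mul_continuousOn ?_
      · rw [uIcc_of_le hs.1, uIcc_of_le hℓ]; exact hsub
      · rw [uIcc_of_le hs.1]; exact (hprim.continuousOn.mono hsub).norm
  have huv : ∀ s ∈ Icc 0 ℓ, F.u s = G.u s ∧ F.v s = G.v s := fun s hs => by
    have := h0 s hs
    rw [hD, Prod.mk_eq_zero, sub_eq_zero, sub_eq_zero] at this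
    exact this
  refine fun s hs => ⟨?_, huv s hs⟩
  rw [(hF.2.2.2 s hs).1, (hG.2.2.2 s hs).1]
  congr 1
  refine intervalIntegral.integral_congr fun t ht => ?_
  rw [uIcc_of_le hs.1] at ht
  obtain ⟨e1, e2⟩ := huv t ⟨ht.1, ht.2.trans hs.2⟩
  simp only [FramedCurve.w, e1, e2]

lemma isFrame (hF : F.Solves ℓ k b) (hℓ : 0 ≤ ℓ) (hk : IntervalIntegrable k volume 0 ℓ)
    (hb : b.IsOrthonormal) : IsFrame F ℓ k := by
  obtain ⟨G, hG, h1, h2, h3⟩ := exists_isFrame hℓ hk hb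
  have hu := hF.unique (hG.solves h1 h2 h3) hℓ hk
  have hw : ∀ t ∈ Icc 0 ℓ, F.w t = G.w t := fun t ht => by
    simp only [FramedCurve.w, (hu t ht).2.1, (hu t ht).2.2]
  exact
    { r_prim := hF.r_prim hℓ
      u_prim := hF.u_prim hℓ hk
      v_prim := hF.v_prim hℓ hk
      w_prim := (hG.w_prim.congr fun t ht => (hw t ht).symm).congr_ae
        (Eventually.of_forall fun t ht => by
          rw [(hu t (Ioc_subset_Icc_self ht)).2.1, (hu t (Ioc_subset_Icc_self ht)).2.2])
      norm_u := fun s hs => (hu s hs).2.1 ▸ hG.norm_u s hs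
      norm_v := fun s hs => (hu s hs).2.2 ▸ hG.norm_v s hs
      inner_uv := fun s hs => by rw [(hu s hs).2.1, (hu s hs).2.2]; exact hG.inner_uv s hs }

end FramedCurve.Solves

section Density

variable {p : ℝ}

lemma integrable_density (hp : 1 < p) {ℓ : ℝ} (z : Density p ℓ) :
    Integrable z (volume.restrict (Icc 0 ℓ)) :=
  (Lp.memLp z).integrable (by simpa using hp.le)

lemma intervalIntegrable_density (hp : 1 < p) {ℓ : ℝ} (hℓ : 0 ≤ ℓ) (z : Density p ℓ) :
    IntervalIntegrable z volume 0 ℓ := by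
  rw [intervalIntegrable_iff_integrableOn_Icc_of_le hℓ]
  exact integrable_density hp z

lemma Rod.frame_solves (hp : 1 < p) (B : Rod p) (z : Density p B.ℓ) {b : InitialValue}
    (hb : b.IsOrthonormal) : (B.frame z b).Solves B.ℓ z b := by
  obtain ⟨F, hF, h1, h2, h3⟩ :=
    exists_isFrame B.ℓ_pos.le (intervalIntegrable_density hp B.ℓ_pos.le z) hb
  exact Classical.epsilon_spec (p := fun F : FramedCurve => F.Solves B.ℓ z b)
    ⟨F, hF.solves h1 h2 h3⟩

lemma Rod.isFrame (hp : 1 < p) (B : Rod p) (z : Density p B.ℓ) {b : InitialValue}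
    (hb : b.IsOrthonormal) : IsFrame (B.frame z b) B.ℓ z :=
  (B.frame_solves hp z hb).isFrame B.ℓ_pos.le (intervalIntegrable_density hp B.ℓ_pos.le z) hb

end Density

/-! ### The height over the cross-sectional planes -/

namespace FramedCurve

/-- The height of the point `P` over the plane of the cross-section at `s`. -/
noncomputable def height (F : FramedCurve) (s : ℝ) (P : E3) : ℝ := inner ℝ (P - F.r s) (F.w s)

/-- The coordinates, with respect to the directors at `s`, of the projection of `P` to the plane of
the cross-section at `s`. -/
noncomputable def sectionCoord (F : FramedCurve) (s : ℝ) (P : E3) : ℝ × ℝ :=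
  (inner ℝ (P - F.r s) (F.u s), inner ℝ (P - F.r s) (F.v s))

end FramedCurve

/-- The parameters `s` and `t` of a closed curve on `[0, ℓ]` have distance less than `δ` along the
curve. -/
def CyclicNear (ℓ δ s t : ℝ) : Prop := |t - s| < δ ∨ ℓ - δ < |t - s|

lemma CyclicNear.mono {ℓ δ δ' s t : ℝ} (h : CyclicNear ℓ δ s t) (hd : δ ≤ δ') :
    CyclicNear ℓ δ' s t :=
  h.imp (fun h => h.trans_le hd) fun h => by linarith

/-- Uniform convergence on `[0, ℓ]` of midlines and directors. -/
structure TendstoFrame {ι : Type*} (Fs : ι → FramedCurve) (l : Filter ι) (F : FramedCurve)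
    (ℓ : ℝ) : Prop where
  r : TendstoUniformlyOn (fun i => (Fs i).r) F.r l (Icc 0 ℓ)
  u : TendstoUniformlyOn (fun i => (Fs i).u) F.u l (Icc 0 ℓ)
  v : TendstoUniformlyOn (fun i => (Fs i).v) F.v l (Icc 0 ℓ)
  w : TendstoUniformlyOn (fun i => (Fs i).w) F.w l (Icc 0 ℓ)

lemma tendstoFrame_const {ι : Type*} (l : Filter ι) (F : FramedCurve) (ℓ : ℝ) :
    TendstoFrame (fun _ : ι => F) l F ℓ := by
  constructor <;>
  · rw [Metric.tendstoUniformlyOn_iff]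
    intro ε hε
    simp [hε]

namespace IsFrame

variable {F : FramedCurve} {ℓ : ℝ} {k : ℝ → E3}

lemma continuousOn_sectionCoord (h : IsFrame F ℓ k) (P : E3) :
    ContinuousOn (fun s => F.sectionCoord s P) (Icc 0 ℓ) := by
  have hr : ContinuousOn (fun s => P - F.r s) (Icc 0 ℓ) :=
    continuousOn_const.sub h.r_prim.continuousOn
  exact (hr.inner h.u_prim.continuousOn).prodMk (hr.inner h.v_prim.continuousOn)

lemma position_sectionCoord (h : IsFrame F ℓ k) {s : ℝ} (hs : s ∈ Icc 0 ℓ) {P : E3}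
    (hP : F.height s P = 0) : F.position (s, F.sectionCoord s P) = P := by
  have := orthonormal_expansion (h.norm_u s hs) (h.norm_v s hs) (h.inner_uv s hs) (P - F.r s)
  rw [show inner ℝ (P - F.r s) (cross (F.u s) (F.v s)) = 0 from hP, zero_smul, add_zero] at this
  simp only [FramedCurve.position, FramedCurve.sectionCoord]
  rw [add_assoc, ← this]
  abel

lemma sectionCoord_position (h : IsFrame F ℓ k) {s : ℝ} (hs : s ∈ Icc 0 ℓ) (ζ : ℝ × ℝ) :
    F.sectionCoord s (F.position (s, ζ)) = ζ := by
  have e : F.position (s, ζ) - F.r s = ζ.1 • F.u s + ζ.2 • F.v s := by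
    simp only [FramedCurve.position]; abel
  have hvu : inner ℝ (F.v s) (F.u s) = 0 := by rw [real_inner_comm]; exact h.inner_uv s hs
  simp only [FramedCurve.sectionCoord, e, inner_add_left, real_inner_smul_left,
    real_inner_self_eq_norm_sq, h.norm_u s hs, h.norm_v s hs, h.inner_uv s hs, hvu]
  simp

lemma height_position (F : FramedCurve) (s : ℝ) (ζ : ℝ × ℝ) :
    F.height s (F.position (s, ζ)) = 0 := by
  have e : F.position (s, ζ) - F.r s = ζ.1 • F.u s + ζ.2 • F.v s := by
    simp only [FramedCurve.position]; abel
  simp only [FramedCurve.height, e, inner_add_left, real_inner_smul_left, FramedCurve.w,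
    inner_self_cross, inner_cross_self]
  simp

lemma norm_position_sub_sq (h : IsFrame F ℓ k) {s : ℝ} (hs : s ∈ Icc 0 ℓ) (ζ : ℝ × ℝ) :
    ‖F.position (s, ζ) - F.r s‖ ^ 2 = ζ.1 ^ 2 + ζ.2 ^ 2 := by
  have e : F.position (s, ζ) - F.r s = ζ.1 • F.u s + ζ.2 • F.v s := by
    simp only [FramedCurve.position]; abel
  rw [e, norm_add_sq_real, norm_smul, norm_smul, real_inner_smul_left, real_inner_smul_right,
    h.norm_u s hs, h.norm_v s hs, h.inner_uv s hs]
  simp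

lemma sectionCoord_sq_le (h : IsFrame F ℓ k) {s : ℝ} (hs : s ∈ Icc 0 ℓ) (P : E3) :
    (F.sectionCoord s P).1 ^ 2 + (F.sectionCoord s P).2 ^ 2 ≤ ‖P - F.r s‖ ^ 2 := by
  have hexp := orthonormal_expansion (h.norm_u s hs) (h.norm_v s hs) (h.inner_uv s hs) (P - F.r s)
  have : ‖P - F.r s‖ ^ 2 = inner ℝ (P - F.r s) (P - F.r s) :=
    (real_inner_self_eq_norm_sq _).symm
  rw [this]
  conv_rhs => rw [hexp, inner_add_left, inner_add_left, real_inner_smul_left,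
    real_inner_smul_left, real_inner_smul_left, ← hexp, real_inner_comm (P - F.r s),
    real_inner_comm (P - F.r s), real_inner_comm (P - F.r s)]
  simp only [FramedCurve.sectionCoord]
  nlinarith [sq_nonneg (inner ℝ (P - F.r s) (cross (F.u s) (F.v s)))]

/-- The height of a fixed point decreases along the rod, with the Jacobian of the position as its
rate. The twist density does not enter. -/
lemma height_prim (h : IsFrame F ℓ k) (P : E3) :
    IsPrimitive ℓ (fun s => F.height s P)
      (fun t => (F.sectionCoord t P).1 * k t 0 + (F.sectionCoord t P).2 * k t 1 - 1) := by
  refine (((IsPrimitive.const h.r_prim.nonneg P).sub h.r_prim).inner h.w_prim).congr_ae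
    (Eventually.of_forall fun t ht => ?_)
  rw [zero_sub, inner_neg_left, real_inner_self_eq_norm_sq, h.norm_w (Ioc_subset_Icc_self ht),
    inner_add_right, real_inner_smul_right, real_inner_smul_right]
  simp only [FramedCurve.sectionCoord]
  ring

lemma height_sub_le (h : IsFrame F ℓ k) {P : E3} {c a b : ℝ} (ha : a ∈ Icc 0 ℓ)
    (hb : b ∈ Icc 0 ℓ) (hab : a ≤ b)
    (hc : ∀ᵐ t, t ∈ Ioo a b →
      (F.sectionCoord t P).1 * k t 0 + (F.sectionCoord t P).2 * k t 1 ≤ 1 - c) :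
    F.height b P - F.height a P ≤ -(c * (b - a)) := by
  rw [(h.height_prim P).sub_eq_integral ha hb]
  have : -(c * (b - a)) = ∫ _ in a..b, -c := by simp; ring
  rw [this]
  refine intervalIntegral.integral_mono_ae_restrict hab
    ((h.height_prim P).intervalIntegrable ha hb) (by simp) ?_
  have hne : ∀ᵐ t : ℝ, t ≠ a ∧ t ≠ b := by
    have e0 : ∀ᵐ s : ℝ, s ≠ a := by simp [ae_iff]
    have e1 : ∀ᵐ s : ℝ, s ≠ b := by simp [ae_iff]
    filter_upwards [e0, e1] with t h1 h2 using ⟨h1, h2⟩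
  refine (ae_restrict_iff' measurableSet_Icc).2 ?_
  filter_upwards [hc, hne] with t ht htn hts
  have := ht ⟨lt_of_le_of_ne hts.1 htn.1.symm, lt_of_le_of_ne hts.2 htn.2⟩
  linarith

lemma continuousOn_height (h : IsFrame F ℓ k) (P : E3) :
    ContinuousOn (fun s => F.height s P) (Icc 0 ℓ) := (h.height_prim P).continuousOn

lemma exists_height_eq_zero (h : IsFrame F ℓ k) {P : E3} {a b : ℝ} (ha : a ∈ Icc 0 ℓ)
    (hb : b ∈ Icc 0 ℓ) (hab : a ≤ b) (h1 : 0 ≤ F.height a P) (h2 : F.height b P ≤ 0) :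
    ∃ s ∈ Icc a b, F.height s P = 0 :=
  intermediate_value_Icc' hab
    ((h.continuousOn_height P).mono (Icc_subset_Icc ha.1 hb.2)) ⟨h2, h1⟩

end IsFrame

section Crossing

variable {ι : Type*} {l : Filter ι} {Fs : ι → FramedCurve} {F : FramedCurve} {ℓ : ℝ}
  {ks : ι → ℝ → E3} {k : ℝ → E3} {Ps : ι → E3} {q : E3}

lemma TendstoFrame.tendsto_height (hF : TendstoFrame Fs l F ℓ) (hP : Tendsto Ps l (𝓝 q)) {s : ℝ}
    (hs : s ∈ Icc 0 ℓ) : Tendsto (fun i => (Fs i).height s (Ps i)) l (𝓝 (F.height s q)) :=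
  (hP.sub (hF.r.tendsto_at hs)).inner (hF.w.tendsto_at hs)

/-- The plane of the cross-section at `s₀` is crossed transversally at `q`; hence nearby points have
height zero over a nearby cross-section of nearby frames. Near the common end of a closed rod the
crossing may happen on either side. -/
lemma eventually_exists_height_eq_zero (hF : TendstoFrame Fs l F ℓ) (hP : Tendsto Ps l (𝓝 q))
    (h : IsFrame F ℓ k) (hs : ∀ i, IsFrame (Fs i) ℓ (ks i)) (hℓ : 0 < ℓ) {s₀ : ℝ}
    (hs₀ : s₀ ∈ Icc 0 ℓ) (hq : F.height s₀ q = 0)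
    (hcl : s₀ ∈ Ioo 0 ℓ ∨ ((F.r 0 = F.r ℓ ∧ F.w 0 = F.w ℓ) ∧
      ∀ i, (Fs i).r 0 = (Fs i).r ℓ ∧ (Fs i).w 0 = (Fs i).w ℓ)) {c δ : ℝ} (hc : 0 < c) (hδ : 0 < δ)
    (hJ : ∀ᵐ t, t ∈ Icc 0 ℓ → CyclicNear ℓ δ s₀ t →
      (F.sectionCoord t q).1 * k t 0 + (F.sectionCoord t q).2 * k t 1 ≤ 1 - c) :
    ∀ᶠ i in l, ∃ s ∈ Icc 0 ℓ, CyclicNear ℓ δ s₀ s ∧ (s₀ ∈ Ioo 0 ℓ → |s - s₀| < δ) ∧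
      (Fs i).height s (Ps i) = 0 := by
  by_cases hin : s₀ ∈ Ioo 0 ℓ
  · -- the interior case: the height changes sign between `s₀ - d` and `s₀ + d`
    obtain ⟨d, hd0, hd⟩ : ∃ d, 0 < d ∧ d < δ ∧ d ≤ s₀ ∧ d ≤ ℓ - s₀ := by
      refine ⟨min (δ / 2) (min s₀ (ℓ - s₀)), ?_, ?_, ?_, ?_⟩
      · exact lt_min (by linarith) (lt_min hin.1 (by linarith [hin.2]))
      · exact (min_le_left _ _).trans_lt (by linarith)
      · exact (min_le_right _ _).trans (min_le_left _ _)
      · exact (min_le_right _ _).trans (min_le_right _ _)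
    have ha : s₀ - d ∈ Icc 0 ℓ := ⟨by linarith, by linarith [hin.2]⟩
    have hb : s₀ + d ∈ Icc 0 ℓ := ⟨by linarith [hin.1], by linarith⟩
    have e1 : 0 < F.height (s₀ - d) q := by
      have := h.height_sub_le (P := q) (c := c) ha hs₀ (by linarith) (by
        filter_upwards [hJ] with t ht hts
        refine ht ⟨ha.1.trans hts.1.le, hts.2.le.trans hs₀.2⟩ (Or.inl ?_)
        rw [abs_lt]; constructor <;> linarith [hts.1, hts.2])
      rw [hq] at this
      nlinarith
    have e2 : F.height (s₀ + d) q < 0 := by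
      have := h.height_sub_le (P := q) (c := c) hs₀ hb (by linarith) (by
        filter_upwards [hJ] with t ht hts
        refine ht ⟨hs₀.1.trans hts.1.le, hts.2.le.trans hb.2⟩ (Or.inl ?_)
        rw [abs_lt]; constructor <;> linarith [hts.1, hts.2])
      rw [hq] at this
      nlinarith
    filter_upwards [(hF.tendsto_height hP ha).eventually (lt_mem_nhds e1),
      (hF.tendsto_height hP hb).eventually (gt_mem_nhds e2)] with i h1 h2
    obtain ⟨s, hs', hz⟩ := (hs i).exists_height_eq_zero ha hb (by linarith) h1.le h2.le
    have hsd : |s - s₀| < δ := by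
      rw [abs_lt]; constructor <;> linarith [hs'.1, hs'.2]
    exact ⟨s, ⟨ha.1.trans hs'.1, hs'.2.trans hb.2⟩, Or.inl hsd, fun _ => hsd, hz⟩
  · -- at the common end, the height changes sign between `ℓ - d` and `d`
    obtain ⟨⟨hr, hw⟩, hcls⟩ := hcl.resolve_left hin
    have h0 : (0 : ℝ) ∈ Icc 0 ℓ := ⟨le_rfl, hℓ.le⟩
    have hl : ℓ ∈ Icc 0 ℓ := ⟨hℓ.le, le_rfl⟩
    have hend : s₀ = 0 ∨ s₀ = ℓ := by
      by_contra! hne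
      exact hin ⟨lt_of_le_of_ne hs₀.1 hne.1.symm, lt_of_le_of_ne hs₀.2 hne.2⟩
    have near : ∀ t ∈ Icc 0 ℓ, t < δ ∨ ℓ - δ < t → CyclicNear ℓ δ s₀ t := by
      intro t ht hor
      rcases hend with rfl | rfl
      · rw [CyclicNear, sub_zero, abs_of_nonneg ht.1]; exact hor
      · rw [CyclicNear, abs_of_nonpos (by linarith [ht.2])]
        exact hor.symm.imp (fun h => by linarith) fun h => by linarith
    have hq0 : F.height 0 q = 0 ∧ F.height ℓ q = 0 := by
      have : F.height 0 q = F.height ℓ q := by simp only [FramedCurve.height, hr, hw]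
      rcases hend with rfl | rfl
      · exact ⟨hq, this ▸ hq⟩
      · exact ⟨this ▸ hq, hq⟩
    obtain ⟨d, hd0, hdδ, hdℓ⟩ : ∃ d, 0 < d ∧ d < δ ∧ d ≤ ℓ :=
      ⟨min (δ / 2) ℓ, lt_min (by linarith) hℓ, (min_le_left _ _).trans_lt (by linarith),
        min_le_right _ _⟩
    have ha : ℓ - d ∈ Icc 0 ℓ := ⟨by linarith, by linarith⟩
    have hb : d ∈ Icc 0 ℓ := ⟨hd0.le, hdℓ⟩
    have e1 : 0 < F.height (ℓ - d) q := by
      have := h.height_sub_le (P := q) (c := c) ha hl (by linarith) (by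
        filter_upwards [hJ] with t ht hts
        have htI : t ∈ Icc 0 ℓ := ⟨ha.1.trans hts.1.le, hts.2.le⟩
        exact ht htI (near t htI (Or.inr (by linarith [hts.1]))))
      rw [hq0.2] at this
      nlinarith
    have e2 : F.height d q < 0 := by
      have := h.height_sub_le (P := q) (c := c) h0 hb hd0.le (by
        filter_upwards [hJ] with t ht hts
        have htI : t ∈ Icc 0 ℓ := ⟨hts.1.le, hts.2.le.trans hb.2⟩
        exact ht htI (near t htI (Or.inl (by linarith [hts.2]))))
      rw [hq0.1] at this
      nlinarith
    filter_upwards [(hF.tendsto_height hP ha).eventually (lt_mem_nhds e1),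
      (hF.tendsto_height hP hb).eventually (gt_mem_nhds e2)] with i h1 h2
    have hi : (Fs i).height 0 (Ps i) = (Fs i).height ℓ (Ps i) := by
      simp only [FramedCurve.height, (hcls i).1, (hcls i).2]
    rcases le_total 0 ((Fs i).height 0 (Ps i)) with hpos | hneg
    · obtain ⟨s, hs', hz⟩ := (hs i).exists_height_eq_zero h0 hb hd0.le hpos h2.le
      have hsI : s ∈ Icc 0 ℓ := ⟨hs'.1, hs'.2.trans hb.2⟩
      exact ⟨s, hsI, near s hsI (Or.inl (by linarith [hs'.2])), fun h => absurd h hin, hz⟩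
    · obtain ⟨s, hs', hz⟩ := (hs i).exists_height_eq_zero ha hl (by linarith) h1.le (hi ▸ hneg)
      have hsI : s ∈ Icc 0 ℓ := ⟨ha.1.trans hs'.1, hs'.2⟩
      exact ⟨s, hsI, near s hsI (Or.inr (by linarith [hs'.1])), fun h => absurd h hin, hz⟩

lemma inner_sub_inner_le {x x' u u' : E3} (hu : ‖u'‖ ≤ 1) :
    |inner ℝ x' u' - inner ℝ x u| ≤ ‖x' - x‖ + ‖x‖ * ‖u' - u‖ := by
  have : inner ℝ x' u' - inner ℝ x u = inner ℝ (x' - x) u' + inner ℝ x (u' - u) := by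
    rw [inner_sub_left, inner_sub_right]; ring
  rw [this]
  refine (abs_add_le _ _).trans (add_le_add ?_ (abs_real_inner_le_norm _ _))
  exact (abs_real_inner_le_norm _ _).trans (mul_le_of_le_one_right (norm_nonneg _) hu)

lemma TendstoFrame.tendstoUniformlyOn_sectionCoord (hF : TendstoFrame Fs l F ℓ)
    (hP : Tendsto Ps l (𝓝 q)) (h : IsFrame F ℓ k) (hs : ∀ i, IsFrame (Fs i) ℓ (ks i)) :
    TendstoUniformlyOn (fun i s => (Fs i).sectionCoord s (Ps i))
      (fun s => F.sectionCoord s q) l (Icc 0 ℓ) := by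
  obtain ⟨C, hC⟩ := isCompact_Icc.exists_bound_of_continuousOn
    (continuousOn_const.sub h.r_prim.continuousOn : ContinuousOn (fun s => q - F.r s) (Icc 0 ℓ))
  have hC0 : 0 ≤ C := (norm_nonneg _).trans (hC 0 h.r_prim.zero_mem)
  rw [Metric.tendstoUniformlyOn_iff]
  intro ε hε
  set η := ε / (2 * (C + 3)) with hη
  have hη0 : 0 < η := by positivity
  have hηε : η * (C + 2) < ε := by
    have : η * (2 * (C + 3)) = ε := by rw [hη]; field_simp
    nlinarith
  filter_upwards [Metric.tendstoUniformlyOn_iff.1 hF.r η hη0,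
    Metric.tendstoUniformlyOn_iff.1 hF.u η hη0, Metric.tendstoUniformlyOn_iff.1 hF.v η hη0,
    Metric.tendsto_nhds.1 hP η hη0] with i h1 h2 h3 h4 s hsI
  have e1 : ‖(Ps i - (Fs i).r s) - (q - F.r s)‖ ≤ 2 * η := by
    have := h1 s hsI
    rw [dist_eq_norm] at this h4
    rw [show (Ps i - (Fs i).r s) - (q - F.r s) = (Ps i - q) + (F.r s - (Fs i).r s) by abel]
    refine (norm_add_le _ _).trans ?_
    linarith
  have key : ∀ {u u' : E3}, dist u u' < η → ‖u'‖ = 1 →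
      |inner ℝ (Ps i - (Fs i).r s) u' - inner ℝ (q - F.r s) u| < ε := by
    intro u u' hd hn
    rw [dist_comm, dist_eq_norm] at hd
    refine (inner_sub_inner_le hn.le).trans_lt ?_
    have : ‖q - F.r s‖ * ‖u' - u‖ ≤ C * η := mul_le_mul (hC s hsI) hd.le (norm_nonneg _) hC0
    linarith
  rw [dist_comm, Prod.dist_eq, Real.dist_eq, Real.dist_eq]
  exact max_lt (key (h2 s hsI) ((hs i).norm_u s hsI)) (key (h3 s hsI) ((hs i).norm_v s hsI))

end Crossing

/-! ### Points of the rod persist under perturbation -/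

lemma CyclicNear.cases {ℓ δ s t : ℝ} (h : CyclicNear ℓ δ s t) (hs : s ∈ Icc 0 ℓ)
    (ht : t ∈ Icc 0 ℓ) : |t - s| < δ ∨ (s < δ ∧ ℓ - δ < t) ∨ (t < δ ∧ ℓ - δ < s) := by
  rcases h with h | h
  · exact Or.inl h
  · right
    rcases le_total s t with hst | hst
    · rw [abs_of_nonneg (by linarith)] at h
      left; constructor <;> linarith [hs.1, ht.2]
    · rw [abs_of_nonpos (by linarith)] at h
      right; constructor <;> linarith [hs.2, ht.1]

/-- A continuous closed curve is uniformly continuous for the cyclic distance. -/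
lemma exists_dist_lt_of_cyclicNear {ℓ : ℝ} (hℓ : 0 ≤ ℓ) {r : ℝ → E3}
    (hr : ContinuousOn r (Icc 0 ℓ)) (hc : r 0 = r ℓ) {η : ℝ} (hη : 0 < η) :
    ∃ δ > 0, ∀ s ∈ Icc 0 ℓ, ∀ t ∈ Icc 0 ℓ, CyclicNear ℓ δ s t → dist (r s) (r t) < η := by
  have h0 : (0 : ℝ) ∈ Icc 0 ℓ := ⟨le_rfl, hℓ⟩
  have hl : ℓ ∈ Icc 0 ℓ := ⟨hℓ, le_rfl⟩
  obtain ⟨δ, hδ, h⟩ := Metric.uniformContinuousOn_iff.1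
    (isCompact_Icc.uniformContinuousOn_of_continuous hr) (η / 2) (half_pos hη)
  have ends : ∀ s ∈ Icc 0 ℓ, ∀ t ∈ Icc 0 ℓ, s < δ → ℓ - δ < t → dist (r s) (r t) < η := by
    intro s hs t ht h1 h2
    have e1 := h s hs 0 h0 (by rw [Real.dist_eq, sub_zero, abs_of_nonneg hs.1]; exact h1)
    have e2 := h ℓ hl t ht (by
      rw [Real.dist_eq, abs_of_nonneg (by linarith [ht.2])]; linarith)
    rw [hc] at e1
    linarith [dist_triangle (r s) (r ℓ) (r t)]
  refine ⟨δ, hδ, fun s hs t ht hst => ?_⟩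
  rcases hst.cases hs ht with h1 | ⟨h1, h2⟩ | ⟨h1, h2⟩
  · have := h s hs t ht (by rw [dist_comm, Real.dist_eq]; exact h1)
    linarith
  · exact ends s hs t ht h1 h2
  · rw [dist_comm]; exact ends t ht s hs h1 h2

namespace Rod

variable {p : ℝ} (B : Rod p)

lemma ε_pos : 0 < B.ε := B.τ_pos.trans B.τ_lt

lemma zero_mem_Icc : (0 : ℝ) ∈ Icc 0 B.ℓ := ⟨le_rfl, B.ℓ_pos.le⟩

lemma ℓ_mem_Icc : B.ℓ ∈ Icc 0 B.ℓ := ⟨B.ℓ_pos.le, le_rfl⟩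

lemma disc_subset {s : ℝ} (hs : s ∈ Icc 0 B.ℓ) {ζ : ℝ × ℝ} (hζ : ζ.1 ^ 2 + ζ.2 ^ 2 < B.ε ^ 2) :
    ζ ∈ B.A s :=
  B.A_thick s hs ζ (abs_lt_of_sq_lt_sq (by nlinarith [sq_nonneg ζ.2]) B.ε_pos.le)
    (abs_lt_of_sq_lt_sq (by nlinarith [sq_nonneg ζ.1]) B.ε_pos.le)

lemma compression_le_one_iff {s : ℝ} (hs : s ∈ Icc 0 B.ℓ) (x y : ℝ) :
    compression B.A x y s ≤ 1 ↔ ∀ ζ ∈ B.A s, ζ.1 * x + ζ.2 * y ≤ 1 := by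
  have hne : ((fun ζ : ℝ × ℝ => ζ.1 * x + ζ.2 * y) '' B.A s).Nonempty :=
    ⟨_, 0, B.disc_subset hs (by simpa using pow_pos B.ε_pos 2), rfl⟩
  have hbd : BddAbove ((fun ζ : ℝ × ℝ => ζ.1 * x + ζ.2 * y) '' B.A s) :=
    ((B.A_compact s hs).image (by fun_prop)).bddAbove
  rw [compression, csSup_le_iff hbd hne, forall_mem_image]

/-- Inside a disc that is smaller than the disc of radius `ε`, the Jacobian is bounded below. -/
lemma exists_jacobian_bound_of_lt {ρ : ℝ} (hρ0 : 0 ≤ ρ) (hρ : ρ < B.ε) :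
    ∃ c > 0, ∀ s ∈ Icc 0 B.ℓ, ∀ x y : ℝ, compression B.A x y s ≤ 1 →
      ∀ ζ : ℝ × ℝ, ζ.1 ^ 2 + ζ.2 ^ 2 ≤ ρ ^ 2 → ζ.1 * x + ζ.2 * y ≤ 1 - c := by
  set θ := (B.ε - ρ) / (B.ε + ρ) with hθ
  have hε := B.ε_pos
  have hθ0 : 0 < θ := div_pos (by linarith) (by linarith)
  -- the dilation by `1 + θ = 2ε / (ε + ρ)` maps the disc of radius `ρ` into the disc of radius `ε`
  have hθρ : (1 + θ) * ρ < B.ε := by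
    have : (1 + θ) * ρ = 2 * B.ε * ρ / (B.ε + ρ) := by rw [hθ]; field_simp; ring
    rw [this, div_lt_iff₀ (by linarith)]
    nlinarith
  refine ⟨1 - 1 / (1 + θ), ?_, fun s hs x y hxy ζ hζ => ?_⟩
  · rw [gt_iff_lt, sub_pos, div_lt_one (by linarith)]; linarith
  have hmem : ((1 + θ) * ζ.1, (1 + θ) * ζ.2) ∈ B.A s := by
    apply B.disc_subset hs
    have : ((1 + θ) * ρ) ^ 2 < B.ε ^ 2 := by
      apply pow_lt_pow_left₀ hθρ (by positivity) two_ne_zero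
    have := mul_le_mul_of_nonneg_left hζ (sq_nonneg (1 + θ))
    nlinarith
  have := (B.compression_le_one_iff hs x y).1 hxy _ hmem
  rw [sub_sub_cancel, le_div_iff₀ (by linarith)]
  linarith

section Persistence

variable {B} {ι : Type*} {l : Filter ι} {Fs : ι → FramedCurve} {F : FramedCurve}
  {ks : ι → ℝ → E3} {k : ℝ → E3} {Ps : ι → E3} {q : E3}

/-- A point in the tube of radius `ε` around the closed midline is covered, also after perturbation
of the point and of the frame, by cross-sections of the tube that are near to the original one. -/
lemma eventually_mem_tube (hF : TendstoFrame Fs l F B.ℓ) (hP : Tendsto Ps l (𝓝 q))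
    (h : IsFrame F B.ℓ k) (hs : ∀ i, IsFrame (Fs i) B.ℓ (ks i))
    (hcl : F.r 0 = F.r B.ℓ ∧ F.w 0 = F.w B.ℓ)
    (hcls : ∀ i, (Fs i).r 0 = (Fs i).r B.ℓ ∧ (Fs i).w 0 = (Fs i).w B.ℓ)
    (hg : ∀ᵐ t, t ∈ Icc 0 B.ℓ → compression B.A (k t 0) (k t 1) t ≤ 1)
    {s₀ : ℝ} (hs₀ : s₀ ∈ Icc 0 B.ℓ) (hq : F.height s₀ q = 0) (hqε : ‖q - F.r s₀‖ < B.ε)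
    {δ : ℝ} (hδ : 0 < δ) :
    ∀ᶠ i in l, ∃ s ∈ Icc 0 B.ℓ, CyclicNear B.ℓ δ s₀ s ∧ (Fs i).height s (Ps i) = 0 ∧
      ‖Ps i - (Fs i).r s‖ < B.ε := by
  set η := (B.ε - ‖q - F.r s₀‖) / 4 with hη
  have hη0 : 0 < η := by rw [hη]; linarith
  have hηε : ‖q - F.r s₀‖ + 4 * η = B.ε := by rw [hη]; ring
  obtain ⟨δ₁, hδ₁, hr⟩ := exists_dist_lt_of_cyclicNear B.ℓ_pos.le h.r_prim.continuousOn hcl.1 hη0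
  have hclose : ∀ t ∈ Icc 0 B.ℓ, CyclicNear B.ℓ δ₁ s₀ t → ‖q - F.r t‖ ≤ ‖q - F.r s₀‖ + η := by
    intro t ht hn
    have := hr s₀ hs₀ t ht hn
    rw [dist_eq_norm] at this
    rw [show q - F.r t = (q - F.r s₀) + (F.r s₀ - F.r t) by abel]
    exact (norm_add_le _ _).trans (by linarith)
  obtain ⟨c, hc, hJ⟩ := B.exists_jacobian_bound_of_lt (ρ := ‖q - F.r s₀‖ + η) (by positivity)
    (by linarith)
  have key := eventually_exists_height_eq_zero hF hP h hs B.ℓ_pos hs₀ hq (Or.inr ⟨hcl, hcls⟩)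
    (c := c) (δ := min δ δ₁) hc (lt_min hδ hδ₁) (by
      filter_upwards [hg] with t ht htI hn
      refine hJ t htI _ _ (ht htI) _ ((h.sectionCoord_sq_le htI q).trans ?_)
      exact pow_le_pow_left₀ (norm_nonneg _) (hclose t htI (hn.mono (min_le_right _ _))) 2)
  filter_upwards [key, Metric.tendstoUniformlyOn_iff.1 hF.r η hη0,
    Metric.tendsto_nhds.1 hP η hη0] with i ⟨s, hsI, hn, _, hz⟩ h1 h2
  refine ⟨s, hsI, hn.mono (min_le_left _ _), hz, ?_⟩
  have h3 := h1 s hsI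
  have h4 := hclose s hsI (hn.mono (min_le_right _ _))
  rw [dist_eq_norm] at h2 h3
  rw [show Ps i - (Fs i).r s = (Ps i - q) + (q - F.r s) + (F.r s - (Fs i).r s) by abel]
  refine (norm_add_le _ _).trans_lt ?_
  have := norm_add_le (Ps i - q) (q - F.r s)
  linarith

/-- The position of an interior material point is also, for nearby frames, the position of an
interior material point. -/
lemma eventually_mem_image_interior (hF : TendstoFrame Fs l F B.ℓ) (h : IsFrame F B.ℓ k)
    (hs : ∀ i, IsFrame (Fs i) B.ℓ (ks i))
    (hg : ∀ᵐ t, t ∈ Icc 0 B.ℓ → compression B.A (k t 0) (k t 1) t ≤ 1)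
    {x : ℝ × ℝ × ℝ} (hx : x ∈ interior B.Ω) :
    ∀ᶠ i in l, F.position x ∈ (Fs i).position '' interior B.Ω := by
  obtain ⟨s₀, ζ₀⟩ := x
  set q := F.position (s₀, ζ₀) with hqdef
  have hs₀ : s₀ ∈ Icc 0 B.ℓ := (interior_subset hx).1
  have hs₀' : s₀ ∈ Ioo 0 B.ℓ := by
    rw [← interior_Icc, mem_interior_iff_mem_nhds]
    have h1 : (fun s : ℝ => (s, ζ₀)) ⁻¹' interior B.Ω ∈ 𝓝 s₀ :=
      (Continuous.prodMk_left ζ₀).continuousAt.preimage_mem_nhds (isOpen_interior.mem_nhds hx)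
    filter_upwards [h1] with s hs using (interior_subset hs).1
  -- a dilation of the section coordinates by `1 + θ` stays in the interior
  obtain ⟨θ, hθ0, hθ⟩ : ∃ θ > 0, (s₀, ((1 + θ) * ζ₀.1, (1 + θ) * ζ₀.2)) ∈ interior B.Ω := by
    have hc : Continuous fun θ : ℝ => (s₀, ((1 + θ) * ζ₀.1, (1 + θ) * ζ₀.2)) := by fun_prop
    have h1 : (fun θ : ℝ => (s₀, ((1 + θ) * ζ₀.1, (1 + θ) * ζ₀.2))) ⁻¹' interior B.Ω ∈ 𝓝 0 :=
      hc.continuousAt.preimage_mem_nhds (isOpen_interior.mem_nhds (by simpa using hx))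
    obtain ⟨ε, hε, hb⟩ := Metric.mem_nhds_iff.1 h1
    refine ⟨ε / 2, half_pos hε, hb ?_⟩
    rw [Metric.mem_ball, Real.dist_eq, sub_zero, abs_of_pos (half_pos hε)]
    linarith
  have hsec : F.sectionCoord s₀ q = ζ₀ := h.sectionCoord_position hs₀ ζ₀
  have hcont : ContinuousAt (fun s => F.sectionCoord s q) s₀ :=
    (h.continuousOn_sectionCoord q).continuousAt (Icc_mem_nhds hs₀'.1 hs₀'.2)
  have hU : ∀ᶠ s in 𝓝 s₀, (s, ((1 + θ) * (F.sectionCoord s q).1, (1 + θ) *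
      (F.sectionCoord s q).2)) ∈ interior B.Ω := by
    apply ContinuousAt.eventually_mem (f := fun s => (s, ((1 + θ) * (F.sectionCoord s q).1,
      (1 + θ) * (F.sectionCoord s q).2)))
    · exact continuousAt_id.prodMk ((continuousAt_const.mul hcont.fst).prodMk
        (continuousAt_const.mul hcont.snd))
    · rw [hsec]; exact isOpen_interior.mem_nhds hθ
  obtain ⟨η, hη, hball⟩ := Metric.isOpen_iff.1 (isOpen_interior (s := B.Ω)) _ hx
  obtain ⟨δ, hδ, hδU⟩ := Metric.eventually_nhds_iff.1
    (hU.and (Metric.tendsto_nhds.1 hcont (η / 2) (half_pos hη)))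
  obtain ⟨d, hd0, hdδ, hdη, hdℓ⟩ : ∃ d > 0, d ≤ δ ∧ d ≤ η ∧ ∀ t, CyclicNear B.ℓ d s₀ t →
      t ∈ Icc 0 B.ℓ → |t - s₀| < δ := by
    refine ⟨min (min δ η) (min s₀ (B.ℓ - s₀)), ?_, ?_, ?_, fun t ht htI => ?_⟩
    · exact lt_min (lt_min hδ hη) (lt_min hs₀'.1 (by linarith [hs₀'.2]))
    · exact (min_le_left _ _).trans (min_le_left _ _)
    · exact (min_le_left _ _).trans (min_le_right _ _)
    · have e1 : min (min δ η) (min s₀ (B.ℓ - s₀)) ≤ s₀ :=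
        (min_le_right _ _).trans (min_le_left _ _)
      have e2 : min (min δ η) (min s₀ (B.ℓ - s₀)) ≤ B.ℓ - s₀ :=
        (min_le_right _ _).trans (min_le_right _ _)
      rcases ht.cases hs₀ htI with h1 | ⟨h1, h2⟩ | ⟨h1, h2⟩
      · exact h1.trans_le ((min_le_left _ _).trans (min_le_left _ _))
      · linarith
      · linarith
  have hθ1 : 0 < 1 - 1 / (1 + θ) := by
    rw [sub_pos, div_lt_one (by linarith)]; linarith
  have key := eventually_exists_height_eq_zero hF tendsto_const_nhds h hs B.ℓ_pos hs₀
    (IsFrame.height_position F s₀ ζ₀) (Or.inl hs₀') (c := 1 - 1 / (1 + θ)) (δ := d) hθ1 hd0 (by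
      filter_upwards [hg] with t ht htI hn
      have hmem := (interior_subset (hδU (hdℓ t hn htI)).1).2
      have := (B.compression_le_one_iff htI _ _).1 (ht htI) _ hmem
      rw [sub_sub_cancel, le_div_iff₀ (by linarith)]
      linarith)
  filter_upwards [key, Metric.tendstoUniformlyOn_iff.1
    (hF.tendstoUniformlyOn_sectionCoord (q := q) tendsto_const_nhds h hs) (η / 2) (half_pos hη)]
    with i ⟨s, hsI, _, hn, hz⟩ h1
  have hsd := hn hs₀'
  refine ⟨(s, (Fs i).sectionCoord s q), hball ?_, (hs i).position_sectionCoord hsI hz⟩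
  rw [Metric.mem_ball, Prod.dist_eq]
  refine max_lt (hsd.trans_le hdη) ?_
  have e1 := h1 s hsI
  have e2 : dist (F.sectionCoord s q) (F.sectionCoord s₀ q) < η / 2 := (hδU (hsd.trans_le hdδ)).2
  rw [hsec] at e2
  rw [dist_comm] at e1
  exact (dist_triangle _ _ _).trans_lt (by linarith)

end Persistence

end Rod

/-! ### The volume of the deformed rod -/

lemma IsPrimitive.strictMonoOn {ℓ : ℝ} {σ m : ℝ → ℝ} (h : IsPrimitive ℓ σ m)
    (hm : ∀ t, 1 ≤ m t) : StrictMonoOn σ (Icc 0 ℓ) := by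
  intro s hs t ht hst
  have := intervalIntegral.integral_mono_on hst.le (by simp) (h.intervalIntegrable hs ht)
    (fun τ _ => hm τ)
  rw [← h.sub_eq_integral hs ht] at this
  simp only [intervalIntegral.integral_const, smul_eq_mul, mul_one] at this
  linarith

/-- An increasing absolutely continuous change of parameter maps null sets to null sets. -/
lemma IsPrimitive.volume_image_eq_zero {ℓ : ℝ} {σ m : ℝ → ℝ} (h : IsPrimitive ℓ σ m)
    (hm : ∀ t, 1 ≤ m t) {N : Set ℝ} (hN : N ⊆ Icc 0 ℓ) (hN0 : volume N = 0) :
    volume (σ '' N) = 0 := by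
  wlog hmeas : MeasurableSet N generalizing N
  · refine measure_mono_null (image_mono (subset_inter (subset_toMeasurable volume N) hN))
      (this inter_subset_right (measure_mono_null inter_subset_left ?_)
        ((measurableSet_toMeasurable _ _).inter measurableSet_Icc))
    rwa [measure_toMeasurable]
  have hmono := h.strictMonoOn hm
  have h0 := h.zero_mem
  have hl : ℓ ∈ Icc 0 ℓ := ⟨h.nonneg, le_rfl⟩
  set μ := (volume.restrict (Icc 0 ℓ)).withDensity fun t => ENNReal.ofReal (m t) with hμ
  have hint : IntegrableOn m (Icc 0 ℓ) :=
    (intervalIntegrable_iff_integrableOn_Icc_of_le h.nonneg).1 h.integrable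
  have hμs : ∀ s ∈ Icc 0 ℓ, μ (Icc 0 s) = ENNReal.ofReal (σ s - σ 0) := by
    intro s hs
    have hsub : Icc 0 s ⊆ Icc 0 ℓ := Icc_subset_Icc le_rfl hs.2
    rw [h.sub_eq_integral h0 hs, intervalIntegral.integral_of_le hs.1,
      ← integral_Icc_eq_integral_Ioc, ofReal_integral_eq_lintegral_ofReal (hint.mono_set hsub)
        (Eventually.of_forall fun t => zero_le_one.trans (hm t)), hμ,
      withDensity_apply _ measurableSet_Icc, Measure.restrict_restrict measurableSet_Icc,
      inter_eq_left.2 hsub]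
  have hμc : μ (Icc 0 ℓ)ᶜ = 0 := by
    refine withDensity_absolutelyContinuous _ _ ?_
    rw [Measure.restrict_apply measurableSet_Icc.compl, compl_inter_self, measure_empty]
  have : IsFiniteMeasure μ := ⟨by
    rw [← union_compl_self (Icc 0 ℓ)]
    refine (measure_union_le _ _).trans_lt ?_
    rw [hμc, hμs ℓ hl, add_zero]
    exact ENNReal.ofReal_lt_top⟩
  let g : ℝ → ℝ := fun s => σ (projIcc 0 ℓ h.nonneg s)
  have hg : Continuous g :=
    (continuousOn_iff_continuous_domRestrict.1 h.continuousOn).comp continuous_projIcc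
  have hgI : ∀ t ∈ Icc 0 ℓ, g t = σ t := fun t ht => by
    simp only [g, projIcc_of_mem h.nonneg ht]
  have hfin : IsFiniteMeasure (μ.map g) := inferInstance
  have hmap : μ.map g = volume.restrict (Icc (σ 0) (σ ℓ)) := by
    refine Measure.ext_of_Iic _ _ fun a => ?_
    rw [Measure.map_apply hg.measurable measurableSet_Iic,
      Measure.restrict_apply measurableSet_Iic]
    have e1 : μ (g ⁻¹' Iic a) = μ {t | t ∈ Icc 0 ℓ ∧ σ t ≤ a} := by
      refine le_antisymm ?_ (measure_mono fun t ht => ?_)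
      · rw [← measure_sdiff_null hμc]
        refine measure_mono fun t ht => ?_
        have htI : t ∈ Icc 0 ℓ := not_not.1 ht.2
        exact ⟨htI, hgI t htI ▸ ht.1⟩
      · exact mem_preimage.2 (hgI t ht.1 ▸ ht.2)
    rw [e1]
    rcases lt_or_ge a (σ 0) with ha | ha
    · have e2 : {t | t ∈ Icc 0 ℓ ∧ σ t ≤ a} = ∅ := by
        refine eq_empty_of_forall_notMem fun t ht => ?_
        exact absurd ((hmono.monotoneOn h0 ht.1 ht.1.1).trans ht.2) (not_le.2 ha)
      have e3 : Iic a ∩ Icc (σ 0) (σ ℓ) = ∅ :=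
        eq_empty_of_forall_notMem fun t ht => absurd (ht.2.1.trans ht.1) (not_le.2 ha)
      rw [e2, e3, measure_empty, measure_empty]
    · obtain ⟨s, hs, hsa⟩ := intermediate_value_Icc h.nonneg h.continuousOn
        (show min a (σ ℓ) ∈ Icc (σ 0) (σ ℓ) from
          ⟨le_min ha (hmono.monotoneOn h0 hl h.nonneg), min_le_right _ _⟩)
      have e2 : {t | t ∈ Icc 0 ℓ ∧ σ t ≤ a} = Icc 0 s := by
        ext t
        constructor
        · rintro ⟨ht, hta⟩
          refine ⟨ht.1, (hmono.le_iff_le ht hs).1 ?_⟩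
          rw [hsa]
          exact le_min hta (hmono.monotoneOn ht hl ht.2)
        · intro ht
          have htI : t ∈ Icc 0 ℓ := ⟨ht.1, ht.2.trans hs.2⟩
          exact ⟨htI, (hmono.monotoneOn htI hs ht.2).trans (hsa.trans_le (min_le_left _ _))⟩
      have e3 : Iic a ∩ Icc (σ 0) (σ ℓ) = Icc (σ 0) (σ s) := by
        ext t
        rw [hsa]
        simp only [mem_inter_iff, mem_Iic, mem_Icc, le_min_iff]
        tauto
      rw [e2, e3, hμs s hs, Real.volume_Icc]
  have hsub : σ '' N ⊆ Icc (σ 0) (σ ℓ) := by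
    rintro _ ⟨t, ht, rfl⟩
    exact ⟨hmono.monotoneOn h0 (hN ht) (hN ht).1, hmono.monotoneOn (hN ht) hl (hN ht).2⟩
  have hm' : MeasurableSet (σ '' N) :=
    hmeas.image_of_continuousOn_injOn (h.continuousOn.mono hN) (hmono.injOn.mono hN)
  rw [← inter_eq_left.2 hsub, ← Measure.restrict_apply hm', ← hmap,
    Measure.map_apply hg.measurable hm']
  refine measure_mono_null (t := N ∪ (Icc 0 ℓ)ᶜ) (fun t ht => ?_)
    (measure_union_null (withDensity_absolutelyContinuous _ _
      (Measure.absolutelyContinuous_of_le Measure.restrict_le_self hN0)) hμc)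
  by_cases htI : t ∈ Icc 0 ℓ
  · obtain ⟨t', ht', he⟩ := ht
    rw [hgI t htI] at he
    exact Or.inl (hmono.injOn (hN ht') htI he ▸ ht')
  · exact Or.inr htI

/-- The Cartesian coordinates of Euclidean space, as a triple. -/
def toTriple (x : E3) : ℝ × ℝ × ℝ := (x 0, x 1, x 2)

lemma measurePreserving_toTriple : MeasurePreserving toTriple volume volume := by
  have h1 : MeasurePreserving (WithLp.ofLp : E3 → (Fin 3 → ℝ)) volume volume :=
    PiLp.volume_preserving_ofLp (Fin 3)
  have h2 := volume_preserving_piFinSuccAbove (fun _ : Fin 3 => ℝ) 0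
  have h3 := volume_preserving_finTwoArrow ℝ
  exact (((MeasurePreserving.id volume).prod h3).comp h2).comp h1

lemma toTriple_injective : Function.Injective toTriple := fun x y h => by
  simp only [toTriple, Prod.mk.injEq] at h
  exact ext_coord h.1 h.2.1 h.2.2

lemma toTriple_surjective : Function.Surjective toTriple := fun x =>
  ⟨!₂[x.1, x.2.1, x.2.2], by simp [toTriple]⟩

lemma measurableEmbedding_toTriple : MeasurableEmbedding toTriple :=
  Measurable.measurableEmbedding measurePreserving_toTriple.measurable toTriple_injective

/-- Lipschitz images of null sets of Euclidean space are null sets. -/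
lemma volume_image_eq_zero_of_lipschitzOnWith {f : E3 → E3} {S : Set E3} {K : ℝ≥0}
    (hf : LipschitzOnWith K f S) (hS : volume S = 0) : volume (f '' S) = 0 := by
  have : (Measure.hausdorffMeasure ((3 : ℕ) : ℝ) : Measure E3).IsAddHaarMeasure := inferInstance
  have h1 : (Measure.hausdorffMeasure ((3 : ℕ) : ℝ) : Measure E3) S = 0 :=
    Measure.absolutelyContinuous_isAddHaarMeasure _ volume hS
  have h2 := hf.hausdorffMeasure_image_le (d := ((3 : ℕ) : ℝ)) (by positivity)
  rw [h1, mul_zero, nonpos_iff_eq_zero] at h2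
  exact Measure.absolutelyContinuous_isAddHaarMeasure volume _ h2

namespace IsFrame

variable {F : FramedCurve} {ℓ : ℝ} {k : ℝ → E3}

lemma norm_u_density_le (h : IsFrame F ℓ k) {t : ℝ} (ht : t ∈ Icc 0 ℓ) :
    ‖-(k t 0) • F.w t - k t 2 • F.v t‖ ≤ 2 * ‖k t‖ := by
  refine (norm_sub_le _ _).trans ?_
  rw [norm_smul, norm_smul, h.norm_w ht, h.norm_v t ht, norm_neg, Real.norm_eq_abs,
    Real.norm_eq_abs]
  linarith [abs_coord_le (k t) 0, abs_coord_le (k t) 2]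

lemma norm_v_density_le (h : IsFrame F ℓ k) {t : ℝ} (ht : t ∈ Icc 0 ℓ) :
    ‖k t 2 • F.u t - k t 1 • F.w t‖ ≤ 2 * ‖k t‖ := by
  refine (norm_sub_le _ _).trans ?_
  rw [norm_smul, norm_smul, h.norm_w ht, h.norm_u t ht, Real.norm_eq_abs, Real.norm_eq_abs]
  linarith [abs_coord_le (k t) 1, abs_coord_le (k t) 2]

lemma norm_sub_le_of_density {x x' : ℝ → E3} {m : ℝ → ℝ} (hx : IsPrimitive ℓ x x')
    (hm : IntervalIntegrable m volume 0 ℓ) (hle : ∀ t ∈ Icc 0 ℓ, ‖x' t‖ ≤ m t) {s t : ℝ}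
    (hs : s ∈ Icc 0 ℓ) (ht : t ∈ Icc 0 ℓ) (hst : s ≤ t) : ‖x t - x s‖ ≤ ∫ τ in s..t, m τ := by
  rw [hx.sub_eq_integral hs ht]
  refine intervalIntegral.norm_integral_le_of_norm_le hst (Eventually.of_forall fun τ hτ =>
    hle τ ⟨hs.1.trans hτ.1.le, hτ.2.trans ht.2⟩) (hm.mono_set ?_)
  rw [uIcc_of_le hst, uIcc_of_le hx.nonneg]
  exact Icc_subset_Icc hs.1 ht.2

/-- The images of a null set of cross-sections form a null set: in the parameter
`σ(s) = ∫₀ˢ (1 + 2|k|)` the position is Lipschitz. -/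
lemma volume_image_null (h : IsFrame F ℓ k) (hk : IntervalIntegrable k volume 0 ℓ)
    {N : Set ℝ} (hN : N ⊆ Icc 0 ℓ) (hN0 : volume N = 0) {K : Set (ℝ × ℝ × ℝ)} {R : ℝ}
    (hK : ∀ x ∈ K, x.1 ∈ N ∧ |x.2.1| ≤ R ∧ |x.2.2| ≤ R) : volume (F.position '' K) = 0 := by
  rcases K.eq_empty_or_nonempty with rfl | ⟨x₀, hx₀⟩
  · simp
  have hR : 0 ≤ R := (abs_nonneg _).trans (hK x₀ hx₀).2.1
  set m : ℝ → ℝ := fun t => 1 + 2 * ‖k t‖ with hm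
  have hmi : IntervalIntegrable m volume 0 ℓ := (by simp : IntervalIntegrable _ _ _ _).add
    (hk.norm.const_mul 2)
  set σ : ℝ → ℝ := fun s => ∫ t in (0 : ℝ)..s, m t with hσ
  have hσp : IsPrimitive ℓ σ m := ⟨h.r_prim.nonneg, hmi, fun s _ => by simp [hσ]⟩
  have hm1 : ∀ t, 1 ≤ m t := fun t => by simp only [hm]; linarith [norm_nonneg (k t)]
  have hinj := (hσp.strictMonoOn hm1).injOn
  have hlip : ∀ s ∈ Icc 0 ℓ, ∀ t ∈ Icc 0 ℓ, ‖F.r t - F.r s‖ ≤ |σ t - σ s| ∧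
      ‖F.u t - F.u s‖ ≤ |σ t - σ s| ∧ ‖F.v t - F.v s‖ ≤ |σ t - σ s| := by
    have key : ∀ s ∈ Icc 0 ℓ, ∀ t ∈ Icc 0 ℓ, s ≤ t → ‖F.r t - F.r s‖ ≤ |σ t - σ s| ∧
        ‖F.u t - F.u s‖ ≤ |σ t - σ s| ∧ ‖F.v t - F.v s‖ ≤ |σ t - σ s| := by
      intro s hs t ht hst
      rw [hσp.sub_eq_integral hs ht, abs_of_nonneg (intervalIntegral.integral_nonneg hst
        fun τ _ => zero_le_one.trans (hm1 τ))]
      refine ⟨norm_sub_le_of_density h.r_prim hmi (fun τ hτ => ?_) hs ht hst,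
        norm_sub_le_of_density h.u_prim hmi (fun τ hτ => ?_) hs ht hst,
        norm_sub_le_of_density h.v_prim hmi (fun τ hτ => ?_) hs ht hst⟩
      · rw [h.norm_w hτ]; exact hm1 τ
      · exact (h.norm_u_density_le hτ).trans (by simp only [hm]; linarith)
      · exact (h.norm_v_density_le hτ).trans (by simp only [hm]; linarith)
    intro s hs t ht
    rcases le_total s t with hst | hst
    · exact key s hs t ht hst
    · have := key t ht s hs hst
      rwa [norm_sub_rev (F.r t), norm_sub_rev (F.u t), norm_sub_rev (F.v t), abs_sub_comm]
  set τ : ℝ → ℝ := Function.invFunOn σ (Icc 0 ℓ) with hτ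
  have hτσ : ∀ s ∈ Icc 0 ℓ, τ (σ s) = s := fun s hs => hinj.leftInvOn_invFunOn hs
  set S : Set E3 := {x | x 0 ∈ σ '' N ∧ |x 1| ≤ R ∧ |x 2| ≤ R} with hS
  set Q : E3 → E3 := fun x => F.position (τ (x 0), x 1, x 2) with hQ
  have hS0 : volume S = 0 := by
    refine measure_mono_null (t := toTriple ⁻¹' (Prod.fst ⁻¹' (σ '' N))) (fun x hx => hx.1) ?_
    exact measurePreserving_toTriple.quasiMeasurePreserving.preimage_null
      (Measure.quasiMeasurePreserving_fst.preimage_null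
        (hσp.volume_image_eq_zero hm1 hN hN0))
  have hsub : F.position '' K ⊆ Q '' S := by
    rintro _ ⟨x, hx, rfl⟩
    obtain ⟨h1, h2, h3⟩ := hK x hx
    refine ⟨!₂[σ x.1, x.2.1, x.2.2], ⟨⟨x.1, h1, by simp⟩, by simpa using h2, by simpa using h3⟩, ?_⟩
    simp [hQ, hτσ x.1 (hN h1)]
  refine measure_mono_null hsub (volume_image_eq_zero_of_lipschitzOnWith
    (K := Real.toNNReal (3 + 2 * R)) (LipschitzOnWith.of_dist_le_mul fun x hx y hy => ?_) hS0)
  obtain ⟨⟨s, hs, hsx⟩, hx1, hx2⟩ := hx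
  obtain ⟨⟨t, ht, hty⟩, hy1, hy2⟩ := hy
  have hs' := hN hs
  have ht' := hN ht
  obtain ⟨e1, e2, e3⟩ := hlip t ht' s hs'
  have c0 : |x 0 - y 0| ≤ ‖x - y‖ := abs_coord_le (x - y) 0
  have c1 : |x 1 - y 1| ≤ ‖x - y‖ := abs_coord_le (x - y) 1
  have c2 : |x 2 - y 2| ≤ ‖x - y‖ := abs_coord_le (x - y) 2
  rw [hsx, hty] at e1 e2 e3
  rw [Real.coe_toNNReal _ (by positivity), dist_eq_norm, dist_eq_norm]
  simp only [hQ, FramedCurve.position, ← hsx, ← hty, hτσ s hs', hτσ t ht']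
  rw [show F.r s + x 1 • F.u s + x 2 • F.v s - (F.r t + y 1 • F.u t + y 2 • F.v t) =
    (F.r s - F.r t) + (x 1 - y 1) • F.u s + y 1 • (F.u s - F.u t) + (x 2 - y 2) • F.v s +
      y 2 • (F.v s - F.v t) by module]
  have n1 : ‖(x 1 - y 1) • F.u s‖ ≤ ‖x - y‖ := by
    rw [norm_smul, h.norm_u s hs', mul_one]; exact c1
  have n2 : ‖(x 2 - y 2) • F.v s‖ ≤ ‖x - y‖ := by
    rw [norm_smul, h.norm_v s hs', mul_one]; exact c2
  have n3 : ‖y 1 • (F.u s - F.u t)‖ ≤ R * ‖x - y‖ := by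
    rw [norm_smul]; exact mul_le_mul hy1 (e2.trans c0) (norm_nonneg _) hR
  have n4 : ‖y 2 • (F.v s - F.v t)‖ ≤ R * ‖x - y‖ := by
    rw [norm_smul]; exact mul_le_mul hy2 (e3.trans c0) (norm_nonneg _) hR
  have n5 := e1.trans c0
  refine (norm_add_le _ _).trans ?_
  refine (add_le_add_left ((norm_add_le _ _).trans (add_le_add_left ((norm_add_le _ _).trans
    (add_le_add_left (norm_add_le _ _) _)) _)) _).trans ?_
  linarith

/-- The linear map with the columns `a, b, c`. -/
noncomputable def columns (a b c : E3) : E3 →L[ℝ] E3 :=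
  (EuclideanSpace.proj 0 : E3 →L[ℝ] ℝ).smulRight a +
    (EuclideanSpace.proj 1 : E3 →L[ℝ] ℝ).smulRight b +
    (EuclideanSpace.proj 2 : E3 →L[ℝ] ℝ).smulRight c

lemma det_columns (a b c : E3) : (columns a b c).det = inner ℝ a (cross b c) := by
  rw [ContinuousLinearMap.det, ← LinearMap.det_toMatrix (EuclideanSpace.basisFun (Fin 3) ℝ).toBasis,
    Matrix.det_fin_three]
  simp [LinearMap.toMatrix_apply, columns, inner_eq_coord, cross_zero, cross_one, cross_two]
  ring

/-- The volume of the deformed rod is at most the integral of the Jacobian. -/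
theorem volume_image_le (h : IsFrame F ℓ k) (hk : IntervalIntegrable k volume 0 ℓ)
    {K : Set (ℝ × ℝ × ℝ)} (hKm : MeasurableSet K) {R : ℝ}
    (hK : ∀ x ∈ K, x.1 ∈ Icc 0 ℓ ∧ |x.2.1| ≤ R ∧ |x.2.2| ≤ R) :
    volume (F.position '' K) ≤
      ∫⁻ x in K, ENNReal.ofReal |1 - x.2.1 * k x.1 0 - x.2.2 * k x.1 1| := by
  set du : ℝ → E3 := fun t => -(k t 0) • F.w t - k t 2 • F.v t with hdu
  set dv : ℝ → E3 := fun t => k t 2 • F.u t - k t 1 • F.w t with hdv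
  have hgood : ∀ᵐ t, t ∈ Icc 0 ℓ → HasDerivAt F.r (F.w t) t ∧ HasDerivAt F.u (du t) t ∧
      HasDerivAt F.v (dv t) t := by
    have e0 : ∀ᵐ s : ℝ, s ≠ 0 := by simp [ae_iff]
    have e1 : ∀ᵐ s : ℝ, s ≠ ℓ := by simp [ae_iff]
    filter_upwards [h.r_prim.ae_hasDerivAt, h.u_prim.ae_hasDerivAt, h.v_prim.ae_hasDerivAt, e0,
      e1] with t h1 h2 h3 h4 h5 ht
    have ht' : t ∈ Ioo 0 ℓ := ⟨lt_of_le_of_ne ht.1 h4.symm, lt_of_le_of_ne ht.2 h5⟩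
    exact ⟨h1 ht', h2 ht', h3 ht'⟩
  obtain ⟨N, hNsub, hNm, hN0⟩ := exists_measurable_superset_of_null (ae_iff.1 hgood)
  have hN : ∀ t ∈ Icc 0 ℓ, t ∉ N → HasDerivAt F.r (F.w t) t ∧ HasDerivAt F.u (du t) t ∧
      HasDerivAt F.v (dv t) t := fun t ht htN => by
    by_contra hcon
    exact htN (hNsub fun h => hcon (h ht))
  set K₁ := K ∩ (Prod.fst ⁻¹' N)ᶜ with hK₁
  set K₂ := K ∩ Prod.fst ⁻¹' N with hK₂
  have hK₁m : MeasurableSet K₁ := hKm.inter (measurable_fst hNm).compl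
  have h2 : volume (F.position '' K₂) = 0 :=
    h.volume_image_null hk (N := N ∩ Icc 0 ℓ) inter_subset_right
      (measure_mono_null inter_subset_left hN0) (R := R)
      fun x hx => ⟨⟨hx.2, (hK x hx.1).1⟩, (hK x hx.1).2⟩
  have hKe : F.position '' K = F.position '' K₁ ∪ F.position '' K₂ := by
    rw [← image_union, hK₁, hK₂, union_comm, inter_union_compl]
  have h1 : volume (F.position '' K₁) ≤
      ∫⁻ x in K₁, ENNReal.ofReal |1 - x.2.1 * k x.1 0 - x.2.2 * k x.1 1| := by
    have him : F.position '' K₁ = (fun x : E3 => F.position (toTriple x)) '' (toTriple ⁻¹' K₁) := by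
      rw [← image_image F.position toTriple, image_preimage_eq _ toTriple_surjective]
    rw [him, ← measurePreserving_toTriple.setLIntegral_comp_preimage_emb
      measurableEmbedding_toTriple]
    refine (addHaar_image_le_lintegral_abs_det_fderiv volume
      (f' := fun x => columns (F.w (x 0) + x 1 • du (x 0) + x 2 • dv (x 0)) (F.u (x 0)) (F.v (x 0)))
      (measurePreserving_toTriple.measurable hK₁m) fun x hx => ?_).trans_eq ?_
    · obtain ⟨e1, e2, e3⟩ := hN (x 0) (hK _ hx.1).1 hx.2
      have p : ∀ i : Fin 3, HasFDerivAt (fun y : E3 => y i) (EuclideanSpace.proj i : E3 →L[ℝ] ℝ) x :=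
        fun i => (EuclideanSpace.proj i : E3 →L[ℝ] ℝ).hasFDerivAt
      have d := ((e1.hasFDerivAt.comp x (p 0)).add ((p 1).smul (e2.hasFDerivAt.comp x (p 0)))).add
        ((p 2).smul (e3.hasFDerivAt.comp x (p 0)))
      refine HasFDerivAt.hasFDerivWithinAt (HasFDerivAt.congr_fderiv d ?_)
      ext1 y
      simp only [columns, add_apply, ContinuousLinearMap.smulRight_apply,
        smul_apply, Function.comp_apply]
      simp only [ContinuousLinearMap.toSpanSingleton_apply, ContinuousLinearMap.comp_apply, PiLp.proj_apply]
      module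
    · refine setLIntegral_congr_fun (measurePreserving_toTriple.measurable hK₁m) fun x hx => ?_
      have hI : x 0 ∈ Icc 0 ℓ := (hK _ hx.1).1
      have hvw : inner ℝ (F.v (x 0)) (cross (F.u (x 0)) (F.v (x 0))) = 0 := inner_cross_self _ _
      have huw : inner ℝ (F.u (x 0)) (cross (F.u (x 0)) (F.v (x 0))) = 0 := inner_self_cross _ _
      have hww : inner ℝ (F.w (x 0)) (cross (F.u (x 0)) (F.v (x 0))) = 1 := by
        change inner ℝ (F.w (x 0)) (F.w (x 0)) = 1
        rw [real_inner_self_eq_norm_sq, h.norm_w hI, one_pow]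
      beta_reduce
      rw [det_columns]
      congr 2
      simp only [hdu, hdv, inner_add_left, inner_sub_left, real_inner_smul_left, hvw, huw, hww,
        toTriple]
      ring
  rw [hKe]
  refine (measure_union_le _ _).trans ?_
  rw [h2, add_zero]
  exact h1.trans (lintegral_mono_set inter_subset_left)

end IsFrame

/-! ### Global injectivity of the tube around the midline -/

lemma CyclicNear.not_both {ℓ δ s t x : ℝ} (hs : s ∈ Icc 0 ℓ) (ht : t ∈ Icc 0 ℓ)
    (hx : x ∈ Icc 0 ℓ) (h1 : 2 * δ ≤ |s - t|) (h2 : |s - t| ≤ ℓ - 3 * δ)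
    (hsx : CyclicNear ℓ δ s x) (htx : CyclicNear ℓ δ t x) : False := by
  have h3 := hs.1
  have h4 := hs.2
  have h5 := ht.1
  have h6 := ht.2
  have e1 : s - t ≤ |s - t| := le_abs_self _
  have e2 : -(s - t) ≤ |s - t| := neg_le_abs _
  rcases hsx.cases hs hx with a | ⟨a, b⟩ | ⟨a, b⟩ <;>
  rcases htx.cases ht hx with c | ⟨c, d⟩ | ⟨c, d⟩ <;>
  (try simp only [abs_lt] at a c) <;>
  rcases abs_cases (s - t) with ⟨h, h'⟩ | ⟨h, h'⟩ <;>
  linarith [hx.1, hx.2]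

lemma continuousOn_position {F : FramedCurve} {ℓ : ℝ} {k : ℝ → E3} (h : IsFrame F ℓ k) :
    ContinuousOn F.position (Prod.fst ⁻¹' Icc 0 ℓ) := by
  have m : MapsTo (Prod.fst : ℝ × ℝ × ℝ → ℝ) (Prod.fst ⁻¹' Icc 0 ℓ) (Icc 0 ℓ) := fun x hx => hx
  have c1 := h.r_prim.continuousOn.comp continuousOn_fst m
  have c2 := h.u_prim.continuousOn.comp continuousOn_fst m
  have c3 := h.v_prim.continuousOn.comp continuousOn_fst m
  exact (c1.add (continuous_snd.fst.continuousOn.smul c2)).add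
    (continuous_snd.snd.continuousOn.smul c3)

namespace Rod

variable {p : ℝ} (B : Rod p)

lemma Ω_subset : B.Ω ⊆ Icc 0 B.ℓ ×ˢ (Icc (-B.R) B.R ×ˢ Icc (-B.R) B.R) := by
  rintro x ⟨hx, hA⟩
  obtain ⟨h1, h2⟩ := B.A_lt x.1 hx x.2 hA
  exact ⟨hx, abs_le.1 h1.le, abs_le.1 h2.le⟩

lemma isCompact_Ω : IsCompact B.Ω := by
  refine (isCompact_Icc.prod (isCompact_Icc.prod isCompact_Icc)).of_isClosed_subset ?_ B.Ω_subset
  rw [Ω, ← B.closure_interior]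
  exact isClosed_closure

lemma measurableSet_Ω : MeasurableSet B.Ω := B.isCompact_Ω.isClosed.measurableSet

lemma R_pos : 0 < B.R := by
  have := (B.A_lt 0 B.zero_mem_Icc 0 (B.disc_subset B.zero_mem_Icc
    (by simpa using pow_pos B.ε_pos 2))).1
  simpa using this

/-- A fibrewise linear functional of an integrable density is integrable over the rod. -/
lemma integrableOn_mul_density {g : ℝ → ℝ} (hg : IntegrableOn g (Icc 0 B.ℓ))
    {c : ℝ × ℝ × ℝ → ℝ} (hc : Continuous c) :
    IntegrableOn (fun x : ℝ × ℝ × ℝ => c x * g x.1) B.Ω := by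
  set Q : Set (ℝ × ℝ) := Icc (-B.R) B.R ×ˢ Icc (-B.R) B.R with hQ
  have hQc : IsCompact Q := isCompact_Icc.prod isCompact_Icc
  have : IsFiniteMeasure (volume.restrict Q) := ⟨by
    rw [Measure.restrict_apply_univ]; exact hQc.measure_lt_top⟩
  have h1 : IntegrableOn (fun x : ℝ × ℝ × ℝ => g x.1) (Icc 0 B.ℓ ×ˢ Q) := by
    rw [IntegrableOn, Measure.volume_eq_prod, ← Measure.prod_restrict]
    exact Integrable.comp_fst hg _
  obtain ⟨C, hC⟩ := (isCompact_Icc.prod hQc).exists_bound_of_continuousOn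
    (hc.continuousOn (s := Icc 0 B.ℓ ×ˢ Q))
  refine IntegrableOn.mono_set ?_ B.Ω_subset
  refine Integrable.bdd_mul h1 hc.aestronglyMeasurable (c := C) ?_
  exact (ae_restrict_iff' (measurableSet_Icc.prod hQc.isClosed.measurableSet)).2
    (Eventually.of_forall hC)

/-- The Jacobian of the position map of a rod with the densities `k`. -/
noncomputable def jacobian (k : ℝ → E3) (x : ℝ × ℝ × ℝ) : ℝ :=
  1 - x.2.1 * k x.1 0 - x.2.2 * k x.1 1

lemma integrableOn_coord {k : ℝ → E3} (hk : IntervalIntegrable k volume 0 B.ℓ) (i : Fin 3) :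
    IntegrableOn (fun t => k t i) (Icc 0 B.ℓ) :=
  (intervalIntegrable_iff_integrableOn_Icc_of_le B.ℓ_pos.le).1 (intervalIntegrable_coord hk i)

lemma integrableOn_jacobian {k : ℝ → E3} (hk : IntervalIntegrable k volume 0 B.ℓ) :
    IntegrableOn (jacobian k) B.Ω := by
  have : IntegrableOn (fun _ : ℝ × ℝ × ℝ => (1 : ℝ)) B.Ω :=
    integrableOn_const B.isCompact_Ω.measure_lt_top.ne
  exact (this.sub (B.integrableOn_mul_density (B.integrableOn_coord hk 0) (by fun_prop))).sub
    (B.integrableOn_mul_density (B.integrableOn_coord hk 1) (by fun_prop))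

/-- A closed rod without local and global interpenetration. -/
structure Impenetrable (F : FramedCurve) (k : ℝ → E3) : Prop where
  isFrame : IsFrame F B.ℓ k
  integrable : IntervalIntegrable k volume 0 B.ℓ
  closed : F.r 0 = F.r B.ℓ ∧ F.w 0 = F.w B.ℓ
  compression_le : ∀ᵐ t, t ∈ Icc 0 B.ℓ → compression B.A (k t 0) (k t 1) t ≤ 1
  volume_le : (∫ x in B.Ω, jacobian k x) ≤ volume.real (F.position '' B.Ω)

namespace Impenetrable

variable {B} {F : FramedCurve} {k : ℝ → E3}

lemma ae_compression (h : B.Impenetrable F k) : ∀ᵐ x : ℝ × ℝ × ℝ,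
    x.1 ∈ Icc 0 B.ℓ → compression B.A (k x.1 0) (k x.1 1) x.1 ≤ 1 :=
  (Measure.quasiMeasurePreserving_fst (μ := (volume : Measure ℝ))
    (ν := (volume : Measure (ℝ × ℝ)))).ae h.compression_le

lemma ae_jacobian_nonneg (h : B.Impenetrable F k) :
    ∀ᵐ x : ℝ × ℝ × ℝ, x ∈ B.Ω → 0 ≤ jacobian k x := by
  filter_upwards [h.ae_compression] with x hx hxΩ
  have := (B.compression_le_one_iff hxΩ.1 _ _).1 (hx hxΩ.1) _ hxΩ.2
  rw [jacobian]; linarith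

lemma ae_jacobian_pos (h : B.Impenetrable F k) :
    ∀ᵐ x : ℝ × ℝ × ℝ, x.1 ∈ Icc 0 B.ℓ → x.2.1 ^ 2 + x.2.2 ^ 2 < B.ε ^ 2 → 0 < jacobian k x := by
  filter_upwards [h.ae_compression] with x hx hx1 hxε
  have h0 : 0 ≤ x.2.1 ^ 2 + x.2.2 ^ 2 := by positivity
  have hlt : √(x.2.1 ^ 2 + x.2.2 ^ 2) < B.ε := by
    rw [Real.sqrt_lt h0 B.ε_pos.le]; exact hxε
  obtain ⟨c, hc, hJ⟩ := B.exists_jacobian_bound_of_lt (Real.sqrt_nonneg _) hlt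
  have := hJ x.1 hx1 _ _ (hx hx1) x.2 (Real.sq_sqrt h0).ge
  rw [jacobian]; linarith

/-- Two cross-sections of the tube of radius `ε` are disjoint. Otherwise a ball would be covered
twice, and the volume of the deformed rod would be less than the integral of the Jacobian. -/
theorem tube_injective (h : B.Impenetrable F k) {s t : ℝ} (hs : s ∈ Icc 0 B.ℓ)
    (ht : t ∈ Icc 0 B.ℓ) {q : E3} (hqs : F.height s q = 0) (hqsε : ‖q - F.r s‖ < B.ε)
    (hqt : F.height t q = 0) (hqtε : ‖q - F.r t‖ < B.ε) : |s - t| = 0 ∨ |s - t| = B.ℓ := by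
  by_contra! hne
  have hle : |s - t| ≤ B.ℓ := by
    rw [abs_le]; constructor <;> linarith [hs.1, hs.2, ht.1, ht.2]
  have hlt : |s - t| < B.ℓ := lt_of_le_of_ne hle hne.2
  have hpos : 0 < |s - t| := lt_of_le_of_ne (abs_nonneg _) hne.1.symm
  obtain ⟨δ, hδ, hδ1, hδ2⟩ : ∃ δ > 0, 2 * δ ≤ |s - t| ∧ |s - t| ≤ B.ℓ - 3 * δ :=
    ⟨min (|s - t|) (B.ℓ - |s - t|) / 3, div_pos (lt_min hpos (by linarith)) three_pos,
      by linarith [min_le_left (|s - t|) (B.ℓ - |s - t|)],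
      by linarith [min_le_right (|s - t|) (B.ℓ - |s - t|)]⟩
  let T : ℝ → Set (ℝ × ℝ × ℝ) := fun s => {x | x.1 ∈ Icc 0 B.ℓ ∧ CyclicNear B.ℓ δ s x.1 ∧
    x.2.1 ^ 2 + x.2.2 ^ 2 < B.ε ^ 2}
  have hTΩ : ∀ s, T s ⊆ B.Ω := fun s x hx => ⟨hx.1, B.disc_subset hx.1 hx.2.2⟩
  have hcover : ∀ s ∈ Icc 0 B.ℓ, F.height s q = 0 → ‖q - F.r s‖ < B.ε →
      ∀ᶠ P in 𝓝 q, P ∈ F.position '' T s := by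
    intro s hs h1 h2
    filter_upwards [eventually_mem_tube (tendstoFrame_const (𝓝 q) F B.ℓ) tendsto_id h.isFrame
      (fun _ => h.isFrame) h.closed (fun _ => h.closed) h.compression_le hs h1 h2 hδ]
      with P ⟨s', hs', hn, hz, hε⟩
    refine ⟨(s', F.sectionCoord s' P), ⟨hs', hn, ?_⟩, h.isFrame.position_sectionCoord hs' hz⟩
    refine (h.isFrame.sectionCoord_sq_le hs' P).trans_lt ?_
    exact pow_lt_pow_left₀ hε (norm_nonneg _) two_ne_zero
  obtain ⟨η, hη, hball⟩ := Metric.mem_nhds_iff.1 (hcover t ht hqt hqtε)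
  have hcont : ContinuousOn F.position B.Ω :=
    (continuousOn_position h.isFrame).mono fun x hx => hx.1
  have hTm : MeasurableSet (T s) := by
    have m1 : Measurable fun x : ℝ × ℝ × ℝ => |x.1 - s| := by fun_prop
    have m2 : Measurable fun x : ℝ × ℝ × ℝ => x.2.1 ^ 2 + x.2.2 ^ 2 := by fun_prop
    exact (measurable_fst measurableSet_Icc).inter (((measurableSet_lt m1 measurable_const).union
      (measurableSet_lt measurable_const m1)).inter (measurableSet_lt m2 measurable_const))
  obtain ⟨O, hO, hOe⟩ := continuousOn_iff'.1 hcont (Metric.ball q η) Metric.isOpen_ball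
  set U := T s ∩ O with hU
  have hUm : MeasurableSet U := hTm.inter hO.measurableSet
  have hUΩ : U ⊆ B.Ω := inter_subset_left.trans (hTΩ s)
  have hUball : ∀ x ∈ U, F.position x ∈ Metric.ball q η := fun x hx => by
    have : x ∈ O ∩ B.Ω := ⟨hx.2, hUΩ hx⟩
    rw [← hOe] at this
    exact this.1
  -- `U` can be removed from the rod without changing its image
  have himage : F.position '' B.Ω ⊆ F.position '' (B.Ω \ U) := by
    rintro _ ⟨x, hx, rfl⟩
    by_cases hxU : x ∈ U
    · obtain ⟨y, hy, hye⟩ := hball (hUball x hxU)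
      exact ⟨y, ⟨hTΩ t hy, fun hyU =>
        CyclicNear.not_both hs ht hy.1 hδ1 hδ2 hyU.1.2.1 hy.2.1⟩, hye⟩
    · exact ⟨x, ⟨hx, hxU⟩, rfl⟩
  have hUpos : 0 < volume U := by
    set ζ := F.sectionCoord s q
    have hζ : ζ.1 ^ 2 + ζ.2 ^ 2 < B.ε ^ 2 := (h.isFrame.sectionCoord_sq_le hs q).trans_lt
      (pow_lt_pow_left₀ hqsε (norm_nonneg _) two_ne_zero)
    have hqζ : F.position (s, ζ) = q := h.isFrame.position_sectionCoord hs hqs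
    have hopen : IsOpen {x : ℝ × ℝ × ℝ | x.1 ∈ Ioo 0 B.ℓ ∧ |x.1 - s| < δ ∧
        x.2.1 ^ 2 + x.2.2 ^ 2 < B.ε ^ 2} :=
      (isOpen_Ioo.preimage continuous_fst).inter ((isOpen_lt (f := fun x : ℝ × ℝ × ℝ => |x.1 - s|)
        (by fun_prop) continuous_const).inter (isOpen_lt
          (f := fun x : ℝ × ℝ × ℝ => x.2.1 ^ 2 + x.2.2 ^ 2) (by fun_prop) continuous_const))
    have hO' : (s, ζ) ∈ O := by
      have : (s, ζ) ∈ F.position ⁻¹' Metric.ball q η ∩ B.Ω :=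
        ⟨by rw [mem_preimage, hqζ]; exact Metric.mem_ball_self hη, hs, B.disc_subset hs hζ⟩
      rw [hOe] at this
      exact this.1
    obtain ⟨s', hs'I, hs'd, hs'O⟩ : ∃ s' ∈ Ioo 0 B.ℓ, |s' - s| < δ ∧ (s', ζ) ∈ O := by
      have hcl : s ∈ closure (Ioo 0 B.ℓ) := by rw [closure_Ioo B.ℓ_pos.ne]; exact hs
      have hnhds : {s' | |s' - s| < δ ∧ (s', ζ) ∈ O} ∈ 𝓝 s := by
        refine IsOpen.mem_nhds ((isOpen_lt (f := fun s' : ℝ => |s' - s|) (by fun_prop)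
        continuous_const).inter (hO.preimage (Continuous.prodMk_left ζ))) ⟨by simpa using hδ, hO'⟩
      obtain ⟨s', h1, h2⟩ := mem_closure_iff_nhds.1 hcl _ hnhds
      exact ⟨s', h2, h1⟩
    refine ((hopen.inter hO).measure_pos volume ⟨(s', ζ), ⟨hs'I, hs'd, hζ⟩, hs'O⟩).trans_le
      (measure_mono ?_)
    rintro x ⟨⟨h1, h2, h3⟩, h4⟩
    exact ⟨⟨Ioo_subset_Icc_self h1, Or.inl h2, h3⟩, h4⟩
  have hJi := B.integrableOn_jacobian h.integrable
  have hJU : 0 < ∫ x in U, jacobian k x := by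
    rw [setIntegral_pos_iff_support_of_nonneg_ae]
    · refine hUpos.trans_le (measure_mono_ae ?_)
      filter_upwards [h.ae_jacobian_pos] with x hx hxU
      exact ⟨(hx hxU.1.1 hxU.1.2.2).ne', hxU⟩
    · exact (ae_restrict_iff' hUm).2 (h.ae_jacobian_nonneg.mono fun x hx hxU => hx (hUΩ hxU))
    · exact hJi.mono_set hUΩ
  have hsplit : ∫ x in B.Ω, jacobian k x =
      (∫ x in B.Ω \ U, jacobian k x) + ∫ x in U, jacobian k x := by
    rw [add_comm, ← setIntegral_union disjoint_sdiff_right (B.measurableSet_Ω.diff hUm)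
      (hJi.mono_set hUΩ) (hJi.mono_set sdiff_subset), union_sdiff_cancel hUΩ]
  have hvol : volume.real (F.position '' B.Ω) ≤ ∫ x in B.Ω \ U, jacobian k x := by
    have hm := B.measurableSet_Ω.diff hUm
    have hnn : ∀ᵐ x ∂(volume.restrict (B.Ω \ U)), 0 ≤ jacobian k x :=
      (ae_restrict_iff' hm).2 (h.ae_jacobian_nonneg.mono fun x hx hxU => hx hxU.1)
    have h1 := h.isFrame.volume_image_le h.integrable hm (R := B.R) fun x hx =>
      ⟨hx.1.1, (B.A_lt x.1 hx.1.1 x.2 hx.1.2).1.le, (B.A_lt x.1 hx.1.1 x.2 hx.1.2).2.le⟩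
    have h2 : ∫⁻ x in B.Ω \ U, ENNReal.ofReal |1 - x.2.1 * k x.1 0 - x.2.2 * k x.1 1| =
        ENNReal.ofReal (∫ x in B.Ω \ U, jacobian k x) := by
      rw [ofReal_integral_eq_lintegral_ofReal (hJi.mono_set sdiff_subset) hnn]
      refine lintegral_congr_ae ?_
      filter_upwards [hnn] with x hx
      rw [← jacobian, abs_of_nonneg hx]
    rw [h2] at h1
    rw [Measure.real]
    refine ENNReal.toReal_le_of_le_ofReal (integral_nonneg_of_ae hnn) ?_
    exact (measure_mono himage).trans h1
  linarith [h.volume_le]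

/-- The closed midline is simple. -/
lemma midline_injective (h : B.Impenetrable F k) {s t : ℝ} (hs : s ∈ Icc 0 B.ℓ)
    (ht : t ∈ Icc 0 B.ℓ) (hst : F.r s = F.r t) : |s - t| = 0 ∨ |s - t| = B.ℓ :=
  h.tube_injective hs ht (q := F.r s) (by simp [FramedCurve.height])
    (by simpa using B.ε_pos) (by simp [FramedCurve.height, hst]) (by simpa [hst] using B.ε_pos)

/-- The points of the tube off the midline are not on the midline. -/
lemma midline_ne (h : B.Impenetrable F k) {s t : ℝ} (hs : s ∈ Icc 0 B.ℓ)
    (ht : t ∈ Icc 0 B.ℓ) {q : E3} (hq : F.height t q = 0) (hq0 : 0 < ‖q - F.r t‖)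
    (hqε : ‖q - F.r t‖ < B.ε) : F.r s ≠ q := by
  intro he
  have := h.tube_injective hs ht (q := q) (by simp [FramedCurve.height, ← he])
    (by simpa [← he] using B.ε_pos) hq hqε
  have hr : F.r s = F.r t := by
    rcases this with h0 | h0
    · rw [sub_eq_zero.1 (abs_eq_zero.1 h0)]
    · rcases abs_cases (s - t) with ⟨h1, _⟩ | ⟨h1, _⟩
      · have e1 : t = 0 := by linarith [hs.2, ht.1]
        have e2 : s = B.ℓ := by linarith
        rw [e1, e2, h.closed.1]
      · have e1 : s = 0 := by linarith [ht.2, hs.1]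
        have e2 : t = B.ℓ := by linarith
        rw [e1, e2, h.closed.1]
  rw [← he, hr, sub_self, norm_zero] at hq0
  exact lt_irrefl _ hq0

end Impenetrable

end Rod

/-! ### Isotopies of links -/

/-- Isotopies of links can be composed. -/
lemma LinkIsotopic.trans {K₁ K₂ L₁ L₂ H₁ H₂ : Set E3} (h : LinkIsotopic K₁ K₂ L₁ L₂)
    (h' : LinkIsotopic L₁ L₂ H₁ H₂) : LinkIsotopic K₁ K₂ H₁ H₂ := by
  obtain ⟨N, N', Φ, hN, hN', hKN, hLN, hΦ, hΦe, hΦ0, hΦN, hΦ1, hΦ2⟩ := h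
  obtain ⟨M, M', Ψ, hM, hM', hLM, hHM, hΨ, hΨe, hΨ0, hΨM, hΨ1, hΨ2⟩ := h'
  have h1I : (1 : ℝ) ∈ Icc (0 : ℝ) 1 := ⟨zero_le_one, le_rfl⟩
  have hΦ1c : ContinuousOn (Φ 1) N := hΦ.comp (f := fun x => ((1 : ℝ), x))
    (Continuous.prodMk_right 1).continuousOn fun x hx => ⟨h1I, hx⟩
  set N₀ := N ∩ Φ 1 ⁻¹' M with hN₀
  have hN₀o : IsOpen N₀ := hΦ1c.isOpen_inter_preimage hN hM
  let Θ : ℝ → E3 → E3 := fun τ x => if τ ≤ 1 / 2 then Φ (2 * τ) x else Ψ (2 * τ - 1) (Φ 1 x)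
  have hΘ1 : Θ 1 = fun x => Ψ 1 (Φ 1 x) := by
    funext x
    have : ¬ (1 : ℝ) ≤ 1 / 2 := by norm_num
    simp only [Θ, this, if_false]
    norm_num
  have hsub : K₁ ∪ K₂ ⊆ N₀ := by
    refine subset_inter hKN fun x hx => ?_
    apply hLM
    rw [← hΦ1, ← hΦ2]
    exact hx.imp (fun h => mem_image_of_mem _ h) fun h => mem_image_of_mem _ h
  have hopen : IsOpen (Θ 1 '' N₀) := by
    have e1 : Φ 1 '' N₀ = N' ∩ M := by rw [hN₀, image_inter_preimage, hΦN]
    have e2 : Θ 1 '' N₀ = M.domRestrict (Ψ 1) '' (Subtype.val ⁻¹' (N' ∩ M)) := by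
      rw [hΘ1, ← image_image (Ψ 1) (Φ 1), e1, domRestrict_eq, image_comp,
        Subtype.image_preimage_coe, ← inter_assoc, inter_comm M, inter_assoc, inter_self]
    have hoe : IsOpenEmbedding (M.domRestrict (Ψ 1)) :=
      ⟨hΨe 1 h1I, by rw [range_domRestrict, hΨM]; exact hM'⟩
    rw [e2]
    exact hoe.isOpenMap _ ((hN'.inter hM).preimage continuous_subtype_val)
  refine ⟨N₀, Θ 1 '' N₀, Θ, hN₀o, hopen, hsub, ?_, ?_, ?_, ?_, rfl, ?_, ?_⟩
  · rw [← hΨ1, ← hΨ2, ← hΦ1, ← hΦ2, hΘ1, image_image, image_image, ← image_union]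
    exact image_mono hsub
  · apply ContinuousOn.if
    · rintro ⟨τ, x⟩ ⟨⟨_, hx⟩, hfr⟩
      have hτ : τ = 1 / 2 := frontier_le_subset_eq continuous_fst continuous_const hfr
      subst hτ
      norm_num
      exact (hΨ0 _ hx.2).symm
    · refine hΦ.comp (f := fun q : ℝ × E3 => (2 * q.1, q.2)) (by fun_prop) ?_
      rintro ⟨τ, x⟩ ⟨⟨hτ, hx⟩, hcl⟩
      rw [(isClosed_le continuous_fst continuous_const).closure_eq] at hcl
      have : τ ≤ 1 / 2 := hcl
      exact ⟨⟨by linarith [hτ.1], by linarith⟩, hx.1⟩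
    · have hmap : ∀ q ∈ (Icc (0 : ℝ) 1 ×ˢ N₀) ∩ closure {a : ℝ × E3 | ¬ a.1 ≤ 1 / 2},
          (1 : ℝ) / 2 ≤ q.1 := by
        rintro q ⟨_, hq⟩
        have : closure {a : ℝ × E3 | ¬ a.1 ≤ 1 / 2} ⊆ {a | 1 / 2 ≤ a.1} :=
          closure_minimal (fun a ha => (not_le.1 ha).le)
            (isClosed_le continuous_const continuous_fst)
        exact this hq
      refine hΨ.comp (f := fun q : ℝ × E3 => (2 * q.1 - 1, Φ 1 q.2))
        (ContinuousOn.prodMk (by fun_prop)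
          (hΦ1c.comp continuousOn_snd fun q hq => hq.1.2.1)) ?_
      rintro q hq
      have := hmap q hq
      exact ⟨⟨by dsimp only; linarith, by dsimp only; linarith [hq.1.1.2]⟩, hq.1.2.2⟩
  · intro τ hτ
    have hres : ∀ φ : E3 → E3, IsEmbedding (N.domRestrict φ) → IsEmbedding (N₀.domRestrict φ) :=
      fun φ hφ => hφ.comp (IsEmbedding.inclusion inter_subset_left)
    by_cases hle : τ ≤ 1 / 2
    · have : Θ τ = Φ (2 * τ) := by funext x; simp only [Θ, hle, if_true]
      rw [this]
      exact hres _ (hΦe _ ⟨by linarith [hτ.1], by linarith⟩)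
    · have : Θ τ = fun x => Ψ (2 * τ - 1) (Φ 1 x) := by funext x; simp only [Θ, hle, if_false]
      rw [this]
      have e1 : IsEmbedding (M.codRestrict (N₀.domRestrict (Φ 1)) fun x => x.2.2) :=
        (hres _ (hΦe 1 h1I)).codRestrict M _
      exact (hΨe (2 * τ - 1) ⟨by linarith, by linarith [hτ.2]⟩).comp e1
  · intro x hx
    have : (0 : ℝ) ≤ 1 / 2 := by norm_num
    simp only [Θ, this, if_true, mul_zero]
    exact hΦ0 x hx.1
  · rw [hΘ1, ← image_image (Ψ 1) (Φ 1), hΦ1, hΨ1]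
  · rw [hΘ1, ← image_image (Ψ 1) (Φ 1), hΦ2, hΨ2]

/-- A perturbation of the identity with Lipschitz constant less than one is an ambient isotopy. -/
lemma linkIsotopic_of_lipschitzWith {e : E3 → E3} {κ : ℝ≥0} (he : LipschitzWith κ e) (hκ : κ < 1)
    (K₁ K₂ : Set E3) :
    LinkIsotopic K₁ K₂ ((fun x => x + e x) '' K₁) ((fun x => x + e x) '' K₂) := by
  have hec := he.continuous
  have hsurj : Function.Surjective fun x => x + e x := by
    intro y
    have hc : ContractingWith κ fun x => y - e x := ⟨hκ, LipschitzWith.of_dist_le_mul fun a b => by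
      rw [dist_sub_left]; exact he.dist_le_mul a b⟩
    refine ⟨hc.fixedPoint, ?_⟩
    have := hc.fixedPoint_isFixedPt
    rw [Function.IsFixedPt] at this
    beta_reduce
    nth_rw 1 [← this]
    abel
  refine ⟨univ, univ, fun τ x => x + τ • e x, isOpen_univ, isOpen_univ, subset_univ _,
    subset_univ _, by fun_prop, fun τ hτ => ?_, by simp, ?_, by simp, by simp⟩
  · have hκ' : (κ : ℝ) < 1 := by exact_mod_cast hκ
    have hanti : AntilipschitzWith (Real.toNNReal (1 - κ)⁻¹) fun x => x + τ • e x := by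
      refine AntilipschitzWith.of_le_mul_dist fun x y => ?_
      rw [Real.coe_toNNReal _ (inv_nonneg.2 (by linarith)), ← div_eq_inv_mul,
        le_div_iff₀ (by linarith), dist_eq_norm, dist_eq_norm]
      have h1 : x - y = (x + τ • e x - (y + τ • e y)) - τ • (e x - e y) := by module
      have h2 : ‖x - y‖ ≤ ‖x + τ • e x - (y + τ • e y)‖ + ‖τ • (e x - e y)‖ := by
        conv_lhs => rw [h1]
        exact norm_sub_le _ _
      have h3 : ‖τ • (e x - e y)‖ ≤ κ * ‖x - y‖ := by
        rw [norm_smul, Real.norm_eq_abs, abs_of_nonneg hτ.1]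
        have := he.dist_le_mul x y
        rw [dist_eq_norm, dist_eq_norm] at this
        nlinarith [norm_nonneg (e x - e y), hτ.2]
      linarith
    have huc : UniformContinuous fun x => x + τ • e x :=
      uniformContinuous_id.add (he.uniformContinuous.const_smul τ)
    exact (hanti.isUniformEmbedding huc).isEmbedding.comp IsEmbedding.subtypeVal
  · simp only [one_smul, image_univ]
    exact hsurj.range_eq

/-- The distance of two parameters along a closed curve of length `ℓ`. -/
noncomputable def cyclicDist (ℓ s t : ℝ) : ℝ := min |s - t| (ℓ - |s - t|)

/-- A closed curve that is continuously differentiable and simple satisfies a chord-arc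
condition. -/
lemma exists_chord_arc {ℓ : ℝ} (hℓ : 0 < ℓ) {r w : ℝ → E3} (hr : IsPrimitive ℓ r w)
    (hw : ContinuousOn w (Icc 0 ℓ)) (hw1 : ∀ s ∈ Icc 0 ℓ, ‖w s‖ = 1) (hcr : r 0 = r ℓ)
    (hcw : w 0 = w ℓ)
    (hinj : ∀ s ∈ Icc 0 ℓ, ∀ t ∈ Icc 0 ℓ, r s = r t → |s - t| = 0 ∨ |s - t| = ℓ) :
    ∃ c > 0, ∀ s ∈ Icc 0 ℓ, ∀ t ∈ Icc 0 ℓ, c * cyclicDist ℓ s t ≤ ‖r s - r t‖ := by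
  obtain ⟨δ, hδ, hδw⟩ := exists_dist_lt_of_cyclicNear hℓ.le hw hcw (half_pos one_pos)
  have h0 := hr.zero_mem
  have hl : ℓ ∈ Icc 0 ℓ := ⟨hℓ.le, le_rfl⟩
  -- along short arcs, the chord is compared with a tangent vector
  have chord : ∀ s ∈ Icc 0 ℓ, ∀ t ∈ Icc 0 ℓ, s ≤ t → ∀ a ∈ Icc 0 ℓ,
      (∀ τ ∈ Icc s t, CyclicNear ℓ δ a τ) → ‖r t - r s - (t - s) • w a‖ ≤ (t - s) / 2 := by
    intro s hs t ht hst a ha hn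
    have e1 : r t - r s - (t - s) • w a = ∫ τ in s..t, (w τ - w a) := by
      rw [intervalIntegral.integral_sub (hr.intervalIntegrable hs ht) (by simp),
        ← hr.sub_eq_integral hs ht, intervalIntegral.integral_const]
    rw [e1]
    have := intervalIntegral.norm_integral_le_of_norm_le_const (a := s) (b := t) (C := 1 / 2)
      (f := fun τ => w τ - w a) (fun τ hτ => by
        rw [uIoc_of_le hst] at hτ
        have := hδw a ha τ ⟨hs.1.trans hτ.1.le, hτ.2.trans ht.2⟩ (hn τ (Ioc_subset_Icc_self hτ))
        rw [dist_comm, dist_eq_norm] at this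
        exact this.le)
    rw [abs_of_nonneg (by linarith)] at this
    linarith
  have local_bound : ∀ s ∈ Icc 0 ℓ, ∀ t ∈ Icc 0 ℓ, s ≤ t → CyclicNear ℓ δ s t →
      1 / 2 * cyclicDist ℓ s t ≤ ‖r s - r t‖ := by
    intro s hs t ht hst hn
    have habs : |s - t| = t - s := by rw [abs_sub_comm, abs_of_nonneg (by linarith)]
    rw [CyclicNear, abs_of_nonneg (by linarith : 0 ≤ t - s)] at hn
    rw [cyclicDist, habs]
    rcases hn with hn | hn
    · have e1 := chord s hs t ht hst s hs fun τ hτ => Or.inl (by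
        rw [abs_of_nonneg (by linarith [hτ.1])]; linarith [hτ.2])
      have e2 : ‖(t - s) • w s‖ = t - s := by
        rw [norm_smul, hw1 s hs, mul_one, Real.norm_of_nonneg (by linarith)]
      have e3 := norm_sub_norm_le ((t - s) • w s) ((t - s) • w s - (r t - r s))
      rw [sub_sub_cancel, norm_sub_rev _ (r t - r s), e2, norm_sub_rev (r t)] at e3
      linarith [min_le_left (t - s) (ℓ - (t - s))]
    · have e1 := chord 0 h0 s hs hs.1 0 h0 fun τ hτ => Or.inl (by
        rw [sub_zero, abs_of_nonneg hτ.1]; linarith [hτ.2, ht.2])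
      have e2 := chord t ht ℓ hl ht.2 ℓ hl fun τ hτ => Or.inl (by
        rw [abs_of_nonpos (by linarith [hτ.2])]; linarith [hτ.1, hs.1])
      rw [← hcw] at e2
      have e3 : ‖(s + (ℓ - t)) • w 0‖ = s + (ℓ - t) := by
        rw [norm_smul, hw1 0 h0, mul_one, Real.norm_of_nonneg (by linarith [hs.1, ht.2])]
      have e4 : (s + (ℓ - t)) • w 0 = (r s - r t) - ((r s - r 0 - (s - 0) • w 0) +
          (r ℓ - r t - (ℓ - t) • w 0)) := by rw [hcr]; module
      have e5 := norm_sub_le (r s - r t) ((r s - r 0 - (s - 0) • w 0) +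
          (r ℓ - r t - (ℓ - t) • w 0))
      rw [← e4, e3] at e5
      have e6 := norm_add_le (r s - r 0 - (s - 0) • w 0) (r ℓ - r t - (ℓ - t) • w 0)
      linarith [min_le_right (t - s) (ℓ - (t - s))]
  set S : Set (ℝ × ℝ) := (Icc 0 ℓ ×ˢ Icc 0 ℓ) ∩ {x | δ ≤ |x.2 - x.1| ∧ |x.2 - x.1| ≤ ℓ - δ}
    with hS
  have hSc : IsCompact S := by
    refine (isCompact_Icc.prod isCompact_Icc).inter_right (IsClosed.inter ?_ ?_)
    · exact isClosed_le continuous_const (g := fun x : ℝ × ℝ => |x.2 - x.1|) (by fun_prop)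
    · exact isClosed_le (f := fun x : ℝ × ℝ => |x.2 - x.1|) (by fun_prop) continuous_const
  have hSf : ContinuousOn (fun x : ℝ × ℝ => ‖r x.1 - r x.2‖) S :=
    ((hr.continuousOn.comp continuousOn_fst fun x hx => hx.1.1).sub
      (hr.continuousOn.comp continuousOn_snd fun x hx => hx.1.2)).norm
  obtain ⟨m, hm, hmS⟩ : ∃ m > 0, ∀ x ∈ S, m ≤ ‖r x.1 - r x.2‖ := by
    rcases S.eq_empty_or_nonempty with hemp | hne
    · exact ⟨1, one_pos, by simp [hemp]⟩
    · obtain ⟨x, hx, hmin⟩ := hSc.exists_isMinOn hne hSf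
      refine ⟨_, ?_, fun y hy => hmin hy⟩
      rw [gt_iff_lt, norm_pos_iff, sub_ne_zero]
      intro he
      have := hinj x.1 hx.1.1 x.2 hx.1.2 he
      rw [abs_sub_comm] at this
      rcases this with h | h
      · linarith [hx.2.1]
      · linarith [hx.2.2]
  refine ⟨min (1 / 2) (m / ℓ), lt_min (by norm_num) (div_pos hm hℓ), fun s hs t ht => ?_⟩
  have hd0 : 0 ≤ cyclicDist ℓ s t := by
    refine le_min (abs_nonneg _) ?_
    rw [sub_nonneg, abs_le]; constructor <;> linarith [hs.1, hs.2, ht.1, ht.2]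
  by_cases hn : CyclicNear ℓ δ s t
  · refine (mul_le_mul_of_nonneg_right (min_le_left _ _) hd0).trans ?_
    rcases le_total s t with hst | hst
    · exact local_bound s hs t ht hst hn
    · rw [cyclicDist, abs_sub_comm, norm_sub_rev]
      refine local_bound t ht s hs hst ?_
      rwa [CyclicNear, abs_sub_comm]
  · rw [CyclicNear, not_or, not_lt, not_lt] at hn
    have h1 := hmS (s, t) ⟨⟨hs, ht⟩, hn⟩
    refine (mul_le_mul_of_nonneg_right (min_le_right _ _) hd0).trans (le_trans ?_ h1)
    have h2 : cyclicDist ℓ s t ≤ ℓ := (min_le_right _ _).trans (by linarith [abs_nonneg (s - t)])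
    calc m / ℓ * cyclicDist ℓ s t ≤ m / ℓ * ℓ := by gcongr
      _ = m := by field_simp

/-- A closed curve moves by at most its maximal speed times the cyclic distance. -/
lemma norm_sub_le_cyclicDist {ℓ η : ℝ} {x x' : ℝ → E3} (hx : IsPrimitive ℓ x x')
    (hc : x 0 = x ℓ) (hle : ∀ s ∈ Icc 0 ℓ, ‖x' s‖ ≤ η) {s t : ℝ} (hs : s ∈ Icc 0 ℓ)
    (ht : t ∈ Icc 0 ℓ) : ‖x s - x t‖ ≤ η * cyclicDist ℓ s t := by
  have arc : ∀ a ∈ Icc 0 ℓ, ∀ b ∈ Icc 0 ℓ, ‖x b - x a‖ ≤ η * |b - a| := by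
    intro a ha b hb
    rw [hx.sub_eq_integral ha hb]
    refine intervalIntegral.norm_integral_le_of_norm_le_const fun τ hτ => hle τ ?_
    exact (convex_Icc 0 ℓ).ordConnected.uIcc_subset ha hb (uIoc_subset_uIcc hτ)
  have h0 := hx.zero_mem
  have hl : ℓ ∈ Icc 0 ℓ := ⟨hx.nonneg, le_rfl⟩
  have hη : 0 ≤ η := (norm_nonneg _).trans (hle 0 h0)
  rw [cyclicDist, mul_min_of_nonneg _ _ hη]
  refine le_min (arc t ht s hs) ?_
  wlog hst : s ≤ t generalizing s t
  · rw [norm_sub_rev, abs_sub_comm]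
    exact this ht hs (le_of_not_ge hst)
  have e1 := arc 0 h0 s hs
  have e2 := arc t ht ℓ hl
  rw [sub_zero, abs_of_nonneg hs.1] at e1
  rw [abs_of_nonneg (by linarith [ht.2])] at e2
  rw [abs_sub_comm, abs_of_nonneg (by linarith : 0 ≤ t - s)]
  have e3 := norm_add_le (x s - x 0) (x ℓ - x t)
  rw [show x s - x 0 + (x ℓ - x t) = x s - x t by rw [hc]; abel] at e3
  linarith

/-- Disjoint compact curves stay apart. -/
lemma exists_pos_le_norm_sub {ℓ₁ ℓ₂ : ℝ} {c c' : ℝ → E3} (hc : ContinuousOn c (Icc 0 ℓ₁))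
    (hc' : ContinuousOn c' (Icc 0 ℓ₂)) (hd : Disjoint (c '' Icc 0 ℓ₁) (c' '' Icc 0 ℓ₂)) :
    ∃ d > 0, ∀ s ∈ Icc 0 ℓ₁, ∀ t ∈ Icc 0 ℓ₂, d ≤ ‖c s - c' t‖ := by
  obtain ⟨d, hd, h⟩ := Metric.exists_pos_forall_lt_edist
    (isCompact_Icc.image_of_continuousOn hc) (isCompact_Icc.image_of_continuousOn hc').isClosed hd
  refine ⟨d, hd, fun s hs t ht => ?_⟩
  have := h _ (mem_image_of_mem c hs) _ (mem_image_of_mem c' ht)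
  rw [edist_nndist, ENNReal.coe_lt_coe, ← NNReal.coe_lt_coe, coe_nndist, dist_eq_norm] at this
  exact this.le

/-- Continuously differentiable links near to a given one are isotopic to it: the displacement of the
curves has a small Lipschitz constant and is extended to the whole space. -/
lemma eventually_linkIsotopic {p : ℝ} {B₁ B₂ : Rod p} {F₁ F₂ : FramedCurve} {k₁ k₂ : ℝ → E3}
    (h₁ : B₁.Impenetrable F₁ k₁) (h₂ : B₂.Impenetrable F₂ k₂)
    (hdisj : Disjoint (F₁.r '' Icc 0 B₁.ℓ) (F₂.r '' Icc 0 B₂.ℓ)) {ι : Type*} {l : Filter ι}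
    {Fs₁ Fs₂ : ι → FramedCurve} {ks₁ ks₂ : ι → ℝ → E3}
    (hF₁ : TendstoFrame Fs₁ l F₁ B₁.ℓ) (hF₂ : TendstoFrame Fs₂ l F₂ B₂.ℓ)
    (hs₁ : ∀ i, IsFrame (Fs₁ i) B₁.ℓ (ks₁ i)) (hs₂ : ∀ i, IsFrame (Fs₂ i) B₂.ℓ (ks₂ i))
    (hc₁ : ∀ i, (Fs₁ i).r 0 = (Fs₁ i).r B₁.ℓ) (hc₂ : ∀ i, (Fs₂ i).r 0 = (Fs₂ i).r B₂.ℓ) :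
    ∀ᶠ i in l, LinkIsotopic (F₁.r '' Icc 0 B₁.ℓ) (F₂.r '' Icc 0 B₂.ℓ)
      ((Fs₁ i).r '' Icc 0 B₁.ℓ) ((Fs₂ i).r '' Icc 0 B₂.ℓ) := by
  have chord : ∀ {B : Rod p} {F : FramedCurve} {k : ℝ → E3}, B.Impenetrable F k →
      ∃ c > 0, ∀ s ∈ Icc 0 B.ℓ, ∀ t ∈ Icc 0 B.ℓ, c * cyclicDist B.ℓ s t ≤ ‖F.r s - F.r t‖ :=
    fun {B F k} h => exists_chord_arc B.ℓ_pos h.isFrame.r_prim h.isFrame.w_prim.continuousOn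
      (fun s hs => h.isFrame.norm_w hs) h.closed.1 h.closed.2
      fun s hs t ht he => h.midline_injective hs ht he
  obtain ⟨c₁, hc₁0, hch₁⟩ := chord h₁
  obtain ⟨c₂, hc₂0, hch₂⟩ := chord h₂
  set K₁ := F₁.r '' Icc 0 B₁.ℓ with hK₁
  set K₂ := F₂.r '' Icc 0 B₂.ℓ with hK₂
  obtain ⟨d, hd, hdK⟩ : ∃ d > 0, ∀ x ∈ K₁, ∀ y ∈ K₂, d ≤ ‖x - y‖ := by
    obtain ⟨d, hd, h⟩ := exists_pos_le_norm_sub h₁.isFrame.r_prim.continuousOn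
      h₂.isFrame.r_prim.continuousOn hdisj
    refine ⟨d, hd, ?_⟩
    rintro _ ⟨s, hs, rfl⟩ _ ⟨t, ht, rfl⟩
    exact h s hs t ht
  set L := lipschitzExtensionConstant E3 with hL
  have hL0 : (0 : ℝ) < L := by exact_mod_cast lipschitzExtensionConstant_pos E3
  set κ : ℝ := 1 / (2 * L) with hκ
  have hκ0 : 0 < κ := by positivity
  set η := min (κ * c₁) (min (κ * c₂) (κ * d / 2)) with hη
  have hη0 : 0 < η := lt_min (by positivity) (lt_min (by positivity) (by positivity))
  have hη1 : η ≤ κ * c₁ := min_le_left _ _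
  have hη2 : η ≤ κ * c₂ := (min_le_right _ _).trans (min_le_left _ _)
  have hη3 : η ≤ κ * d / 2 := (min_le_right _ _).trans (min_le_right _ _)
  filter_upwards [Metric.tendstoUniformlyOn_iff.1 hF₁.r η hη0,
    Metric.tendstoUniformlyOn_iff.1 hF₁.w η hη0, Metric.tendstoUniformlyOn_iff.1 hF₂.r η hη0,
    Metric.tendstoUniformlyOn_iff.1 hF₂.w η hη0] with i r₁ w₁ r₂ w₂
  -- the displacement is well defined on the link by the chord-arc condition
  have same : ∀ {B : Rod p} {F G : FramedCurve} {k k' : ℝ → E3} {c : ℝ}, B.Impenetrable F k →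
      IsFrame G B.ℓ k' → G.r 0 = G.r B.ℓ → 0 < c → η ≤ κ * c →
      (∀ s ∈ Icc 0 B.ℓ, ∀ t ∈ Icc 0 B.ℓ, c * cyclicDist B.ℓ s t ≤ ‖F.r s - F.r t‖) →
      (∀ s ∈ Icc 0 B.ℓ, dist (F.w s) (G.w s) < η) →
      ∀ s ∈ Icc 0 B.ℓ, ∀ t ∈ Icc 0 B.ℓ,
        ‖(G.r s - F.r s) - (G.r t - F.r t)‖ ≤ κ * ‖F.r s - F.r t‖ := by
    intro B F G k k' c hF hG hGc hc hηc hch hw s hs t ht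
    have h1 := norm_sub_le_cyclicDist (hG.r_prim.sub hF.isFrame.r_prim)
      (by rw [hGc, hF.closed.1]) (η := κ * c) (fun s hs => by
        have := hw s hs
        rw [dist_comm, dist_eq_norm] at this
        exact this.le.trans hηc) hs ht
    refine h1.trans ?_
    rw [mul_assoc]
    exact mul_le_mul_of_nonneg_left (hch s hs t ht) hκ0.le
  have s₁ := same h₁ (hs₁ i) (hc₁ i) hc₁0 hη1 hch₁ w₁
  have s₂ := same h₂ (hs₂ i) (hc₂ i) hc₂0 hη2 hch₂ w₂
  have hex₁ : ∀ x ∈ K₁, ∃ s ∈ Icc 0 B₁.ℓ, F₁.r s = x := fun x hx => hx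
  have hex₂ : ∀ x ∈ K₂, ∃ s ∈ Icc 0 B₂.ℓ, F₂.r s = x := fun x hx => hx
  choose! σ₁ hσ₁ hσ₁r using hex₁
  choose! σ₂ hσ₂ hσ₂r using hex₂
  classical
  let e₀ : E3 → E3 := fun x => if x ∈ K₁ then (Fs₁ i).r (σ₁ x) - x else (Fs₂ i).r (σ₂ x) - x
  have hnot : ∀ x ∈ K₂, x ∉ K₁ := fun x hx hx' => disjoint_left.1 hdisj hx' hx
  have e₀₁ : ∀ s ∈ Icc 0 B₁.ℓ, e₀ (F₁.r s) = (Fs₁ i).r s - F₁.r s := by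
    intro s hs
    have hx : F₁.r s ∈ K₁ := mem_image_of_mem _ hs
    have := s₁ _ (hσ₁ _ hx) s hs
    rw [hσ₁r _ hx, sub_self, norm_zero, mul_zero, norm_le_zero_iff, sub_eq_zero] at this
    simp only [e₀, hx, if_true]
    exact this
  have e₀₂ : ∀ s ∈ Icc 0 B₂.ℓ, e₀ (F₂.r s) = (Fs₂ i).r s - F₂.r s := by
    intro s hs
    have hx : F₂.r s ∈ K₂ := mem_image_of_mem _ hs
    have := s₂ _ (hσ₂ _ hx) s hs
    rw [hσ₂r _ hx, sub_self, norm_zero, mul_zero, norm_le_zero_iff, sub_eq_zero] at this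
    simp only [e₀, hnot _ hx, if_false]
    exact this
  have hmix : ∀ s ∈ Icc 0 B₁.ℓ, ∀ t ∈ Icc 0 B₂.ℓ,
      ‖e₀ (F₁.r s) - e₀ (F₂.r t)‖ ≤ κ * ‖F₁.r s - F₂.r t‖ := by
    intro s hs t ht
    rw [e₀₁ s hs, e₀₂ t ht]
    have a := r₁ s hs
    have b := r₂ t ht
    rw [dist_comm, dist_eq_norm] at a b
    have h3 := mul_le_mul_of_nonneg_left (hdK _ (mem_image_of_mem _ hs) _ (mem_image_of_mem _ ht))
      hκ0.le
    linarith [norm_sub_le ((Fs₁ i).r s - F₁.r s) ((Fs₂ i).r t - F₂.r t)]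
  have hlip : LipschitzOnWith (Real.toNNReal κ) e₀ (K₁ ∪ K₂) := by
    refine LipschitzOnWith.of_dist_le_mul fun x hx y hy => ?_
    rw [Real.coe_toNNReal _ hκ0.le, dist_eq_norm, dist_eq_norm]
    rcases hx with ⟨s, hs, rfl⟩ | ⟨s, hs, rfl⟩ <;> rcases hy with ⟨t, ht, rfl⟩ | ⟨t, ht, rfl⟩
    · rw [e₀₁ s hs, e₀₁ t ht]; exact s₁ s hs t ht
    · exact hmix s hs t ht
    · rw [norm_sub_rev, norm_sub_rev (F₂.r s)]; exact hmix t ht s hs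
    · rw [e₀₂ s hs, e₀₂ t ht]; exact s₂ s hs t ht
  obtain ⟨e, he, heq⟩ := hlip.extend_finite_dimension
  have hlt : L * Real.toNNReal κ < 1 := by
    rw [← NNReal.coe_lt_coe, NNReal.coe_mul, Real.coe_toNNReal _ hκ0.le, NNReal.coe_one, hκ]
    field_simp
    norm_num
  have := linkIsotopic_of_lipschitzWith he hlt K₁ K₂
  have i₁ : (fun x => x + e x) '' K₁ = (Fs₁ i).r '' Icc 0 B₁.ℓ := by
    rw [hK₁, image_image]
    refine image_congr fun s hs => ?_
    rw [← heq (Or.inl (mem_image_of_mem _ hs)), e₀₁ s hs, add_sub_cancel]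
  have i₂ : (fun x => x + e x) '' K₂ = (Fs₂ i).r '' Icc 0 B₂.ℓ := by
    rw [hK₂, image_image]
    refine image_congr fun s hs => ?_
    rw [← heq (Or.inr (mem_image_of_mem _ hs)), e₀₂ s hs, add_sub_cancel]
  rwa [i₁, i₂] at this

/-! ### Strong limits of convex combinations in `L^p` -/

section convexLimit

variable {E : Type*} [NormedAddCommGroup E] {α : Type*} [MeasurableSpace α] {μ : Measure α} {p : ℝ}

lemma integrable_of_lp [IsFiniteMeasure μ] [h1 : Fact (1 ≤ ENNReal.ofReal p)]
    (z : Lp E (ENNReal.ofReal p) μ) : Integrable z μ :=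
  (Lp.memLp z).integrable h1.out

lemma integral_norm_rpow_le [Fact (1 ≤ ENNReal.ofReal p)] (hp : 1 < p)
    {z : Lp E (ENNReal.ofReal p) μ} {C : ℝ} (hz : ‖z‖ ≤ C) : ∫ s, ‖z s‖ ^ p ∂μ ≤ C ^ p := by
  have hp0 : 0 < p := by linarith
  have h := (Lp.memLp z).eLpNorm_eq_integral_rpow_norm (by simpa using hp0) ENNReal.ofReal_ne_top
  rw [ENNReal.toReal_ofReal hp0.le] at h
  have h2 : ‖z‖ = (∫ s, ‖z s‖ ^ p ∂μ) ^ p⁻¹ := by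
    rw [Lp.norm_def, h, ENNReal.toReal_ofReal (by positivity)]
  have h3 : ∫ s, ‖z s‖ ^ p ∂μ = ‖z‖ ^ p := by
    rw [h2, ← Real.rpow_mul (by positivity), inv_mul_cancel₀ hp0.ne', Real.rpow_one]
  rw [h3]
  gcongr

lemma integrable_norm_rpow (hp : 1 < p) (z : Lp E (ENNReal.ofReal p) μ) :
    Integrable (fun s => ‖z s‖ ^ p) μ := by
  have hp0 : 0 < p := by linarith
  have := (Lp.memLp z).integrable_norm_rpow (by simpa using hp0) ENNReal.ofReal_ne_top
  rwa [ENNReal.toReal_ofReal hp0.le] at this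

lemma integrable_sqrt [IsFiniteMeasure μ] {g : α → E} (hg : Integrable g μ) :
    Integrable (fun s => √(1 + ‖g s‖ ^ 2)) μ := by
  refine ((integrable_const (1 : ℝ)).add hg.norm).mono' ?_ (ae_of_all _ fun s => ?_)
  · have h : Continuous fun x : E => √(1 + ‖x‖ ^ 2) := by fun_prop
    exact h.comp_aestronglyMeasurable hg.1
  · rw [Real.norm_of_nonneg (Real.sqrt_nonneg _)]
    exact Real.sqrt_le_iff.2 ⟨by simp; positivity, by
      simp only [Pi.add_apply]; nlinarith [norm_nonneg (g s)]⟩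
lemma integral_sqrt_le [IsFiniteMeasure μ] [Fact (1 ≤ ENNReal.ofReal p)] (hp : 1 < p)
    {z : Lp E (ENNReal.ofReal p) μ} {C : ℝ} (hz : ‖z‖ ≤ C) :
    ∫ s, √(1 + ‖z s‖ ^ 2) ∂μ ≤ 2 * μ.real univ + C ^ p := by
  calc ∫ s, √(1 + ‖z s‖ ^ 2) ∂μ ≤ ∫ s, (2 + ‖z s‖ ^ p) ∂μ := by
        refine integral_mono (integrable_sqrt (integrable_of_lp z))
          ((integrable_const _).add (integrable_norm_rpow hp z)) fun s => ?_
        refine Real.sqrt_le_iff.2 ⟨by positivity, ?_⟩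
        have h0 := norm_nonneg (z s)
        have hp0 : 0 ≤ ‖z s‖ ^ p := by positivity
        rcases le_total ‖z s‖ 1 with h | h
        · nlinarith
        · have : ‖z s‖ ≤ ‖z s‖ ^ p := by
            conv_lhs => rw [← Real.rpow_one ‖z s‖]
            exact Real.rpow_le_rpow_of_exponent_le h hp.le
          nlinarith
    _ = 2 * μ.real univ + ∫ s, ‖z s‖ ^ p ∂μ := by
        rw [integral_add (integrable_const _) (integrable_norm_rpow hp z)]
        simp [mul_comm]
    _ ≤ _ := by gcongr; exact integral_norm_rpow_le hp hz

variable [InnerProductSpace ℝ E]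

/-- Quantitative strict convexity of `x ↦ √(1 + ‖x‖²)`. -/
lemma sq_norm_sub_le_sqrt_midpoint {x y : E} {K : ℝ} (hK : 1 ≤ K) (hx : ‖x‖ ≤ K) (hy : ‖y‖ ≤ K) :
    ‖x - y‖ ^ 2 ≤ 32 * K ^ 3 * (√(1 + ‖x‖ ^ 2) + √(1 + ‖y‖ ^ 2) -
      2 * √(1 + ‖(1 / 2 : ℝ) • x + (1 / 2 : ℝ) • y‖ ^ 2)) := by
  set a := √(1 + ‖x‖ ^ 2) with ha
  set b := √(1 + ‖y‖ ^ 2) with hb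
  set m := √(1 + ‖(1 / 2 : ℝ) • x + (1 / 2 : ℝ) • y‖ ^ 2) with hm
  have ha2 : a ^ 2 = 1 + ‖x‖ ^ 2 := Real.sq_sqrt (by positivity)
  have hb2 : b ^ 2 = 1 + ‖y‖ ^ 2 := Real.sq_sqrt (by positivity)
  have hm2 : m ^ 2 = 1 + ‖(1 / 2 : ℝ) • x + (1 / 2 : ℝ) • y‖ ^ 2 := Real.sq_sqrt (by positivity)
  have hmid : ‖(1 / 2 : ℝ) • x + (1 / 2 : ℝ) • y‖ ^ 2 =
      (‖x‖ ^ 2 + 2 * inner ℝ x y + ‖y‖ ^ 2) / 4 := by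
    rw [← smul_add, norm_smul, mul_pow, norm_add_sq_real]
    norm_num
    ring
  have hsub : ‖x - y‖ ^ 2 = ‖x‖ ^ 2 - 2 * inner ℝ x y + ‖y‖ ^ 2 := norm_sub_sq_real x y
  have hin : |inner ℝ x y| ≤ ‖x‖ * ‖y‖ := abs_real_inner_le_norm x y
  have hin' := abs_le.1 hin
  have hin2 : (inner ℝ x y) ^ 2 ≤ ‖x‖ ^ 2 * ‖y‖ ^ 2 := by
    rw [← mul_pow, ← sq_abs]; gcongr
  have ha0 : 1 ≤ a := Real.one_le_sqrt.2 (by nlinarith [sq_nonneg ‖x‖])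
  have hb0 : 1 ≤ b := Real.one_le_sqrt.2 (by nlinarith [sq_nonneg ‖y‖])
  have hm0 : 0 ≤ m := Real.sqrt_nonneg _
  have haK : a ≤ 2 * K := Real.sqrt_le_iff.2 ⟨by linarith, by nlinarith [norm_nonneg x]⟩
  have hbK : b ≤ 2 * K := Real.sqrt_le_iff.2 ⟨by linarith, by nlinarith [norm_nonneg y]⟩
  set i := inner ℝ x y with hi
  have hab : 1 + i ≤ a * b := by
    refine (abs_le_of_sq_le_sq' ?_ (by positivity)).2
    rw [mul_pow, ha2, hb2]; nlinarith only [two_mul_le_add_sq ‖x‖ ‖y‖, hin'.2, hin2]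
  have hprod : ‖x - y‖ ^ 2 ≤ (a * b - (1 + i)) * (a * b + (1 + i)) := by
    have : (a * b - (1 + i)) * (a * b + (1 + i)) = a ^ 2 * b ^ 2 - (1 + i) ^ 2 := by ring
    rw [this, ha2, hb2, hsub]; linarith only [hin2]
  have habK : a * b ≤ 2 * K * (2 * K) := mul_le_mul haK hbK (by linarith) (by linarith)
  have h1 : ‖x - y‖ ^ 2 ≤ (a * b - (1 + i)) * (8 * K ^ 2) := hprod.trans <|
    mul_le_mul_of_nonneg_left (by linarith only [habK, hab]) (by linarith only [hab])
  have hmab : 2 * m ≤ a + b := by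
    refine (abs_le_of_sq_le_sq' ?_ (by linarith)).2
    rw [mul_pow, hm2, hmid, add_sq, ha2, hb2]; linarith only [hab]
  have h2 : 2 * (a * b - (1 + i)) = (a + b - 2 * m) * (a + b + 2 * m) := by
    have : (a + b - 2 * m) * (a + b + 2 * m) = a ^ 2 + b ^ 2 + 2 * (a * b) - 4 * m ^ 2 := by ring
    rw [this, ha2, hb2, hm2, hmid]; ring
  have h3 : 2 * (a * b - (1 + i)) ≤ (a + b - 2 * m) * (8 * K) := by
    rw [h2]; exact mul_le_mul_of_nonneg_left (by linarith only [hmab, haK, hbK])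
      (by linarith only [hmab])
  calc ‖x - y‖ ^ 2 ≤ (a * b - (1 + i)) * (8 * K ^ 2) := h1
    _ = 2 * (a * b - (1 + i)) * (4 * K ^ 2) := by ring
    _ ≤ (a + b - 2 * m) * (8 * K) * (4 * K ^ 2) := by gcongr
    _ = 32 * K ^ 3 * (a + b - 2 * m) := by ring

/-- The pointwise bound behind the Cauchy property of almost minimizing convex combinations. -/
lemma norm_sub_le_sqrt_midpoint (hp : 1 < p) {K η : ℝ} (hK : 1 ≤ K) (hη : 0 < η) (x y : E) :
    ‖x - y‖ ≤ η + 32 * K ^ 3 / η * (√(1 + ‖x‖ ^ 2) + √(1 + ‖y‖ ^ 2) -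
      2 * √(1 + ‖(1 / 2 : ℝ) • x + (1 / 2 : ℝ) • y‖ ^ 2)) +
      2 * K ^ (1 - p) * (‖x‖ ^ p + ‖y‖ ^ p) := by
  set Δ := √(1 + ‖x‖ ^ 2) + √(1 + ‖y‖ ^ 2) -
      2 * √(1 + ‖(1 / 2 : ℝ) • x + (1 / 2 : ℝ) • y‖ ^ 2) with hΔ
  have hΔ0 : 0 ≤ Δ := by
    have h := sq_norm_sub_le_sqrt_midpoint (x := x) (y := y) (K := max 1 (max ‖x‖ ‖y‖))
      (le_max_left _ _) (by simp) (by simp)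
    have hpos : 0 < 32 * (max 1 (max ‖x‖ ‖y‖)) ^ 3 := by positivity
    exact nonneg_of_mul_nonneg_right ((sq_nonneg _).trans h) hpos
  have hK0 : 0 < K := by linarith
  have hx0 : 0 ≤ ‖x‖ ^ p := by positivity
  have hy0 : 0 ≤ ‖y‖ ^ p := by positivity
  have hKp : 0 < K ^ (1 - p) := by positivity
  have hC : 0 ≤ 32 * K ^ 3 / η * Δ := by positivity
  by_cases h : ‖x‖ ≤ K ∧ ‖y‖ ≤ K
  · have h1 := sq_norm_sub_le_sqrt_midpoint hK h.1 h.2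
    rw [← hΔ] at h1
    have h2 : ‖x - y‖ ≤ η + ‖x - y‖ ^ 2 / η := by
      rcases le_total ‖x - y‖ η with h3 | h3
      · have : 0 ≤ ‖x - y‖ ^ 2 / η := by positivity
        linarith
      · have : ‖x - y‖ ≤ ‖x - y‖ ^ 2 / η := by rw [le_div_iff₀ hη]; nlinarith
        linarith
    have h3 : ‖x - y‖ ^ 2 / η ≤ 32 * K ^ 3 / η * Δ := by
      rw [div_mul_eq_mul_div]; gcongr
    have : 0 ≤ 2 * K ^ (1 - p) * (‖x‖ ^ p + ‖y‖ ^ p) := by positivity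
    linarith
  · have key : ∀ t : ℝ, K ≤ t → t ≤ K ^ (1 - p) * t ^ p := fun t ht => by
      have ht0 : 0 < t := hK0.trans_le ht
      calc t = t ^ (1 - p) * t ^ p := by rw [← Real.rpow_add ht0]; simp
        _ ≤ K ^ (1 - p) * t ^ p := by
          refine mul_le_mul_of_nonneg_right ?_ (by positivity)
          exact Real.rpow_le_rpow_of_nonpos hK0 ht (by linarith)
    have h1 : ‖x - y‖ ≤ ‖x‖ + ‖y‖ := norm_sub_le x y
    have h2 : ‖x‖ + ‖y‖ ≤ 2 * (K ^ (1 - p) * (‖x‖ ^ p + ‖y‖ ^ p)) := by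
      rw [not_and_or, not_le, not_le] at h
      have hmx : K ^ (1 - p) * ‖x‖ ^ p ≤ K ^ (1 - p) * (‖x‖ ^ p + ‖y‖ ^ p) := by gcongr; linarith
      have hmy : K ^ (1 - p) * ‖y‖ ^ p ≤ K ^ (1 - p) * (‖x‖ ^ p + ‖y‖ ^ p) := by gcongr; linarith
      rcases le_total ‖x‖ ‖y‖ with hxy | hxy
      · have := key ‖y‖ (by rcases h with h | h <;> linarith)
        linarith
      · have := key ‖x‖ (by rcases h with h | h <;> linarith)
        linarith
    linarith

/-- `Z` is a strong limit of convex combinations of the tails of the sequence `z`: in `L¹` and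
almost everywhere. This is the substitute for weak convergence in `L^p`. -/
def ConvexLimit (z : ℕ → Lp E (ENNReal.ofReal p) μ)
    (Z : Lp E (ENNReal.ofReal p) μ) : Prop :=
  ∃ y : ℕ → Lp E (ENNReal.ofReal p) μ, (∀ n, y n ∈ convexHull ℝ (z '' Ici n)) ∧
    Tendsto (fun n => ∫ s, ‖y n s - Z s‖ ∂μ) atTop (𝓝 0) ∧
    ∀ᵐ s ∂μ, Tendsto (fun n => y n s) atTop (𝓝 (Z s))

/-- Convex combinations of the tails that almost minimize the strictly convex functional
`∫ √(1 + ‖y‖²)` form a Cauchy sequence in `L¹`. -/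
lemma exists_convexHull_cauchy [IsFiniteMeasure μ] [Fact (1 ≤ ENNReal.ofReal p)] (hp : 1 < p)
    {z : ℕ → Lp E (ENNReal.ofReal p) μ} {C : ℝ} (hz : ∀ n, ‖z n‖ ≤ C) :
    ∃ y : ℕ → Lp E (ENNReal.ofReal p) μ, (∀ n, y n ∈ convexHull ℝ (z '' Ici n)) ∧
      ∀ e > 0, ∃ N, ∀ m ≥ N, ∀ n ≥ N, ∫ s, ‖y m s - y n s‖ ∂μ < e := by
  have hC : 0 ≤ C := (norm_nonneg _).trans (hz 0)
  set H : ℕ → Set (Lp E (ENNReal.ofReal p) μ) := fun n => convexHull ℝ (z '' Ici n) with hH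
  have hHb : ∀ n, ∀ x ∈ H n, ‖x‖ ≤ C := fun n x hx => by
    have : H n ⊆ Metric.closedBall 0 C := convexHull_min
      (by rintro _ ⟨k, -, rfl⟩; simpa using hz k) (convex_closedBall _ _)
    simpa using this hx
  set J : Lp E (ENNReal.ofReal p) μ → ℝ := fun x => ∫ s, √(1 + ‖x s‖ ^ 2) ∂μ with hJ
  have hJ0 : ∀ x, 0 ≤ J x := fun x => integral_nonneg fun s => Real.sqrt_nonneg _
  have hanti : ∀ {m n}, m ≤ n → H n ⊆ H m := fun h =>
    convexHull_mono (image_mono (Ici_subset_Ici.2 h))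
  have hne : ∀ n, (H n).Nonempty := fun n => ⟨z n, subset_convexHull _ _ ⟨n, mem_Ici.2 le_rfl, rfl⟩⟩
  have hbb : ∀ n, BddBelow (J '' H n) := fun n => ⟨0, by rintro _ ⟨x, -, rfl⟩; exact hJ0 x⟩
  set I : ℕ → ℝ := fun n => sInf (J '' H n) with hI
  have hImono : Monotone I := fun m n h =>
    csInf_le_csInf (hbb m) ((hne n).image _) (image_mono (hanti h))
  have hIb : BddAbove (range I) := by
    refine ⟨2 * μ.real univ + C ^ p, ?_⟩
    rintro _ ⟨n, rfl⟩
    exact (csInf_le (hbb n) ⟨z n, subset_convexHull _ _ ⟨n, mem_Ici.2 le_rfl, rfl⟩, rfl⟩).trans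
      (integral_sqrt_le hp (hz n))
  obtain ⟨y, hy⟩ : ∃ y : ℕ → Lp E (ENNReal.ofReal p) μ,
      ∀ n, y n ∈ H n ∧ J (y n) < I n + 1 / ((n : ℝ) + 1) := by
    have : ∀ n, ∃ x, x ∈ H n ∧ J x < I n + 1 / ((n : ℝ) + 1) := fun n => by
      obtain ⟨_, ⟨x, hx, rfl⟩, h⟩ := exists_lt_of_csInf_lt ((hne n).image J)
        (show sInf (J '' H n) < I n + 1 / ((n : ℝ) + 1) by
          have : (0 : ℝ) < 1 / ((n : ℝ) + 1) := by positivity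
          linarith)
      exact ⟨x, hx, h⟩
    exact ⟨fun n => (this n).choose, fun n => (this n).choose_spec⟩
  refine ⟨y, fun n => (hy n).1, ?_⟩
  have hIlim := tendsto_atTop_ciSup hImono hIb
  set Jlim := ⨆ n, I n with hJl
  have hgap : ∀ e > 0, ∃ N, ∀ m ≥ N, ∀ n ≥ N,
      J (y m) + J (y n) - 2 * J ((1 / 2 : ℝ) • y m + (1 / 2 : ℝ) • y n) < e := by
    intro e he
    obtain ⟨N₁, hN₁⟩ := (hIlim.eventually (lt_mem_nhds (show Jlim - e / 4 < Jlim by linarith))).exists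
    obtain ⟨N₂, hN₂⟩ := exists_nat_one_div_lt (show (0 : ℝ) < e / 4 by linarith)
    refine ⟨max N₁ N₂, fun m hm n hn => ?_⟩
    have hle : ∀ k, max N₁ N₂ ≤ k → J (y k) < Jlim + e / 4 := fun k hk => by
      have h1 : (1 : ℝ) / ((k : ℝ) + 1) ≤ 1 / ((N₂ : ℝ) + 1) := by
        gcongr
        exact (le_max_right _ _).trans hk
      have h2 := le_ciSup hIb k
      linarith [(hy k).2]
    have hmem : ∀ k, max N₁ N₂ ≤ k → y k ∈ H N₁ := fun k hk =>
      hanti ((le_max_left _ _).trans hk) (hy k).1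
    have h3 : I N₁ ≤ J ((1 / 2 : ℝ) • y m + (1 / 2 : ℝ) • y n) :=
      csInf_le (hbb _) ⟨_, convex_convexHull ℝ _ (hmem m hm) (hmem n hn) (by norm_num)
        (by norm_num) (by norm_num), rfl⟩
    linarith [hle m hm, hle n hn]
  intro e he
  obtain ⟨K, hK1, hK⟩ : ∃ K : ℝ, 1 ≤ K ∧ 4 * K ^ (1 - p) * C ^ p < e / 3 := by
    have h1 : Tendsto (fun K : ℝ => 4 * K ^ (1 - p) * C ^ p) atTop (𝓝 0) := by
      have := (tendsto_rpow_neg_atTop (show 0 < p - 1 by linarith)).const_mul 4 |>.mul_const (C ^ p)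
      simpa [neg_sub] using this
    obtain ⟨K, hK⟩ := ((h1.eventually (gt_mem_nhds (show 0 < e / 3 by linarith))).and
      (eventually_ge_atTop 1)).exists
    exact ⟨K, hK.2, hK.1⟩
  set V := μ.real univ with hV
  have hV0 : 0 ≤ V := measureReal_nonneg
  set η := e / (3 * (V + 1)) with hη
  have hη0 : 0 < η := by positivity
  have hηV : η * V ≤ e / 3 := by
    rw [hη, div_mul_eq_mul_div, div_le_div_iff₀ (by positivity) (by norm_num)]
    nlinarith
  obtain ⟨N, hN⟩ := hgap (e / 3 * (η / (32 * K ^ 3))) (by positivity)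
  refine ⟨N, fun m hm n hn => ?_⟩
  have hmid : J ((1 / 2 : ℝ) • y m + (1 / 2 : ℝ) • y n) =
      ∫ s, √(1 + ‖(1 / 2 : ℝ) • y m s + (1 / 2 : ℝ) • y n s‖ ^ 2) ∂μ := by
    refine integral_congr_ae ?_
    filter_upwards [Lp.coeFn_add ((1 / 2 : ℝ) • y m) ((1 / 2 : ℝ) • y n),
      Lp.coeFn_smul (1 / 2 : ℝ) (y m), Lp.coeFn_smul (1 / 2 : ℝ) (y n)] with s h1 h2 h3
    rw [h1, Pi.add_apply, h2, h3, Pi.smul_apply, Pi.smul_apply]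
  have im := integrable_of_lp (y m)
  have iN := integrable_of_lp (y n)
  have i1 := integrable_sqrt im
  have i2 := integrable_sqrt iN
  have i3 := integrable_sqrt ((im.smul (1 / 2 : ℝ)).add (iN.smul (1 / 2 : ℝ)))
  simp only [Pi.add_apply, Pi.smul_apply] at i3
  have i4 := integrable_norm_rpow hp (y m)
  have i5 := integrable_norm_rpow hp (y n)
  calc ∫ s, ‖y m s - y n s‖ ∂μ
      ≤ ∫ s, (η + 32 * K ^ 3 / η * (√(1 + ‖y m s‖ ^ 2) + √(1 + ‖y n s‖ ^ 2) -
        2 * √(1 + ‖(1 / 2 : ℝ) • y m s + (1 / 2 : ℝ) • y n s‖ ^ 2)) +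
        2 * K ^ (1 - p) * (‖y m s‖ ^ p + ‖y n s‖ ^ p)) ∂μ := by
        refine integral_mono (im.sub iN).norm ?_ fun s => norm_sub_le_sqrt_midpoint hp hK1 hη0 _ _
        exact ((integrable_const _).add (((i1.add i2).sub (i3.const_mul 2)).const_mul _)).add
          ((i4.add i5).const_mul _)
    _ = η * V + 32 * K ^ 3 / η * (J (y m) + J (y n) -
        2 * J ((1 / 2 : ℝ) • y m + (1 / 2 : ℝ) • y n)) +
        2 * K ^ (1 - p) * (∫ s, ‖y m s‖ ^ p ∂μ + ∫ s, ‖y n s‖ ^ p ∂μ) := by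
        have e0 : Integrable (fun s => √(1 + ‖y m s‖ ^ 2) + √(1 + ‖y n s‖ ^ 2)) μ := i1.add i2
        have e1 : Integrable (fun s => √(1 + ‖y m s‖ ^ 2) + √(1 + ‖y n s‖ ^ 2) -
          2 * √(1 + ‖(1 / 2 : ℝ) • y m s + (1 / 2 : ℝ) • y n s‖ ^ 2)) μ := e0.sub (i3.const_mul 2)
        have e2 : Integrable (fun s => ‖y m s‖ ^ p + ‖y n s‖ ^ p) μ := i4.add i5
        have e3 : Integrable (fun s => η + 32 * K ^ 3 / η *
          (√(1 + ‖y m s‖ ^ 2) + √(1 + ‖y n s‖ ^ 2) -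
          2 * √(1 + ‖(1 / 2 : ℝ) • y m s + (1 / 2 : ℝ) • y n s‖ ^ 2))) μ :=
          (integrable_const _).add (e1.const_mul _)
        rw [integral_add e3 (e2.const_mul _), integral_add (integrable_const _) (e1.const_mul _),
          integral_const_mul, integral_const_mul, integral_sub e0 (i3.const_mul 2),
          integral_add i4 i5, integral_add i1 i2, integral_const_mul, hmid, integral_const,
          smul_eq_mul, mul_comm η]
    _ < e := by
        have h1 := integral_norm_rpow_le hp (hHb _ _ (hy m).1)
        have h2 := integral_norm_rpow_le hp (hHb _ _ (hy n).1)
        have hKp : 0 < K ^ (1 - p) := by positivity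
        have h3 : 2 * K ^ (1 - p) * (∫ s, ‖y m s‖ ^ p ∂μ + ∫ s, ‖y n s‖ ^ p ∂μ) ≤
            4 * K ^ (1 - p) * C ^ p := by nlinarith
        have h4 : 32 * K ^ 3 / η * (J (y m) + J (y n) -
            2 * J ((1 / 2 : ℝ) • y m + (1 / 2 : ℝ) • y n)) <
            32 * K ^ 3 / η * (e / 3 * (η / (32 * K ^ 3))) := by
          gcongr
          exact hN m hm n hn
        have h5 : 32 * K ^ 3 / η * (e / 3 * (η / (32 * K ^ 3))) = e / 3 := by
          have : K ≠ 0 := by linarith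
          field_simp
        linarith

/-- Every bounded sequence of `L^p`, `1 < p < ∞`, has a limit of convex combinations of its tails. -/
theorem exists_convexLimit [CompleteSpace E] [IsFiniteMeasure μ] [Fact (1 ≤ ENNReal.ofReal p)]
    (hp : 1 < p) {z : ℕ → Lp E (ENNReal.ofReal p) μ} {C : ℝ} (hz : ∀ n, ‖z n‖ ≤ C) :
    ∃ Z, ConvexLimit z Z := by
  obtain ⟨y, hy, hcau⟩ := exists_convexHull_cauchy hp hz
  set Y : ℕ → Lp E 1 μ := fun n => (integrable_of_lp (y n)).toL1 _ with hY
  have hYy : ∀ n, Y n =ᵐ[μ] y n := fun n => Integrable.coeFn_toL1 _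
  have hYc : CauchySeq Y := by
    refine Metric.cauchySeq_iff.2 fun e he => ?_
    obtain ⟨N, hN⟩ := hcau e he
    refine ⟨N, fun m hm n hn => ?_⟩
    rw [L1.dist_eq_integral_dist]
    refine lt_of_eq_of_lt (integral_congr_ae ?_) (hN m hm n hn)
    filter_upwards [hYy m, hYy n] with s h1 h2
    rw [h1, h2, dist_eq_norm]
  obtain ⟨W, hW⟩ := cauchySeq_tendsto_of_complete hYc
  obtain ⟨ns, hns, hae⟩ := (tendstoInMeasure_of_tendsto_eLpNorm one_ne_zero
    (fun n => (Lp.memLp (Y n)).1) (Lp.memLp W).1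
    ((Lp.tendsto_Lp_iff_tendsto_eLpNorm' Y W).1 hW)).exists_seq_tendsto_ae
  have hae' : ∀ᵐ s ∂μ, Tendsto (fun n => y (ns n) s) atTop (𝓝 (W s)) := by
    filter_upwards [hae, ae_all_iff.2 hYy] with s h1 h2
    simpa only [h2] using h1
  have hHb : ∀ n, ‖y n‖ ≤ C := fun n => by
    have : convexHull ℝ (z '' Ici n) ⊆ Metric.closedBall 0 C := convexHull_min
      (by rintro _ ⟨k, -, rfl⟩; simpa using hz k) (convex_closedBall _ _)
    simpa using this (hy n)
  have hWp : MemLp W (ENNReal.ofReal p) μ := by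
    refine ⟨(Lp.memLp W).1, ?_⟩
    refine (Lp.eLpNorm_lim_le_liminf_eLpNorm (fun n => (Lp.memLp (y (ns n))).1) W hae').trans_lt ?_
    refine lt_of_le_of_lt (b := ENNReal.ofReal C) ?_ ENNReal.ofReal_lt_top
    refine liminf_le_of_le (by isBoundedDefault) fun b hb => ?_
    obtain ⟨n, hn⟩ := hb.exists
    refine hn.trans ?_
    rw [← Lp.enorm_def, ← ofReal_norm]
    exact ENNReal.ofReal_le_ofReal (hHb _)
  refine ⟨hWp.toLp W, fun n => y (ns n), fun n => ?_, ?_, ?_⟩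
  · exact convexHull_mono (image_mono (Ici_subset_Ici.2 (hns.id_le n))) (hy (ns n))
  · have h1 : Tendsto (fun n => dist (Y (ns n)) W) atTop (𝓝 0) :=
      (tendsto_iff_dist_tendsto_zero.1 hW).comp hns.tendsto_atTop
    refine h1.congr fun n => ?_
    rw [L1.dist_eq_integral_dist]
    refine integral_congr_ae ?_
    filter_upwards [hYy (ns n), hWp.coeFn_toLp] with s h1 h2
    rw [h1, h2, dist_eq_norm]
  · filter_upwards [hae', hWp.coeFn_toLp] with s h1 h2
    rwa [h2]

end convexLimit

namespace ConvexLimit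

section

variable {E : Type*} [NormedAddCommGroup E] [InnerProductSpace ℝ E]
  {α : Type*} [MeasurableSpace α] {μ : Measure α} {p : ℝ}
  {z : ℕ → Lp E (ENNReal.ofReal p) μ} {Z : Lp E (ENNReal.ofReal p) μ}

lemma ae_combo (x y : Lp E (ENNReal.ofReal p) μ) (a b : ℝ) :
    ∀ᵐ s ∂μ, (a • x + b • y : Lp E (ENNReal.ofReal p) μ) s = a • x s + b • y s := by
  filter_upwards [Lp.coeFn_add (a • x) (b • y), Lp.coeFn_smul a x, Lp.coeFn_smul b y]
    with s h1 h2 h3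
  rw [h1, Pi.add_apply, h2, h3, Pi.smul_apply, Pi.smul_apply]

/-- Upper bounds of a continuous affine functional pass to limits of convex combinations. -/
lemma le_of_affine (h : ConvexLimit z Z) {G : Lp E (ENNReal.ofReal p) μ → ℝ} {C c : ℝ}
    (hG : ∀ x y (a b : ℝ), 0 ≤ a → 0 ≤ b → a + b = 1 → G (a • x + b • y) = a * G x + b * G y)
    (hC : ∀ x y, |G x - G y| ≤ C * ∫ s, ‖x s - y s‖ ∂μ)
    (hz : ∀ e > 0, ∀ᶠ n in atTop, G (z n) ≤ c + e) : G Z ≤ c := by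
  obtain ⟨y, hy, hlim, -⟩ := h
  have hconv : Tendsto (fun n => G (y n)) atTop (𝓝 (G Z)) := by
    rw [tendsto_iff_dist_tendsto_zero]
    refine squeeze_zero (fun n => dist_nonneg) (fun n => hC (y n) Z) ?_
    simpa using hlim.const_mul C
  refine le_of_forall_pos_le_add fun e he => ?_
  refine le_of_tendsto hconv ?_
  obtain ⟨N, hN⟩ := eventually_atTop.1 (hz e he)
  filter_upwards [eventually_ge_atTop N] with n hn
  have hconvex : Convex ℝ {x | G x ≤ c + e} := fun x hx y hy a b ha hb hab => by
    rw [mem_ofPred_eq] at hx hy ⊢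
    rw [hG x y a b ha hb hab]
    calc a * G x + b * G y ≤ a * (c + e) + b * (c + e) := by gcongr
      _ = c + e := by rw [← add_mul, hab, one_mul]
  exact convexHull_min (by rintro _ ⟨k, hk, rfl⟩; exact hN k (hn.trans hk)) hconvex (hy n)

lemma eq_of_affine (h : ConvexLimit z Z) {G : Lp E (ENNReal.ofReal p) μ → ℝ} {C c : ℝ}
    (hG : ∀ x y (a b : ℝ), 0 ≤ a → 0 ≤ b → a + b = 1 → G (a • x + b • y) = a * G x + b * G y)
    (hC : ∀ x y, |G x - G y| ≤ C * ∫ s, ‖x s - y s‖ ∂μ)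
    (hz : Tendsto (fun n => G (z n)) atTop (𝓝 c)) : G Z = c := by
  refine le_antisymm (h.le_of_affine hG hC fun e he => ?_) (neg_le_neg_iff.1
    (h.le_of_affine (G := fun x => - G x) (C := C) (fun x y a b ha hb hab => ?_)
      (fun x y => ?_) fun e he => ?_))
  · exact (hz.eventually (gt_mem_nhds (show c < c + e by linarith))).mono fun n hn => hn.le
  · rw [hG x y a b ha hb hab]; ring
  · rw [neg_sub_neg, abs_sub_comm]; exact hC x y
  · exact (hz.eventually (lt_mem_nhds (show c - e < c by linarith))).mono fun n hn => by linarith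

/-- Pointwise convex and closed constraints pass to limits of convex combinations. -/
lemma ae_mem (h : ConvexLimit z Z) {K : α → Set E} (hK : ∀ᵐ s ∂μ, Convex ℝ (K s) ∧ IsClosed (K s))
    (hz : ∀ n, ∀ᵐ s ∂μ, z n s ∈ K s) : ∀ᵐ s ∂μ, Z s ∈ K s := by
  obtain ⟨y, hy, -, hlim⟩ := h
  have hconvex : Convex ℝ {x : Lp E (ENNReal.ofReal p) μ | ∀ᵐ s ∂μ, x s ∈ K s} :=
    fun x hx x' hx' a b ha hb hab => by
      rw [mem_ofPred_eq] at hx hx' ⊢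
      filter_upwards [hx, hx', hK, ae_combo x x' a b] with s h1 h2 h3 h4
      rw [h4]
      exact h3.1 h1 h2 ha hb hab
  have hyK : ∀ n, ∀ᵐ s ∂μ, y n s ∈ K s := fun n =>
    convexHull_min (by rintro _ ⟨k, -, rfl⟩; exact hz k) hconvex (hy n)
  filter_upwards [hK, ae_all_iff.2 hyK, hlim] with s h1 h2 h3
  exact h1.2.mem_of_tendsto h3 (Eventually.of_forall h2)

end

end ConvexLimit

/-! ### Elastic energy -/

namespace Rod

variable {p : ℝ} (B : Rod p)

/-- The energy density along a measurable field of densities is measurable: `f` is a Carathéodory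
integrand. -/
lemma aemeasurable_f {z : ℝ → E3} (hz : StronglyMeasurable z) :
    AEMeasurable (fun s => B.f (z s) s) (volume.restrict (Icc 0 B.ℓ)) := by
  refine aemeasurable_of_tendsto_metrizable_ae atTop (f := fun n s => B.f (hz.approx n s) s)
    (fun n => ?_) ?_
  · have : (fun s => B.f (hz.approx n s) s) = fun s => ∑ a ∈ (hz.approx n).range,
        (hz.approx n ⁻¹' {a}).indicator (B.f a) s := by
      funext s
      rw [Finset.sum_eq_single (hz.approx n s)]
      · simp
      · intro a _ ha
        exact indicator_of_notMem (fun h => ha (by simpa using h.symm)) _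
      · intro h
        exact absurd (SimpleFunc.mem_range_self _ s) h
    rw [this]
    exact Finset.aemeasurable_fun_sum _ fun a _ =>
      (B.f_measurable a).indicator (SimpleFunc.measurableSet_fiber _ _)
  · filter_upwards [ae_restrict_mem measurableSet_Icc] with s hs
    exact ((B.f_continuous s hs).tendsto _).comp (hz.tendsto_approx s)

lemma convex_elasticEnergy_le (c : ℝ≥0∞) :
    Convex ℝ {z : Density p B.ℓ | B.elasticEnergy z ≤ c} := by
  intro x hx y hy a b ha hb hab
  rw [mem_ofPred_eq] at hx hy ⊢
  lift a to ℝ≥0 using ha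
  lift b to ℝ≥0 using hb
  have hab' : a + b = 1 := by exact_mod_cast hab
  calc B.elasticEnergy ((a : ℝ) • x + (b : ℝ) • y)
      ≤ ∫⁻ s in Icc 0 B.ℓ, ((a : ℝ≥0∞) * B.f (x s) s + (b : ℝ≥0∞) * B.f (y s) s) := by
        refine lintegral_mono_ae ?_
        filter_upwards [ConvexLimit.ae_combo x y (a : ℝ) (b : ℝ), ae_restrict_mem measurableSet_Icc]
          with s h1 hs
        rw [h1]
        exact (B.f_convex s hs).2 (mem_univ _) (mem_univ _) a.2 b.2 hab'
    _ = a * B.elasticEnergy x + b * B.elasticEnergy y := by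
        have hx' := B.aemeasurable_f (Lp.stronglyMeasurable x)
        have hy' := B.aemeasurable_f (Lp.stronglyMeasurable y)
        rw [lintegral_add_left' (hx'.const_mul _), lintegral_const_mul'' _ hx',
          lintegral_const_mul'' _ hy']
        rfl
    _ ≤ a * c + b * c := by gcongr
    _ = c := by rw [← add_mul, ← ENNReal.coe_add, hab', ENNReal.coe_one, one_mul]

/-- Lower semicontinuity of the elastic energy: by convexity its bounds pass to convex
combinations, and by Fatou's lemma to their limit. -/
lemma elasticEnergy_le_of_convexLimit {z : ℕ → Density p B.ℓ}
    {Z : Density p B.ℓ} (h : ConvexLimit z Z) {c : ℝ≥0∞}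
    (hz : Tendsto (fun n => B.elasticEnergy (z n)) atTop (𝓝 c)) : B.elasticEnergy Z ≤ c := by
  obtain ⟨y, hy, -, hlim⟩ := h
  refine le_of_forall_gt_imp_ge_of_dense fun c' hc' => ?_
  obtain ⟨N, hN⟩ := eventually_atTop.1 (hz.eventually (gt_mem_nhds hc'))
  have hyc : ∀ n ≥ N, B.elasticEnergy (y n) ≤ c' := fun n hn =>
    convexHull_min (by rintro _ ⟨k, hk, rfl⟩; exact (hN k (hn.trans hk)).le)
      (B.convex_elasticEnergy_le c') (hy n)
  calc B.elasticEnergy Z = ∫⁻ s in Icc 0 B.ℓ, liminf (fun n => B.f (y n s) s) atTop := by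
        refine lintegral_congr_ae ?_
        filter_upwards [hlim, ae_restrict_mem measurableSet_Icc] with s h1 hs
        exact (((B.f_continuous s hs).tendsto _).comp h1).liminf_eq.symm
    _ ≤ liminf (fun n => B.elasticEnergy (y n)) atTop :=
        lintegral_liminf_le' fun n => B.aemeasurable_f (Lp.stronglyMeasurable (y n))
    _ ≤ c' := by
        refine liminf_le_of_le (by isBoundedDefault) fun b hb => ?_
        obtain ⟨n, hn, hn'⟩ := (hb.and (eventually_ge_atTop N)).exists
        exact hn.trans (hyc n hn')

/-- The sublevel sets of the elastic energy are bounded in `L^p`. -/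
lemma exists_norm_le_of_elasticEnergy_le (hp : 1 < p) {c : ℝ≥0∞}
    (hc : c ≠ ⊤) : ∃ C, ∀ z : Density p B.ℓ, B.elasticEnergy z ≤ c → ‖z‖ ≤ C := by
  have hp0 : 0 < p := by linarith
  obtain ⟨C, D, hC, hD, hf⟩ := B.f_coercive
  refine ⟨(c.toReal / C) ^ p⁻¹, fun z hz => ?_⟩
  have h1 : ∫⁻ s in Icc 0 B.ℓ, ‖z s‖ₑ ^ p ≤ c / ENNReal.ofReal C := by
    rw [ENNReal.le_div_iff_mul_le (Or.inl (by simpa using hC)) (Or.inl ENNReal.ofReal_ne_top),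
      mul_comm, ← lintegral_const_mul' _ _ ENNReal.ofReal_ne_top]
    refine le_trans (lintegral_mono_ae ?_) hz
    filter_upwards [ae_restrict_mem measurableSet_Icc] with s hs
    refine le_trans ?_ (hf (z s) s hs)
    rw [← ofReal_norm, ENNReal.ofReal_rpow_of_nonneg (norm_nonneg _) hp0.le,
      ← ENNReal.ofReal_mul hC.le]
    exact ENNReal.ofReal_le_ofReal (by linarith)
  have h2 : eLpNorm z (ENNReal.ofReal p) (volume.restrict (Icc 0 B.ℓ)) ≤
      (c / ENNReal.ofReal C) ^ (1 / p) := by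
    rw [eLpNorm_eq_lintegral_rpow_enorm_toReal (by simpa using hp0) ENNReal.ofReal_ne_top,
      ENNReal.toReal_ofReal hp0.le]
    gcongr
  rw [Lp.norm_def]
  have hfin : c / ENNReal.ofReal C ≠ ⊤ := ENNReal.div_ne_top hc (by simpa using hC)
  refine (ENNReal.toReal_mono (ENNReal.rpow_ne_top_of_nonneg (by positivity) hfin) h2).trans_eq ?_
  rw [← ENNReal.toReal_rpow, ENNReal.toReal_div, ENNReal.toReal_ofReal hC.le, one_div]

/-- The local constraint passes to limits of convex combinations. -/
lemma ae_compression_le_of_convexLimit {z : ℕ → Density p B.ℓ}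
    {Z : Density p B.ℓ} (h : ConvexLimit z Z)
    (hz : ∀ n, ∀ᵐ s ∂(volume.restrict (Icc 0 B.ℓ)), compression B.A (z n s 0) (z n s 1) s ≤ 1) :
    ∀ᵐ s ∂(volume.restrict (Icc 0 B.ℓ)), compression B.A (Z s 0) (Z s 1) s ≤ 1 := by
  refine h.ae_mem (K := fun s => {a | compression B.A (a 0) (a 1) s ≤ 1}) ?_ hz
  filter_upwards [ae_restrict_mem measurableSet_Icc] with s hs
  have : {a : E3 | compression B.A (a 0) (a 1) s ≤ 1} =
      ⋂ ζ ∈ B.A s, {a : E3 | ζ.1 * a 0 + ζ.2 * a 1 ≤ 1} := by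
    ext a; simp [B.compression_le_one_iff hs]
  rw [this]
  refine ⟨convex_iInter₂ fun ζ _ => convex_halfSpace_le ⟨fun a b => ?_, fun c a => ?_⟩ _,
    isClosed_biInter fun ζ _ => isClosed_le (by fun_prop) continuous_const⟩
  · simp; ring
  · simp; ring

/-- The total Jacobian of the rod passes to limits of convex combinations. -/
lemma integral_jacobian_le_of_convexLimit (hp : 1 < p)
    {z : ℕ → Density p B.ℓ} {Z : Density p B.ℓ} (h : ConvexLimit z Z) {c : ℝ}
    (hz : ∀ e > 0, ∀ᶠ n in atTop, ∫ x in B.Ω, jacobian (z n) x ≤ c + e) :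
    ∫ x in B.Ω, jacobian Z x ≤ c := by
  have hint : ∀ x : Density p B.ℓ, IntegrableOn (jacobian x) B.Ω := fun x =>
    B.integrableOn_jacobian (intervalIntegrable_density hp B.ℓ_pos.le x)
  set Q : Set (ℝ × ℝ) := Icc (-B.R) B.R ×ˢ Icc (-B.R) B.R with hQ
  have hQf : volume Q ≠ ⊤ := (isCompact_Icc.prod isCompact_Icc).measure_lt_top.ne
  have : IsFiniteMeasure (volume.restrict Q) := ⟨by
    rw [Measure.restrict_apply_univ]; exact hQf.lt_top⟩
  refine h.le_of_affine (G := fun z => ∫ x in B.Ω, jacobian z x) (C := 2 * B.R * volume.real Q)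
    (fun x y a b ha hb hab => ?_)
    (fun x y => ?_) hz
  · rw [← integral_const_mul, ← integral_const_mul,
      ← integral_add ((hint x).const_mul a) ((hint y).const_mul b)]
    refine setIntegral_congr_ae B.measurableSet_Ω ?_
    have h1 : ∀ᵐ q : ℝ × ℝ × ℝ, q.1 ∈ Icc 0 B.ℓ →
        (a • x + b • y : Density p B.ℓ) q.1 = a • x q.1 + b • y q.1 :=
      (Measure.quasiMeasurePreserving_fst (μ := (volume : Measure ℝ))
        (ν := (volume : Measure (ℝ × ℝ)))).ae
        ((ae_restrict_iff' measurableSet_Icc).1 (ConvexLimit.ae_combo x y a b))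
    filter_upwards [h1] with q hq hqΩ
    rw [jacobian, hq hqΩ.1, jacobian, jacobian]
    simp only [PiLp.add_apply, PiLp.smul_apply, smul_eq_mul]
    linear_combination (-1 : ℝ) * hab
  · have hd : Integrable (fun s => ‖x s - y s‖) (volume.restrict (Icc 0 B.ℓ)) :=
      ((integrable_density hp x).sub (integrable_density hp y)).norm
    have hd2 : IntegrableOn (fun q : ℝ × ℝ × ℝ => ‖x q.1 - y q.1‖) (Icc 0 B.ℓ ×ˢ Q) := by
      rw [IntegrableOn, Measure.volume_eq_prod, ← Measure.prod_restrict]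
      exact hd.comp_fst _
    rw [← integral_sub (hint x) (hint y), ← Real.norm_eq_abs]
    calc ‖∫ q in B.Ω, (jacobian x q - jacobian y q)‖
        ≤ ∫ q in B.Ω, 2 * B.R * ‖x q.1 - y q.1‖ := by
          refine norm_integral_le_of_norm_le ((hd2.mono_set B.Ω_subset).const_mul _) ?_
          filter_upwards [ae_restrict_mem B.measurableSet_Ω] with q hq
          have h0 := abs_coord_le (x q.1 - y q.1) 0
          have h1 := abs_coord_le (x q.1 - y q.1) 1
          have hA := B.A_lt q.1 hq.1 q.2 hq.2
          rw [show jacobian x q - jacobian y q =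
            -(q.2.1 * (x q.1 - y q.1) 0) - q.2.2 * (x q.1 - y q.1) 1 by
              simp only [jacobian, PiLp.sub_apply]; ring]
          refine (norm_sub_le _ _).trans ?_
          rw [norm_neg, norm_mul, norm_mul, Real.norm_eq_abs, Real.norm_eq_abs, Real.norm_eq_abs,
            Real.norm_eq_abs, mul_assoc, two_mul]
          have hR := B.R_pos
          gcongr
          · exact hA.1.le
          · exact hA.2.le
      _ ≤ ∫ q in Icc 0 B.ℓ ×ˢ Q, 2 * B.R * ‖x q.1 - y q.1‖ := by
          refine setIntegral_mono_set (hd2.const_mul _) (ae_of_all _ fun q => ?_)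
            B.Ω_subset.eventuallyLE
          have hR := B.R_pos
          positivity
      _ = 2 * B.R * volume.real Q * ∫ s in Icc 0 B.ℓ, ‖x s - y s‖ := by
          rw [integral_const_mul, Measure.volume_eq_prod]
          have := setIntegral_prod_mul (μ := (volume : Measure ℝ))
            (ν := (volume : Measure (ℝ × ℝ))) (fun s => ‖x s - y s‖) (fun _ => (1 : ℝ))
            (Icc 0 B.ℓ) Q
          simp only [mul_one] at this
          rw [this]
          simp [Measure.real]
          ring

/-- The primitives of the densities pass to limits of convex combinations. -/
lemma integral_coord_eq_of_convexLimit (hp : 1 < p)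
    {z : ℕ → Density p B.ℓ} {Z : Density p B.ℓ} (h : ConvexLimit z Z) {t c : ℝ}
    (ht : t ∈ Icc 0 B.ℓ) (i : Fin 3)
    (hz : Tendsto (fun n => ∫ s in (0 : ℝ)..t, z n s i) atTop (𝓝 c)) :
    ∫ s in (0 : ℝ)..t, Z s i = c := by
  have hint : ∀ x : Density p B.ℓ, IntervalIntegrable (fun s => x s i) volume 0 t := fun x =>
    intervalIntegrable_coord ((intervalIntegrable_density hp B.ℓ_pos.le x).mono_set (by
      rw [uIcc_of_le ht.1, uIcc_of_le B.ℓ_pos.le]; exact Icc_subset_Icc_right ht.2)) i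
  have hsub : Ioc 0 t ⊆ Icc 0 B.ℓ := fun s hs => ⟨hs.1.le, hs.2.trans ht.2⟩
  refine h.eq_of_affine (G := fun z => ∫ s in (0 : ℝ)..t, z s i) (C := 1) (fun x y a b ha hb hab => ?_) (fun x y => ?_) hz
  · rw [← intervalIntegral.integral_const_mul, ← intervalIntegral.integral_const_mul,
      ← intervalIntegral.integral_add ((hint x).const_mul a) ((hint y).const_mul b)]
    refine intervalIntegral.integral_congr_ae ?_
    filter_upwards [(ae_restrict_iff' measurableSet_Icc).1 (ConvexLimit.ae_combo x y a b)] with s hs hst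
    rw [uIoc_of_le ht.1] at hst
    rw [hs (hsub hst)]
    simp
  · have hd : Integrable (fun s => ‖x s - y s‖) (volume.restrict (Icc 0 B.ℓ)) :=
      ((integrable_density hp x).sub (integrable_density hp y)).norm
    rw [← intervalIntegral.integral_sub (hint x) (hint y), one_mul, ← Real.norm_eq_abs]
    rw [intervalIntegral.integral_of_le ht.1]
    refine (norm_integral_le_of_norm_le (IntegrableOn.mono_set hd hsub)
      (ae_of_all _ fun s => ?_)).trans
      (setIntegral_mono_set hd (ae_of_all _ fun s => norm_nonneg _) hsub.eventuallyLE)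
    exact abs_coord_le (x s - y s) i

end Rod

/-! ### Convergence of primitives -/

lemma abs_integral_mul_le {ℓ c : ℝ} (hℓ : 0 ≤ ℓ) {g a : ℝ → ℝ}
    (ha : IntervalIntegrable a volume 0 ℓ) (hg : ∀ t ∈ Icc 0 ℓ, |g t| ≤ c) :
    |∫ t in (0 : ℝ)..ℓ, g t * a t| ≤ c * ∫ t in (0 : ℝ)..ℓ, |a t| := by
  rw [← intervalIntegral.integral_const_mul, ← Real.norm_eq_abs]
  refine intervalIntegral.norm_integral_le_of_norm_le hℓ (Eventually.of_forall fun t ht => ?_)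
    (ha.abs.const_mul c)
  rw [norm_mul, Real.norm_eq_abs, Real.norm_eq_abs]
  exact mul_le_mul_of_nonneg_right (hg t (Ioc_subset_Icc_self ht)) (abs_nonneg _)

/-- Densities that are bounded in `L¹` and whose primitives converge pointwise converge weakly when
tested with uniformly convergent continuous functions: integrate by parts against polynomials. -/
lemma tendsto_integral_mul {ℓ C : ℝ} {A a g : ℕ → ℝ → ℝ} {A₀ a₀ g₀ : ℝ → ℝ}
    (hA : ∀ n, IsPrimitive ℓ (A n) (a n)) (hA₀ : IsPrimitive ℓ A₀ a₀)
    (hC : ∀ n, ∫ t in (0 : ℝ)..ℓ, |a n t| ≤ C)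
    (hlim : ∀ t ∈ Icc 0 ℓ, Tendsto (fun n => A n t) atTop (𝓝 (A₀ t)))
    (hg : ∀ n, ContinuousOn (g n) (Icc 0 ℓ)) (hg₀ : ContinuousOn g₀ (Icc 0 ℓ))
    (hglim : TendstoUniformlyOn g g₀ atTop (Icc 0 ℓ)) :
    Tendsto (fun n => ∫ t in (0 : ℝ)..ℓ, g n t * a n t) atTop
      (𝓝 (∫ t in (0 : ℝ)..ℓ, g₀ t * a₀ t)) := by
  have hℓ := hA₀.nonneg
  have hu : uIcc 0 ℓ = Icc 0 ℓ := uIcc_of_le hℓ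
  have h0 := hA₀.zero_mem
  have hℓm : ℓ ∈ Icc 0 ℓ := ⟨hℓ, le_rfl⟩
  have hC0 : 0 ≤ C := (intervalIntegral.integral_nonneg hℓ fun t _ => abs_nonneg _).trans (hC 0)
  set C₀ := ∫ t in (0 : ℝ)..ℓ, |a₀ t| with hC₀
  have hC₀0 : 0 ≤ C₀ := intervalIntegral.integral_nonneg hℓ fun t _ => abs_nonneg _
  -- the case of a polynomial test function
  have hpoly : ∀ q : Polynomial ℝ, Tendsto (fun n => ∫ t in (0 : ℝ)..ℓ, q.eval t * a n t) atTop
      (𝓝 (∫ t in (0 : ℝ)..ℓ, q.eval t * a₀ t)) := by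
    intro q
    have hq : IsPrimitive ℓ (fun t => q.eval t) (fun t => q.derivative.eval t) := by
      refine ⟨hℓ, (by fun_prop : Continuous fun t => q.derivative.eval t).intervalIntegrable _ _,
        fun s _ => ?_⟩
      rw [intervalIntegral.integral_eq_sub_of_hasDerivAt (fun t _ => q.hasDerivAt t)
        ((by fun_prop : Continuous fun t => q.derivative.eval t).intervalIntegrable _ _)]
      ring
    have parts : ∀ {B b : ℝ → ℝ}, IsPrimitive ℓ B b → ∫ t in (0 : ℝ)..ℓ, q.eval t * b t =
        q.eval ℓ * B ℓ - q.eval 0 * B 0 - ∫ t in (0 : ℝ)..ℓ, q.derivative.eval t * B t :=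
      fun {B b} hB => by
        have h := (hq.mul hB).eq_integral ℓ hℓm
        rw [intervalIntegral.integral_add
          (hq.integrable.mul_continuousOn (hu ▸ hB.continuousOn))
          (hB.integrable.continuousOn_mul (hu ▸ hq.continuousOn))] at h
        linarith
    simp_rw [parts (hA _), parts hA₀]
    refine (((hlim ℓ hℓm).const_mul _).sub ((hlim 0 h0).const_mul _)).sub ?_
    obtain ⟨D, hD⟩ := isCompact_Icc.exists_bound_of_continuousOn (s := Icc 0 ℓ)
      (f := fun t => q.derivative.eval t) (by fun_prop)
    refine intervalIntegral.tendsto_integral_filter_of_dominated_convergence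
      (fun _ => D * (|A₀ 0| + 1 + C)) ?_ ?_ (by simp) ?_
    · refine Eventually.of_forall fun n => ?_
      have hc : ContinuousOn (fun t => q.derivative.eval t * A n t) (Icc 0 ℓ) :=
        ContinuousOn.mul (by fun_prop) (hA n).continuousOn
      rw [uIoc_of_le hℓ]
      exact (hc.mono Ioc_subset_Icc_self).aestronglyMeasurable measurableSet_Ioc
    · filter_upwards [(hlim 0 h0).abs.eventually (gt_mem_nhds (lt_add_one _))] with n hn
      refine Eventually.of_forall fun t ht => ?_
      rw [uIoc_of_le hℓ] at ht
      have ht' := Ioc_subset_Icc_self ht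
      have h1 : |A n t - A n 0| ≤ C := by
        rw [(hA n).sub_eq_integral h0 ht', ← Real.norm_eq_abs]
        refine (intervalIntegral.norm_integral_le_integral_norm ht'.1).trans (le_trans ?_ (hC n))
        exact intervalIntegral.integral_mono_interval le_rfl ht'.1 ht'.2
          (Eventually.of_forall fun _ => norm_nonneg _) (hA n).integrable.abs
      have h2 : |A n t| ≤ |A₀ 0| + 1 + C := by
        have := abs_add_le (A n t - A n 0) (A n 0)
        rw [sub_add_cancel] at this
        linarith
      rw [norm_mul]
      exact mul_le_mul (hD t ht') h2 (norm_nonneg _) ((norm_nonneg _).trans (hD t ht'))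
    · refine Eventually.of_forall fun t ht => ?_
      rw [uIoc_of_le hℓ] at ht
      exact (hlim t (Ioc_subset_Icc_self ht)).const_mul _
  rw [Metric.tendsto_atTop']
  intro e he
  set δ := e / (4 * (C + C₀ + 1)) with hδ
  have hδ0 : 0 < δ := by positivity
  obtain ⟨q, hq⟩ := exists_polynomial_near_of_continuousOn 0 ℓ g₀ hg₀ δ hδ0
  have hqc : ContinuousOn (fun t => q.eval t) (uIcc 0 ℓ) := by fun_prop
  obtain ⟨N, hN⟩ := eventually_atTop.1 (((Metric.tendsto_nhds.1 (hpoly q)) (e / 4)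
    (by linarith)).and (Metric.tendstoUniformlyOn_iff.1 hglim δ hδ0))
  refine ⟨N, fun n hn => ?_⟩
  obtain ⟨h1, h2⟩ := hN n hn.le
  have e1 : ∫ t in (0 : ℝ)..ℓ, g n t * a n t = (∫ t in (0 : ℝ)..ℓ, (g n t - q.eval t) * a n t) +
      ∫ t in (0 : ℝ)..ℓ, q.eval t * a n t := by
    simp_rw [sub_mul]
    rw [intervalIntegral.integral_sub ((hA n).integrable.continuousOn_mul (hu ▸ hg n))
      ((hA n).integrable.continuousOn_mul hqc)]
    ring
  have e2 : ∫ t in (0 : ℝ)..ℓ, g₀ t * a₀ t = (∫ t in (0 : ℝ)..ℓ, (g₀ t - q.eval t) * a₀ t) +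
      ∫ t in (0 : ℝ)..ℓ, q.eval t * a₀ t := by
    simp_rw [sub_mul]
    rw [intervalIntegral.integral_sub (hA₀.integrable.continuousOn_mul (hu ▸ hg₀))
      (hA₀.integrable.continuousOn_mul hqc)]
    ring
  have b1 : |∫ t in (0 : ℝ)..ℓ, (g n t - q.eval t) * a n t| ≤ 2 * δ * C := by
    refine (abs_integral_mul_le hℓ (hA n).integrable fun t ht => ?_).trans
      (mul_le_mul_of_nonneg_left (hC n) (by positivity))
    have h3 := h2 t ht
    rw [dist_comm, Real.dist_eq] at h3
    have h4 := hq t ht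
    rw [abs_sub_comm] at h4
    linarith [abs_sub_le (g n t) (g₀ t) (q.eval t)]
  have b2 : |∫ t in (0 : ℝ)..ℓ, (g₀ t - q.eval t) * a₀ t| ≤ δ * C₀ :=
    abs_integral_mul_le hℓ hA₀.integrable fun t ht => by
      rw [abs_sub_comm]; exact (hq t ht).le
  have b3 : 2 * δ * C + δ * C₀ ≤ e / 2 := by
    rw [hδ]
    have : e / (4 * (C + C₀ + 1)) * (2 * C + C₀) ≤ e / 2 := by
      rw [div_mul_eq_mul_div, div_le_div_iff₀ (by positivity) (by norm_num)]
      nlinarith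
    linarith
  rw [Real.dist_eq] at h1 ⊢
  rw [e1, e2]
  rw [abs_lt] at h1 ⊢
  rw [abs_le] at b1 b2
  constructor <;> linarith [h1.1, h1.2, b1.1, b1.2, b2.1, b2.2]

/-- The theorem of Arzelà and Ascoli, for bounded equicontinuous sequences on an interval. -/
lemma exists_subseq_tendstoUniformlyOn {E : Type*} [NormedAddCommGroup E] [ProperSpace E] {ℓ M : ℝ}
    (hℓ : 0 ≤ ℓ) {x : ℕ → ℝ → E} (hM : ∀ n, ∀ t ∈ Icc 0 ℓ, ‖x n t‖ ≤ M)
    (heq : ∀ e > 0, ∃ δ > 0, ∀ n, ∀ s ∈ Icc 0 ℓ, ∀ t ∈ Icc 0 ℓ, s ≤ t → t - s < δ →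
      ‖x n t - x n s‖ < e) :
    ∃ φ : ℕ → ℕ, StrictMono φ ∧ ∃ y : ℝ → E, ContinuousOn y (Icc 0 ℓ) ∧
      TendstoUniformlyOn (fun n => x (φ n)) y atTop (Icc 0 ℓ) := by
  have heq' : ∀ e > 0, ∃ δ > 0, ∀ n, ∀ s ∈ Icc 0 ℓ, ∀ t ∈ Icc 0 ℓ, dist s t < δ →
      dist (x n s) (x n t) < e := fun e he => by
    obtain ⟨δ, hδ, h⟩ := heq e he
    refine ⟨δ, hδ, fun n s hs t ht hst => ?_⟩
    rw [Real.dist_eq] at hst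
    rcases le_total s t with hle | hle
    · rw [dist_comm, dist_eq_norm]
      exact h n s hs t ht hle (by rw [abs_sub_comm] at hst; exact (le_abs_self _).trans_lt hst)
    · rw [dist_eq_norm]
      exact h n t ht s hs hle ((le_abs_self _).trans_lt hst)
  have hcont : ∀ n, ContinuousOn (x n) (Icc 0 ℓ) := fun n => by
    rw [Metric.continuousOn_iff]
    intro t ht e he
    obtain ⟨δ, hδ, h⟩ := heq' e he
    exact ⟨δ, hδ, fun s hs hst => h n s hs t ht hst⟩
  have hc : ∀ n, Continuous fun t : Icc 0 ℓ => x n t := fun n =>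
    continuousOn_iff_continuous_domRestrict.1 (hcont n)
  set f : ℕ → BoundedContinuousFunction (Icc 0 ℓ) E := fun n =>
    BoundedContinuousFunction.mkOfCompact ⟨_, hc n⟩ with hf
  have hcomp : IsCompact (closure (range f)) := by
    refine BoundedContinuousFunction.arzela_ascoli (Metric.closedBall 0 M)
      (isCompact_closedBall _ _) _ ?_ ?_
    · rintro _ t ⟨n, rfl⟩
      rw [mem_closedBall_zero_iff]
      exact hM n t t.2
    · refine UniformEquicontinuous.equicontinuous ?_
      rw [Metric.uniformEquicontinuous_iff]
      intro e he
      obtain ⟨δ, hδ, h⟩ := heq' e he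
      refine ⟨δ, hδ, ?_⟩
      rintro s t hst ⟨_, n, rfl⟩
      exact h n s s.2 t t.2 hst
  obtain ⟨g, -, φ, hφ, hlim⟩ := hcomp.tendsto_subseq fun n => subset_closure (mem_range_self n)
  refine ⟨φ, hφ, fun t => g (projIcc 0 ℓ hℓ t),
    (g.continuous.comp continuous_projIcc).continuousOn, ?_⟩
  rw [BoundedContinuousFunction.tendsto_iff_tendstoUniformly,
    Metric.tendstoUniformly_iff] at hlim
  rw [Metric.tendstoUniformlyOn_iff]
  intro e he
  filter_upwards [hlim e he] with n hn t ht
  rw [projIcc_of_mem hℓ ht]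
  exact hn ⟨t, ht⟩

lemma IsPrimitive.mono {E : Type*} [NormedAddCommGroup E] [NormedSpace ℝ E] {ℓ s : ℝ}
    {x x' : ℝ → E} (h : IsPrimitive ℓ x x') (hs : s ∈ Icc 0 ℓ) : IsPrimitive s x x' :=
  ⟨hs.1, h.intervalIntegrable h.zero_mem hs, fun t ht => h.eq_integral t ⟨ht.1, ht.2.trans hs.2⟩⟩

lemma isPrimitive_integral {E : Type*} [NormedAddCommGroup E] [NormedSpace ℝ E] {ℓ : ℝ}
    {x' : ℝ → E} (hℓ : 0 ≤ ℓ) (h : IntervalIntegrable x' volume 0 ℓ) :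
    IsPrimitive ℓ (fun s => ∫ t in (0 : ℝ)..s, x' t) x' :=
  ⟨hℓ, h, fun s _ => by simp⟩

lemma _root_.TendstoUniformlyOn.coord {ι α : Type*} {l : Filter ι} {x : ι → α → E3} {y : α → E3}
    {S : Set α} (h : TendstoUniformlyOn x y l S) (i : Fin 3) :
    TendstoUniformlyOn (fun n t => x n t i) (fun t => y t i) l S := by
  rw [Metric.tendstoUniformlyOn_iff] at h ⊢
  intro e he
  filter_upwards [h e he] with n hn t ht
  refine lt_of_le_of_lt ?_ (hn t ht)
  rw [dist_eq_norm, dist_eq_norm]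
  exact abs_coord_le (y t - x n t) i

/-! ### Compactness of bounded sequences of rods -/

section Density

variable {p : ℝ}

/-- Bounded sets of `L^p` are uniformly integrable. -/
lemma integral_norm_density_le (hp : 1 < p) {ℓ : ℝ} {z : Density p ℓ} {C K : ℝ}
    (hz : ‖z‖ ≤ C) (hK : 1 ≤ K) {s t : ℝ} (hs : s ∈ Icc 0 ℓ) (ht : t ∈ Icc 0 ℓ) (hst : s ≤ t) :
    ∫ τ in s..t, ‖z τ‖ ≤ K * (t - s) + K ^ (1 - p) * C ^ p := by
  have : Fact (1 ≤ ENNReal.ofReal p) := ⟨by simpa using hp.le⟩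
  have hsub : Ioc s t ⊆ Icc 0 ℓ := fun τ hτ => ⟨hs.1.trans hτ.1.le, hτ.2.trans ht.2⟩
  have hi : Integrable (fun τ => ‖z τ‖ ^ p) (volume.restrict (Icc 0 ℓ)) := integrable_norm_rpow hp z
  have hK0 : 0 < K := by linarith
  calc ∫ τ in s..t, ‖z τ‖ = ∫ τ in Ioc s t, ‖z τ‖ := intervalIntegral.integral_of_le hst
    _ ≤ ∫ τ in Ioc s t, (K + K ^ (1 - p) * ‖z τ‖ ^ p) := by
        refine integral_mono (IntegrableOn.mono_set (integrable_density hp z).norm hsub)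
          ((integrable_const _).add ((IntegrableOn.mono_set hi hsub).const_mul _)) fun τ => ?_
        have h0 : 0 ≤ K ^ (1 - p) * ‖z τ‖ ^ p := by positivity
        rcases le_total ‖z τ‖ K with h | h
        · exact h.trans (by simpa using h0)
        · have hz0 : 0 < ‖z τ‖ := hK0.trans_le h
          have : ‖z τ‖ ≤ K ^ (1 - p) * ‖z τ‖ ^ p := calc
            ‖z τ‖ = ‖z τ‖ ^ (1 - p) * ‖z τ‖ ^ p := by rw [← Real.rpow_add hz0]; simp
            _ ≤ K ^ (1 - p) * ‖z τ‖ ^ p := mul_le_mul_of_nonneg_right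
              (Real.rpow_le_rpow_of_nonpos hK0 h (by linarith)) (by positivity)
          exact this.trans (by simpa using hK0.le)
    _ = K * (t - s) + K ^ (1 - p) * ∫ τ in Ioc s t, ‖z τ‖ ^ p := by
        rw [integral_add (integrable_const _) ((IntegrableOn.mono_set hi hsub).const_mul _),
          integral_const_mul]
        simp [Measure.real, hst, mul_comm]
    _ ≤ K * (t - s) + K ^ (1 - p) * C ^ p := by
        gcongr
        exact (setIntegral_mono_set hi (ae_of_all _ fun _ => by positivity)
          hsub.eventuallyLE).trans (integral_norm_rpow_le hp hz)

end Density

namespace Rod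

variable {p : ℝ} (B : Rod p)

/-- Uniform convergence of the primitives of the densities, of the midlines and of the directors,
before the limit is known to be a rod. -/
structure TendstoRod (z : ℕ → Density p B.ℓ) (b : ℕ → InitialValue) (Y : ℝ → E3)
    (F : FramedCurve) : Prop where
  prim : TendstoUniformlyOn (fun n s => ∫ t in (0 : ℝ)..s, z n t) Y atTop (Icc 0 B.ℓ)
  r : TendstoUniformlyOn (fun n => (B.frame (z n) (b n)).r) F.r atTop (Icc 0 B.ℓ)
  u : TendstoUniformlyOn (fun n => (B.frame (z n) (b n)).u) F.u atTop (Icc 0 B.ℓ)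
  v : TendstoUniformlyOn (fun n => (B.frame (z n) (b n)).v) F.v atTop (Icc 0 B.ℓ)

lemma TendstoRod.comp {B : Rod p} {z : ℕ → Density p B.ℓ} {b : ℕ → InitialValue} {Y : ℝ → E3}
    {F : FramedCurve} (h : B.TendstoRod z b Y F) {φ : ℕ → ℕ} (hφ : StrictMono φ) :
    B.TendstoRod (fun n => z (φ n)) (fun n => b (φ n)) Y F := by
  constructor <;> intro u hu
  · exact hφ.tendsto_atTop.eventually (h.prim u hu)
  · exact hφ.tendsto_atTop.eventually (h.r u hu)
  · exact hφ.tendsto_atTop.eventually (h.u u hu)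
  · exact hφ.tendsto_atTop.eventually (h.v u hu)

lemma frame_r_zero (hp : 1 < p) (z : Density p B.ℓ) {b : InitialValue} (hb : b.IsOrthonormal) :
    (B.frame z b).r 0 = b.r := (B.frame_solves hp z hb).r_zero B.ℓ_pos.le

lemma frame_u_zero (hp : 1 < p) (z : Density p B.ℓ) {b : InitialValue} (hb : b.IsOrthonormal) :
    (B.frame z b).u 0 = b.u := (B.frame_solves hp z hb).u_zero B.ℓ_pos.le

lemma frame_v_zero (hp : 1 < p) (z : Density p B.ℓ) {b : InitialValue} (hb : b.IsOrthonormal) :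
    (B.frame z b).v 0 = b.v := (B.frame_solves hp z hb).v_zero B.ℓ_pos.le

lemma norm_midline_sub_le (hp : 1 < p) (z : Density p B.ℓ) {b : InitialValue}
    (hb : b.IsOrthonormal) {s t : ℝ} (hs : s ∈ Icc 0 B.ℓ) (ht : t ∈ Icc 0 B.ℓ) (hst : s ≤ t) :
    ‖(B.frame z b).r t - (B.frame z b).r s‖ ≤ t - s := by
  have h := B.isFrame hp z hb
  have := IsFrame.norm_sub_le_of_density h.r_prim (m := fun _ => 1) (by simp)
    (fun τ hτ => (h.norm_w hτ).le) hs ht hst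
  simpa using this

/-- Bounded sequences of rods are precompact. -/
lemma exists_subseq_tendstoRod (hp : 1 < p) {z : ℕ → Density p B.ℓ} {b : ℕ → InitialValue}
    (hb : ∀ n, (b n).IsOrthonormal) {C M : ℝ} (hz : ∀ n, ‖z n‖ ≤ C) (hM : ∀ n, ‖(b n).r‖ ≤ M) :
    ∃ φ : ℕ → ℕ, StrictMono φ ∧ ∃ Y F,
      B.TendstoRod (fun n => z (φ n)) (fun n => b (φ n)) Y F := by
  have hF := fun n => B.isFrame hp (z n) (hb n)
  have hint := fun n => intervalIntegrable_density hp B.ℓ_pos.le (z n)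
  have hZ := fun n => isPrimitive_integral B.ℓ_pos.le (hint n)
  have h0 := B.zero_mem_Icc
  set x : ℕ → ℝ → E3 × E3 × E3 × E3 := fun n s => (∫ t in (0 : ℝ)..s, z n t,
    (B.frame (z n) (b n)).r s, (B.frame (z n) (b n)).u s, (B.frame (z n) (b n)).v s) with hx
  -- all components have the modulus of continuity of the primitives of `1 + 2|z n|`
  have hmod : ∀ n, ∀ s ∈ Icc 0 B.ℓ, ∀ t ∈ Icc 0 B.ℓ, s ≤ t →
      ‖x n t - x n s‖ ≤ (t - s) + 2 * ∫ τ in s..t, ‖z n τ‖ := by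
    intro n s hs ht' ht hst
    have hI : 0 ≤ ∫ τ in s..ht', ‖z n τ‖ :=
      intervalIntegral.integral_nonneg hst fun _ _ => norm_nonneg _
    have e1 := IsFrame.norm_sub_le_of_density (hZ n) (hint n).norm (fun _ _ => le_rfl) hs ht hst
    have e2 := B.norm_midline_sub_le hp (z n) (hb n) hs ht hst
    have e3 := IsFrame.norm_sub_le_of_density (hF n).u_prim ((hint n).norm.const_mul 2)
      (fun τ hτ => (hF n).norm_u_density_le hτ) hs ht hst
    have e4 := IsFrame.norm_sub_le_of_density (hF n).v_prim ((hint n).norm.const_mul 2)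
      (fun τ hτ => (hF n).norm_v_density_le hτ) hs ht hst
    rw [intervalIntegral.integral_const_mul] at e3 e4
    simp only [hx, Prod.norm_def, Prod.fst_sub, Prod.snd_sub]
    refine max_le ?_ (max_le ?_ (max_le ?_ ?_)) <;> linarith
  have hbd : ∀ n, ∀ t ∈ Icc 0 B.ℓ,
      ‖x n t‖ ≤ M + 1 + B.ℓ + 2 * (1 * (B.ℓ - 0) + 1 ^ (1 - p) * C ^ p) := by
    intro n t ht
    have e1 := hmod n 0 h0 t ht ht.1
    have e2 := integral_norm_density_le hp (hz n) le_rfl h0 ht ht.1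
    have hx0 : ‖x n 0‖ ≤ M + 1 := by
      have hM0 : 0 ≤ M := (norm_nonneg _).trans (hM 0)
      have := hM n
      simp only [hx, Prod.norm_def, intervalIntegral.integral_same, norm_zero,
        B.frame_r_zero hp _ (hb n), (hF n).norm_u 0 h0, (hF n).norm_v 0 h0]
      refine max_le ?_ (max_le ?_ (max_le ?_ ?_)) <;> linarith
    have e3 : ‖x n t‖ ≤ ‖x n 0‖ + ‖x n t - x n 0‖ := by
      have := norm_add_le (x n 0) (x n t - x n 0)
      rwa [add_sub_cancel] at this
    have := ht.2
    linarith
  have heq : ∀ e > 0, ∃ δ > 0, ∀ n, ∀ s ∈ Icc 0 B.ℓ, ∀ t ∈ Icc 0 B.ℓ, s ≤ t → t - s < δ →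
      ‖x n t - x n s‖ < e := by
    intro e he
    obtain ⟨K, hK, hK1⟩ : ∃ K : ℝ, K ^ (1 - p) * C ^ p < e / 8 ∧ 1 ≤ K := by
      have h1 : Tendsto (fun K : ℝ => K ^ (1 - p) * C ^ p) atTop (𝓝 0) := by
        have := (tendsto_rpow_neg_atTop (show 0 < p - 1 by linarith)).mul_const (C ^ p)
        simpa [neg_sub] using this
      exact ((h1.eventually (gt_mem_nhds (show 0 < e / 8 by linarith))).and
        (eventually_ge_atTop 1)).exists
    refine ⟨e / (8 * K), by positivity, fun n s hs t ht hst hδ => ?_⟩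
    have e1 := hmod n s hs t ht hst
    have e2 := integral_norm_density_le hp (hz n) hK1 hs ht hst
    rw [lt_div_iff₀ (by positivity)] at hδ
    have : t - s ≤ K * (t - s) := le_mul_of_one_le_left (by linarith) hK1
    linarith
  obtain ⟨φ, hφ, y, -, hy⟩ := exists_subseq_tendstoUniformlyOn B.ℓ_pos.le hbd heq
  have hproj : ∀ {f : E3 × E3 × E3 × E3 → E3}, (∀ a b, ‖f a - f b‖ ≤ ‖a - b‖) →
      TendstoUniformlyOn (fun n t => f (x (φ n) t)) (fun t => f (y t)) atTop (Icc 0 B.ℓ) := by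
    intro f hf
    rw [Metric.tendstoUniformlyOn_iff] at hy ⊢
    intro e he
    filter_upwards [hy e he] with n hn t ht
    rw [dist_eq_norm]
    exact (hf _ _).trans_lt (by rw [← dist_eq_norm]; exact hn t ht)
  refine ⟨φ, hφ, fun t => (y t).1,
    ⟨fun t => (y t).2.1, fun t => (y t).2.2.1, fun t => (y t).2.2.2⟩, ?_, ?_, ?_, ?_⟩
  · exact hproj (f := fun a => a.1) fun a b => norm_fst_le (a - b)
  · exact hproj (f := fun a => a.2.1) fun a b => (norm_fst_le (a - b).2).trans (norm_snd_le _)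
  · exact hproj (f := fun a => a.2.2.1) fun a b =>
      (norm_fst_le (a - b).2.2).trans ((norm_snd_le (a - b).2).trans (norm_snd_le _))
  · exact hproj (f := fun a => a.2.2.2) fun a b =>
      (norm_snd_le (a - b).2.2).trans ((norm_snd_le (a - b).2).trans (norm_snd_le _))

/-- The limit of rods is the rod of the limit densities. -/
lemma TendstoRod.tendstoFrame {B : Rod p} (hp : 1 < p) {z : ℕ → Density p B.ℓ}
    {b : ℕ → InitialValue} {Y : ℝ → E3} {F : FramedCurve} (h : B.TendstoRod z b Y F)
    (hb : ∀ n, (b n).IsOrthonormal) {C : ℝ} (hz : ∀ n, ‖z n‖ ≤ C) {Z : Density p B.ℓ}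
    (hZ : ConvexLimit z Z) :
    InitialValue.IsOrthonormal ⟨F.r 0, F.u 0, F.v 0⟩ ∧
      TendstoFrame (fun n => B.frame (z n) (b n)) atTop (B.frame Z ⟨F.r 0, F.u 0, F.v 0⟩) B.ℓ := by
  have hF := fun n => B.isFrame hp (z n) (hb n)
  have hint := fun n => intervalIntegrable_density hp B.ℓ_pos.le (z n)
  have hintZ := intervalIntegrable_density hp B.ℓ_pos.le Z
  have h0 := B.zero_mem_Icc
  have hnu : ∀ s ∈ Icc 0 B.ℓ, ‖F.u s‖ = 1 := fun s hs =>
    tendsto_nhds_unique (h.u.tendsto_at hs).norm (by simp [(hF _).norm_u s hs])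
  have hnv : ∀ s ∈ Icc 0 B.ℓ, ‖F.v s‖ = 1 := fun s hs =>
    tendsto_nhds_unique (h.v.tendsto_at hs).norm (by simp [(hF _).norm_v s hs])
  have hin : ∀ s ∈ Icc 0 B.ℓ, inner ℝ (F.u s) (F.v s) = 0 := fun s hs =>
    tendsto_nhds_unique ((h.u.tendsto_at hs).inner (h.v.tendsto_at hs))
      (by simp [(hF _).inner_uv s hs])
  have hb' : InitialValue.IsOrthonormal ⟨F.r 0, F.u 0, F.v 0⟩ := ⟨hnu 0 h0, hnv 0 h0, hin 0 h0⟩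
  refine ⟨hb', ?_⟩
  have cr : ContinuousOn F.r (Icc 0 B.ℓ) :=
    h.r.continuousOn (Frequently.of_forall fun n => (hF n).r_prim.continuousOn)
  have cu : ContinuousOn F.u (Icc 0 B.ℓ) :=
    h.u.continuousOn (Frequently.of_forall fun n => (hF n).u_prim.continuousOn)
  have cv : ContinuousOn F.v (Icc 0 B.ℓ) :=
    h.v.continuousOn (Frequently.of_forall fun n => (hF n).v_prim.continuousOn)
  have cw : ContinuousOn F.w (Icc 0 B.ℓ) := cu.cross cv
  have hw : TendstoUniformlyOn (fun n => (B.frame (z n) (b n)).w) F.w atTop (Icc 0 B.ℓ) := by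
    rw [Metric.tendstoUniformlyOn_iff]
    intro e he
    filter_upwards [Metric.tendstoUniformlyOn_iff.1 h.u (e / 2) (by linarith),
      Metric.tendstoUniformlyOn_iff.1 h.v (e / 2) (by linarith)] with n h1 h2 s hs
    have h1' := h1 s hs
    have h2' := h2 s hs
    rw [dist_eq_norm] at h1' h2' ⊢
    rw [FramedCurve.w, FramedCurve.w, cross_sub_cross]
    have e1 := norm_cross_le (F.u s - (B.frame (z n) (b n)).u s) (F.v s)
    have e2 := norm_cross_le ((B.frame (z n) (b n)).u s) (F.v s - (B.frame (z n) (b n)).v s)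
    rw [hnv s hs, mul_one] at e1
    rw [(hF n).norm_u s hs, one_mul] at e2
    exact (norm_add_le _ _).trans_lt (by linarith)
  -- the primitives of the limit densities are the limits of the primitives
  have hprim : ∀ i, ∀ t ∈ Icc 0 B.ℓ, Tendsto (fun n => ∫ s in (0 : ℝ)..t, z n s i) atTop
      (𝓝 (∫ s in (0 : ℝ)..t, Z s i)) := by
    intro i t ht
    have hco : ∀ x : Density p B.ℓ, (∫ s in (0 : ℝ)..t, x s) i = ∫ s in (0 : ℝ)..t, x s i := by
      intro x
      have := ((isPrimitive_integral B.ℓ_pos.le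
        (intervalIntegrable_density hp B.ℓ_pos.le x)).coord i).eq_integral t ht
      simpa using this
    have h1 : Tendsto (fun n => ∫ s in (0 : ℝ)..t, z n s i) atTop (𝓝 (Y t i)) := by
      simpa only [hco] using (h.prim.coord i).tendsto_at ht
    rwa [B.integral_coord_eq_of_convexLimit hp hZ ht i h1]
  have hbound : ∀ n (i : Fin 3), ∀ s ∈ Icc 0 B.ℓ,
      ∫ t in (0 : ℝ)..s, |z n t i| ≤ 1 * (B.ℓ - 0) + 1 ^ (1 - p) * C ^ p := fun n i s hs => by
    refine le_trans ?_ (integral_norm_density_le hp (hz n) le_rfl h0 B.ℓ_mem_Icc B.ℓ_pos.le)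
    refine (intervalIntegral.integral_mono_interval le_rfl hs.1 hs.2
      (Eventually.of_forall fun _ => abs_nonneg _) (intervalIntegrable_coord (hint n) i).abs).trans ?_
    exact intervalIntegral.integral_mono_on B.ℓ_pos.le (intervalIntegrable_coord (hint n) i).abs
      (hint n).norm fun t _ => abs_coord_le _ _
  have key : ∀ {g : ℕ → ℝ → E3} {g₀ : ℝ → E3}, (∀ n, ContinuousOn (g n) (Icc 0 B.ℓ)) →
      ContinuousOn g₀ (Icc 0 B.ℓ) → TendstoUniformlyOn g g₀ atTop (Icc 0 B.ℓ) →
      ∀ (i j : Fin 3), ∀ s ∈ Icc 0 B.ℓ, Tendsto (fun n => ∫ t in (0 : ℝ)..s, g n t j * z n t i) atTop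
        (𝓝 (∫ t in (0 : ℝ)..s, g₀ t j * Z t i)) := by
    intro g g₀ hg hg₀ hlim i j s hs
    have hsub : Icc 0 s ⊆ Icc 0 B.ℓ := Icc_subset_Icc_right hs.2
    refine tendsto_integral_mul
      (fun n => (isPrimitive_integral B.ℓ_pos.le (intervalIntegrable_coord (hint n) i)).mono hs)
      ((isPrimitive_integral B.ℓ_pos.le (intervalIntegrable_coord hintZ i)).mono hs)
      (fun n => hbound n i s hs) (fun t ht => hprim i t (hsub ht)) (fun n => ?_) ?_
      ((hlim.coord j).mono hsub)
    · exact ((EuclideanSpace.proj j : E3 →L[ℝ] ℝ).continuous.comp_continuousOn (hg n)).mono hsub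
    · exact ((EuclideanSpace.proj j : E3 →L[ℝ] ℝ).continuous.comp_continuousOn hg₀).mono hsub
  have hcw := fun n => (hF n).w_prim.continuousOn
  have hcu := fun n => (hF n).u_prim.continuousOn
  have hcv := fun n => (hF n).v_prim.continuousOn
  have kw := key hcw cw hw
  have ku := key hcu cu h.u
  have kv := key hcv cv h.v
  have hu := uIcc_of_le B.ℓ_pos.le
  have hmul : ∀ {g : ℝ → E3} {x : Density p B.ℓ}, ContinuousOn g (Icc 0 B.ℓ) → ∀ (i j : Fin 3),
      ∀ s ∈ Icc 0 B.ℓ, IntervalIntegrable (fun t => g t j * x t i) volume 0 s :=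
    fun {g x} hg i j s hs => ((intervalIntegrable_coord
      (intervalIntegrable_density hp B.ℓ_pos.le x) i).continuousOn_mul
      (hu ▸ (EuclideanSpace.proj j : E3 →L[ℝ] ℝ).continuous.comp_continuousOn hg)).mono_set (by
        rw [hu, uIcc_of_le hs.1]; exact Icc_subset_Icc_right hs.2)
  have hr' : IsPrimitive B.ℓ F.r F.w := by
    refine ⟨B.ℓ_pos.le, (hu ▸ cw : ContinuousOn F.w (uIcc 0 B.ℓ)).intervalIntegrable, fun s hs => ?_⟩
    refine tendsto_nhds_unique (h.r.tendsto_at hs) ?_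
    simp_rw [(hF _).r_prim.eq_integral s hs]
    refine (h.r.tendsto_at h0).add ?_
    refine intervalIntegral.tendsto_integral_filter_of_dominated_convergence (fun _ => 1) ?_ ?_
      (by simp) ?_
    · refine Eventually.of_forall fun n => ?_
      rw [uIoc_of_le hs.1]
      exact ((hcw n).mono fun t ht => ⟨ht.1.le, ht.2.trans hs.2⟩).aestronglyMeasurable
        measurableSet_Ioc
    · refine Eventually.of_forall fun n => Eventually.of_forall fun t ht => ?_
      rw [uIoc_of_le hs.1] at ht
      exact ((hF n).norm_w ⟨ht.1.le, ht.2.trans hs.2⟩).le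
    · refine Eventually.of_forall fun t ht => ?_
      rw [uIoc_of_le hs.1] at ht
      exact hw.tendsto_at ⟨ht.1.le, ht.2.trans hs.2⟩
  have hu' : IsPrimitive B.ℓ F.u (fun t => -(Z t 0) • F.w t - Z t 2 • F.v t) := by
    have hi : ∀ (x : Density p B.ℓ) {w v : ℝ → E3}, ContinuousOn w (Icc 0 B.ℓ) →
        ContinuousOn v (Icc 0 B.ℓ) → ∀ j, ∀ s ∈ Icc 0 B.ℓ,
        IntervalIntegrable (fun t => (-(x t 0) • w t - x t 2 • v t) j) volume 0 s ∧
        ∫ t in (0 : ℝ)..s, (-(x t 0) • w t - x t 2 • v t) j =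
        -(∫ t in (0 : ℝ)..s, w t j * x t 0) - ∫ t in (0 : ℝ)..s, v t j * x t 2 := by
      intro x w v hw hv j s hs
      have e : (fun t => (-(x t 0) • w t - x t 2 • v t) j) =
          fun t => -(w t j * x t 0) - v t j * x t 2 := by
        funext t; simp only [PiLp.sub_apply, PiLp.smul_apply, smul_eq_mul]; ring
      have hn : IntervalIntegrable (fun t => -(w t j * x t 0)) volume 0 s := (hmul hw 0 j s hs).neg
      rw [e, intervalIntegral.integral_sub hn (hmul hv 2 j s hs), intervalIntegral.integral_neg]
      exact ⟨hn.sub (hmul hv 2 j s hs), rfl⟩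
    refine IsPrimitive.of_coord fun j => ⟨B.ℓ_pos.le, (hi Z cw cv j _ B.ℓ_mem_Icc).1, fun s hs => ?_⟩
    refine tendsto_nhds_unique ((h.u.coord j).tendsto_at hs) ?_
    rw [(hi Z cw cv j s hs).2]
    refine Tendsto.congr (fun n => ?_)
      (((h.u.coord j).tendsto_at h0).add ((kw 0 j s hs).neg.sub (kv 2 j s hs)))
    rw [((hF n).u_prim.coord j).eq_integral s hs, (hi (z n) (hcw n) (hcv n) j s hs).2]
  have hv' : IsPrimitive B.ℓ F.v (fun t => Z t 2 • F.u t - Z t 1 • F.w t) := by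
    have hi : ∀ (x : Density p B.ℓ) {u w : ℝ → E3}, ContinuousOn u (Icc 0 B.ℓ) →
        ContinuousOn w (Icc 0 B.ℓ) → ∀ j, ∀ s ∈ Icc 0 B.ℓ,
        IntervalIntegrable (fun t => (x t 2 • u t - x t 1 • w t) j) volume 0 s ∧
        ∫ t in (0 : ℝ)..s, (x t 2 • u t - x t 1 • w t) j =
        (∫ t in (0 : ℝ)..s, u t j * x t 2) - ∫ t in (0 : ℝ)..s, w t j * x t 1 := by
      intro x u w hu hw j s hs
      have e : (fun t => (x t 2 • u t - x t 1 • w t) j) =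
          fun t => u t j * x t 2 - w t j * x t 1 := by
        funext t; simp only [PiLp.sub_apply, PiLp.smul_apply, smul_eq_mul]; ring
      rw [e, intervalIntegral.integral_sub (hmul hu 2 j s hs) (hmul hw 1 j s hs)]
      exact ⟨(hmul hu 2 j s hs).sub (hmul hw 1 j s hs), rfl⟩
    refine IsPrimitive.of_coord fun j => ⟨B.ℓ_pos.le, (hi Z cu cw j _ B.ℓ_mem_Icc).1, fun s hs => ?_⟩
    refine tendsto_nhds_unique ((h.v.coord j).tendsto_at hs) ?_
    rw [(hi Z cu cw j s hs).2]
    refine Tendsto.congr (fun n => ?_)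
      (((h.v.coord j).tendsto_at h0).add ((ku 2 j s hs).sub (kw 1 j s hs)))
    rw [((hF n).v_prim.coord j).eq_integral s hs, (hi (z n) (hcu n) (hcw n) j s hs).2]
  have hsol : F.Solves B.ℓ Z ⟨F.r 0, F.u 0, F.v 0⟩ := ⟨cr, cu, cv, fun s hs =>
    ⟨hr'.eq_integral s hs, hu'.eq_integral s hs, hv'.eq_integral s hs⟩⟩
  have huniq := hsol.unique (B.frame_solves hp Z hb') B.ℓ_pos.le hintZ
  exact ⟨h.r.congr_right fun s hs => (huniq s hs).1, h.u.congr_right fun s hs => (huniq s hs).2.1,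
    h.v.congr_right fun s hs => (huniq s hs).2.2, hw.congr_right fun s hs => by
      simp only [FramedCurve.w, (huniq s hs).2.1, (huniq s hs).2.2]⟩

end Rod

/-! ### Continuity of the Gauss integral -/

lemma _root_.TendstoUniformlyOn.comp_continuousAt {α β γ ι : Type*} [UniformSpace β]
    [UniformSpace γ] {l : Filter ι} {f : β → γ} {K : Set β} (hK : IsCompact K)
    (hf : ∀ x ∈ K, ContinuousAt f x) {g : ι → α → β} {g₀ : α → β} {S : Set α}
    (hg : TendstoUniformlyOn g g₀ l S) (hgK : ∀ t ∈ S, g₀ t ∈ K) :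
    TendstoUniformlyOn (fun n t => f (g n t)) (fun t => f (g₀ t)) l S := by
  intro r hr
  filter_upwards [hg _ (hK.uniformContinuousAt_of_continuousAt f hf hr)] with n hn t ht
  exact hn t ht (hgK t ht)

/-- The kernel `x × w / |x|³` of the Gauss integral. -/
noncomputable def gaussKernel (x w : E3) : E3 := (‖x‖ ^ 3)⁻¹ • cross x w

lemma gaussKernel_inner (x w a : E3) :
    inner ℝ x (cross w a) / ‖x‖ ^ 3 =
      gaussKernel x w 0 * a 0 + gaussKernel x w 1 * a 1 + gaussKernel x w 2 * a 2 := by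
  rw [inner_eq_coord, gaussKernel]
  simp only [PiLp.smul_apply, smul_eq_mul, cross_zero, cross_one, cross_two]
  ring

lemma continuousAt_gaussKernel {q : E3 × E3} (hq : q.1 ≠ 0) :
    ContinuousAt (fun q : E3 × E3 => gaussKernel q.1 q.2) q := by
  have h : ContinuousAt (fun q : E3 × E3 => (‖q.1‖ ^ 3)⁻¹) q :=
    ContinuousAt.inv₀ (by fun_prop) (by simpa using hq)
  exact h.smul continuous_cross.continuousAt

lemma continuousOn_gaussKernel_comp {ℓ : ℝ} {c : ℝ → E3} (hc : ContinuousOn c (Icc 0 ℓ)) (x w : E3)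
    (hx : ∀ t ∈ Icc 0 ℓ, x ≠ c t) :
    ContinuousOn (fun t => gaussKernel (x - c t) w) (Icc 0 ℓ) := fun t ht => by
  have h : ContinuousWithinAt (fun t => (x - c t, w)) (Icc 0 ℓ) t :=
    (continuousWithinAt_const.sub (hc t ht)).prodMk continuousWithinAt_const
  exact ContinuousAt.comp_continuousWithinAt (g := fun q : E3 × E3 => gaussKernel q.1 q.2)
    (f := fun t => (x - c t, w)) (continuousAt_gaussKernel (sub_ne_zero.2 (hx t ht))) h

lemma intervalIntegrable_gaussKernel_mul {ℓ : ℝ} {c a : ℝ → E3} (hc : IsPrimitive ℓ c a) {x : E3}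
    (w : E3) (hx : ∀ t ∈ Icc 0 ℓ, x ≠ c t) (i : Fin 3) :
    IntervalIntegrable (fun t => gaussKernel (x - c t) w i * a t i) volume 0 ℓ := by
  refine (intervalIntegrable_coord hc.integrable i).continuousOn_mul ?_
  rw [uIcc_of_le hc.nonneg]
  exact (EuclideanSpace.proj i : E3 →L[ℝ] ℝ).continuous.comp_continuousOn
    (continuousOn_gaussKernel_comp hc.continuousOn x w hx)

lemma integral_gauss_eq {ℓ : ℝ} {c a : ℝ → E3} (hc : IsPrimitive ℓ c a) {x : E3}
    (w : E3) (hx : ∀ t ∈ Icc 0 ℓ, x ≠ c t) :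
    ∫ t in (0 : ℝ)..ℓ, inner ℝ (x - c t) (cross w (a t)) / ‖x - c t‖ ^ 3 =
      (∫ t in (0 : ℝ)..ℓ, gaussKernel (x - c t) w 0 * a t 0) +
      (∫ t in (0 : ℝ)..ℓ, gaussKernel (x - c t) w 1 * a t 1) +
      ∫ t in (0 : ℝ)..ℓ, gaussKernel (x - c t) w 2 * a t 2 := by
  have h := intervalIntegrable_gaussKernel_mul hc w hx
  simp_rw [gaussKernel_inner]
  rw [intervalIntegral.integral_add ((h 0).add (h 1)) (h 2),
    intervalIntegral.integral_add (h 0) (h 1)]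

/-- The inner integral of the Gauss formula is continuous in all data; the derivative of the curve
only has to be bounded in `L¹`. -/
lemma tendsto_integral_gauss {ℓ C : ℝ} {c a : ℕ → ℝ → E3} {c₀ a₀ : ℝ → E3} {x w : ℕ → E3}
    {x₀ w₀ : E3} (hc : ∀ n, IsPrimitive ℓ (c n) (a n)) (hc₀ : IsPrimitive ℓ c₀ a₀)
    (hC : ∀ n, ∫ t in (0 : ℝ)..ℓ, ‖a n t‖ ≤ C) (hlim : TendstoUniformlyOn c c₀ atTop (Icc 0 ℓ))
    (hx : Tendsto x atTop (𝓝 x₀)) (hw : Tendsto w atTop (𝓝 w₀))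
    (hne : ∀ n, ∀ t ∈ Icc 0 ℓ, x n ≠ c n t) (hne₀ : ∀ t ∈ Icc 0 ℓ, x₀ ≠ c₀ t) :
    Tendsto (fun n => ∫ t in (0 : ℝ)..ℓ, inner ℝ (x n - c n t) (cross (w n) (a n t)) /
      ‖x n - c n t‖ ^ 3) atTop
      (𝓝 (∫ t in (0 : ℝ)..ℓ, inner ℝ (x₀ - c₀ t) (cross w₀ (a₀ t)) / ‖x₀ - c₀ t‖ ^ 3)) := by
  have hunif : TendstoUniformlyOn (fun n t => (x n - c n t, w n)) (fun t => (x₀ - c₀ t, w₀)) atTop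
      (Icc 0 ℓ) := by
    rw [Metric.tendstoUniformlyOn_iff] at hlim ⊢
    intro e he
    filter_upwards [hlim (e / 2) (by linarith), Metric.tendsto_nhds.1 hx (e / 2) (by linarith),
      Metric.tendsto_nhds.1 hw e he] with n h1 h2 h3 t ht
    rw [Prod.dist_eq]
    refine max_lt ?_ (by rwa [dist_comm])
    refine (dist_sub_sub_le_of_le le_rfl le_rfl).trans_lt ?_
    rw [dist_comm x₀]
    linarith [h1 t ht]
  have hker : TendstoUniformlyOn (fun n t => gaussKernel (x n - c n t) (w n))
      (fun t => gaussKernel (x₀ - c₀ t) w₀) atTop (Icc 0 ℓ) := by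
    have hK : IsCompact ((fun t => (x₀ - c₀ t, w₀)) '' Icc 0 ℓ) :=
      isCompact_Icc.image_of_continuousOn
        ((continuousOn_const.sub hc₀.continuousOn).prodMk continuousOn_const)
    have hcK : ∀ q ∈ (fun t => (x₀ - c₀ t, w₀)) '' Icc 0 ℓ,
        ContinuousAt (fun q : E3 × E3 => gaussKernel q.1 q.2) q := by
      rintro _ ⟨t, ht, rfl⟩
      exact continuousAt_gaussKernel (sub_ne_zero.2 (hne₀ t ht))
    have h := TendstoUniformlyOn.comp_continuousAt hK hcK hunif fun t ht => mem_image_of_mem _ ht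
    exact h
  have hi : ∀ i, Tendsto (fun n => ∫ t in (0 : ℝ)..ℓ, gaussKernel (x n - c n t) (w n) i * a n t i)
      atTop (𝓝 (∫ t in (0 : ℝ)..ℓ, gaussKernel (x₀ - c₀ t) w₀ i * a₀ t i)) := by
    intro i
    refine tendsto_integral_mul (fun n => (hc n).coord i) (hc₀.coord i) (C := C) (fun n => ?_)
      (fun t ht => (hlim.coord i).tendsto_at ht) (fun n => ?_) ?_ (hker.coord i)
    · exact (intervalIntegral.integral_mono_on hc₀.nonneg
        (intervalIntegrable_coord (hc n).integrable i).abs (hc n).integrable.norm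
        fun t _ => abs_coord_le _ _).trans (hC n)
    · exact (EuclideanSpace.proj i : E3 →L[ℝ] ℝ).continuous.comp_continuousOn
        (continuousOn_gaussKernel_comp (hc n).continuousOn _ _ (hne n))
    · exact (EuclideanSpace.proj i : E3 →L[ℝ] ℝ).continuous.comp_continuousOn
        (continuousOn_gaussKernel_comp hc₀.continuousOn _ _ hne₀)
  rw [integral_gauss_eq hc₀ w₀ hne₀]
  simp_rw [fun n => integral_gauss_eq (hc n) (w n) (hne n)]
  exact ((hi 0).add (hi 1)).add (hi 2)

/-- The Gauss integral, with the derivatives replaced by the densities of the curves. -/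
lemma gaussIntegral_eq {ℓ₁ ℓ₂ : ℝ} {c w c' a : ℝ → E3} (hc : IsPrimitive ℓ₁ c w)
    (hw : ContinuousOn w (Icc 0 ℓ₁)) (hc' : IsPrimitive ℓ₂ c' a) :
    gaussIntegral ℓ₁ ℓ₂ c c' = 1 / (4 * Real.pi) * ∫ s in (0 : ℝ)..ℓ₁, ∫ t in (0 : ℝ)..ℓ₂,
      inner ℝ (c s - c' t) (cross (w s) (a t)) / ‖c s - c' t‖ ^ 3 := by
  rw [gaussIntegral]
  congr 1
  have hae : ∀ {ℓ : ℝ} {P : ℝ → Prop}, (∀ᵐ t, t ∈ Ioo 0 ℓ → P t) → ∀ᵐ t, t ∈ Ioc 0 ℓ → P t := by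
    intro ℓ P h
    have h0 : ∀ᵐ t : ℝ, t ≠ ℓ := by simp [ae_iff]
    filter_upwards [h, h0] with t ht hne hts
    exact ht ⟨hts.1, lt_of_le_of_ne hts.2 hne⟩
  refine intervalIntegral.integral_congr_ae ?_
  rw [uIoc_of_le hc.nonneg]
  refine hae (Eventually.of_forall fun s hs => ?_)
  refine intervalIntegral.integral_congr_ae ?_
  rw [uIoc_of_le hc'.nonneg]
  refine hae ?_
  filter_upwards [hc'.ae_hasDerivAt] with t ht hts
  rw [(ht hts).deriv, (hc.hasDerivAt_of_continuousOn hw hs).deriv]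

/-- A bound for the inner integral of the Gauss formula. -/
lemma abs_integral_gauss_le {ℓ d : ℝ} {c a : ℝ → E3} (hc : IsPrimitive ℓ c a) {x : E3} (w : E3)
    (hd : 0 < d) (hx : ∀ t ∈ Icc 0 ℓ, d ≤ ‖x - c t‖) :
    |∫ t in (0 : ℝ)..ℓ, inner ℝ (x - c t) (cross w (a t)) / ‖x - c t‖ ^ 3| ≤
      ‖w‖ / d ^ 2 * ∫ t in (0 : ℝ)..ℓ, ‖a t‖ := by
  rw [← intervalIntegral.integral_const_mul, ← Real.norm_eq_abs]
  refine intervalIntegral.norm_integral_le_of_norm_le hc.nonneg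
    (Eventually.of_forall fun t ht => ?_) (hc.integrable.norm.const_mul _)
  have hxt := hx t (Ioc_subset_Icc_self ht)
  have hx0 : 0 < ‖x - c t‖ := hd.trans_le hxt
  rw [norm_div, norm_pow, norm_norm]
  calc ‖inner ℝ (x - c t) (cross w (a t))‖ / ‖x - c t‖ ^ 3
      ≤ ‖x - c t‖ * (‖w‖ * ‖a t‖) / ‖x - c t‖ ^ 3 := by
        gcongr
        exact (norm_inner_le_norm _ _).trans (by gcongr; exact norm_cross_le _ _)
    _ = ‖w‖ / ‖x - c t‖ ^ 2 * ‖a t‖ := by field_simp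
    _ ≤ ‖w‖ / d ^ 2 * ‖a t‖ := by gcongr

/-- Continuity of the Gauss integral under `C¹` convergence of the first curve, and uniform
convergence with bounded lengths of the second one. -/
theorem tendsto_gaussIntegral {ℓ₁ ℓ₂ C : ℝ} {c w c' a : ℕ → ℝ → E3} {c₀ w₀ c'₀ a₀ : ℝ → E3}
    (hc : ∀ n, IsPrimitive ℓ₁ (c n) (w n)) (hc₀ : IsPrimitive ℓ₁ c₀ w₀)
    (hw : ∀ n, ContinuousOn (w n) (Icc 0 ℓ₁)) (hw₀ : ContinuousOn w₀ (Icc 0 ℓ₁))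
    (hc' : ∀ n, IsPrimitive ℓ₂ (c' n) (a n)) (hc'₀ : IsPrimitive ℓ₂ c'₀ a₀)
    (hC : ∀ n, ∫ t in (0 : ℝ)..ℓ₂, ‖a n t‖ ≤ C)
    (hclim : TendstoUniformlyOn c c₀ atTop (Icc 0 ℓ₁))
    (hwlim : TendstoUniformlyOn w w₀ atTop (Icc 0 ℓ₁))
    (hc'lim : TendstoUniformlyOn c' c'₀ atTop (Icc 0 ℓ₂))
    (hne : ∀ n, Disjoint (c n '' Icc 0 ℓ₁) (c' n '' Icc 0 ℓ₂))
    (hne₀ : Disjoint (c₀ '' Icc 0 ℓ₁) (c'₀ '' Icc 0 ℓ₂)) :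
    Tendsto (fun n => gaussIntegral ℓ₁ ℓ₂ (c n) (c' n)) atTop (𝓝 (gaussIntegral ℓ₁ ℓ₂ c₀ c'₀)) := by
  simp_rw [fun n => gaussIntegral_eq (hc n) (hw n) (hc' n), gaussIntegral_eq hc₀ hw₀ hc'₀]
  refine Tendsto.const_mul _ ?_
  have hdisj : ∀ {x y : ℝ → E3}, Disjoint (x '' Icc 0 ℓ₁) (y '' Icc 0 ℓ₂) →
      ∀ s ∈ Icc 0 ℓ₁, ∀ t ∈ Icc 0 ℓ₂, x s ≠ y t := fun h s hs t ht =>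
    h.ne_of_mem (mem_image_of_mem _ hs) (mem_image_of_mem _ ht)
  obtain ⟨d, hd, hdist⟩ := exists_pos_le_norm_sub hc₀.continuousOn hc'₀.continuousOn hne₀
  obtain ⟨W, hW⟩ := isCompact_Icc.exists_bound_of_continuousOn hw₀
  refine intervalIntegral.tendsto_integral_filter_of_dominated_convergence
    (fun _ => (W + 1) / (d / 3) ^ 2 * C) ?_ ?_ (by simp) ?_
  · refine Eventually.of_forall fun n => ?_
    rw [uIoc_of_le hc₀.nonneg]
    refine ContinuousOn.aestronglyMeasurable (ContinuousOn.mono ?_ Ioc_subset_Icc_self)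
      measurableSet_Ioc
    intro s hs
    refine tendsto_of_seq_tendsto fun σ hσ => ?_
    rw [tendsto_nhdsWithin_iff] at hσ
    obtain ⟨N, hN⟩ := eventually_atTop.1 hσ.2
    have hσ' := (tendsto_nhdsWithin_iff.2 hσ)
    rw [← tendsto_add_atTop_iff_nat N] at hσ' ⊢
    exact tendsto_integral_gauss (fun _ => hc' n) (hc' n) (fun _ => hC n)
      (Metric.tendstoUniformlyOn_iff.2 fun e he => by simp [he])
      (((hc n).continuousOn s hs).tendsto.comp hσ') ((hw n s hs).tendsto.comp hσ')
      (fun m t ht => hdisj (hne n) _ (hN _ (Nat.le_add_left _ _)) t ht)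
      (fun t ht => hdisj (hne n) s hs t ht)
  · filter_upwards [Metric.tendstoUniformlyOn_iff.1 hclim (d / 3) (by linarith),
      Metric.tendstoUniformlyOn_iff.1 hc'lim (d / 3) (by linarith),
      Metric.tendstoUniformlyOn_iff.1 hwlim 1 one_pos] with n h1 h2 h3
    refine Eventually.of_forall fun s hs => ?_
    rw [uIoc_of_le hc₀.nonneg] at hs
    have hs' := Ioc_subset_Icc_self hs
    have h3s := h3 s hs'
    rw [dist_eq_norm] at h3s
    have hwn : ‖w n s‖ ≤ W + 1 := by
      have := norm_le_norm_add_norm_sub (w₀ s) (w n s)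
      linarith [hW s hs']
    have hC0 : 0 ≤ ∫ t in (0 : ℝ)..ℓ₂, ‖a n t‖ :=
      intervalIntegral.integral_nonneg hc'₀.nonneg fun _ _ => norm_nonneg _
    refine (abs_integral_gauss_le (hc' n) (w n s) (show 0 < d / 3 by linarith)
      fun t ht => ?_).trans ?_
    · have e1 := h1 s hs'
      have e2 := h2 t ht
      have e3 := hdist s hs' t ht
      rw [← dist_eq_norm] at e3 ⊢
      have e4 := dist_triangle4 (c₀ s) (c n s) (c' n t) (c'₀ t)
      rw [dist_comm (c' n t)] at e4
      linarith
    · have hW0 : 0 ≤ W + 1 := (norm_nonneg _).trans hwn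
      exact mul_le_mul (by gcongr) (hC n) hC0 (by positivity)
  · refine Eventually.of_forall fun s hs => ?_
    rw [uIoc_of_le hc₀.nonneg] at hs
    have hs' := Ioc_subset_Icc_self hs
    exact tendsto_integral_gauss hc' hc'₀ hC hc'lim (hclim.tendsto_at hs') (hwlim.tendsto_at hs')
      (fun n t ht => hdisj (hne n) s hs' t ht) (fun t ht => hdisj hne₀ s hs' t ht)

/-- Curves of unit speed at distance `d` from each other have a small Gauss integral. -/
lemma abs_gaussIntegral_le {ℓ₁ ℓ₂ d : ℝ} {c w c' a : ℝ → E3} (hc : IsPrimitive ℓ₁ c w)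
    (hw : ContinuousOn w (Icc 0 ℓ₁)) (hw1 : ∀ s ∈ Icc 0 ℓ₁, ‖w s‖ = 1) (hc' : IsPrimitive ℓ₂ c' a)
    (ha1 : ∀ t ∈ Icc 0 ℓ₂, ‖a t‖ = 1) (hd : 0 < d)
    (hdist : ∀ s ∈ Icc 0 ℓ₁, ∀ t ∈ Icc 0 ℓ₂, d ≤ ‖c s - c' t‖) :
    |gaussIntegral ℓ₁ ℓ₂ c c'| ≤ 1 / (4 * Real.pi) * (ℓ₁ * ℓ₂ / d ^ 2) := by
  rw [gaussIntegral_eq hc hw hc', abs_mul, abs_of_nonneg (by positivity : 0 ≤ 1 / (4 * Real.pi))]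
  gcongr
  rw [← Real.norm_eq_abs]
  refine (intervalIntegral.norm_integral_le_of_norm_le_const (C := ℓ₂ / d ^ 2) fun s hs => ?_).trans
    (le_of_eq ?_)
  · rw [uIoc_of_le hc.nonneg] at hs
    have hs' := Ioc_subset_Icc_self hs
    refine (abs_integral_gauss_le hc' (w s) hd fun t ht => hdist s hs' t ht).trans (le_of_eq ?_)
    have : ∫ t in (0 : ℝ)..ℓ₂, ‖a t‖ = ℓ₂ := by
      rw [intervalIntegral.integral_congr (g := fun _ => (1 : ℝ)) fun t ht => ha1 t (by
        rwa [uIcc_of_le hc'.nonneg] at ht)]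
      simp
    rw [this, hw1 s hs']
    ring
  · rw [sub_zero, abs_of_nonneg hc.nonneg]
    ring

/-! ### Closedness of the constraints -/

namespace Rod

variable {p : ℝ} {B : Rod p} {Fs : ℕ → FramedCurve} {F : FramedCurve} {ks : ℕ → ℝ → E3}
  {k : ℝ → E3}

/-- Upper semicontinuity of the volume of the deformed rod. -/
lemma eventually_volume_image_le (hF : TendstoFrame Fs atTop F B.ℓ) (h : IsFrame F B.ℓ k) {e : ℝ}
    (he : 0 < e) : ∀ᶠ n in atTop, volume.real ((Fs n).position '' B.Ω) ≤
      volume.real (F.position '' B.Ω) + e := by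
  have hK : IsCompact (F.position '' B.Ω) := B.isCompact_Ω.image_of_continuousOn
    ((continuousOn_position h).mono fun x hx => hx.1)
  have hfin := hK.measure_lt_top (μ := (volume : Measure E3))
  have h1 := (tendsto_measure_cthickening_of_isCompact hK (μ := volume)).eventually
    (gt_mem_nhds (show volume (F.position '' B.Ω) < volume (F.position '' B.Ω) + ENNReal.ofReal e from
      ENNReal.lt_add_right hfin.ne (by simpa using he)))
  obtain ⟨δ, hδ, hball⟩ := Metric.eventually_nhds_iff.1 h1
  have hR := B.R_pos
  set η := δ / (2 * (1 + 2 * B.R)) with hη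
  have hη0 : 0 < η := by positivity
  have hηδ : η * (1 + 2 * B.R) = δ / 2 := by rw [hη]; field_simp
  have hv : volume (Metric.cthickening (δ / 2) (F.position '' B.Ω)) <
      volume (F.position '' B.Ω) + ENNReal.ofReal e :=
    hball (by rw [Real.dist_eq, sub_zero, abs_of_pos (half_pos hδ)]; linarith)
  filter_upwards [Metric.tendstoUniformlyOn_iff.1 hF.r η hη0,
    Metric.tendstoUniformlyOn_iff.1 hF.u η hη0, Metric.tendstoUniformlyOn_iff.1 hF.v η hη0]
    with n hr hu hv'
  have hsub : (Fs n).position '' B.Ω ⊆ Metric.cthickening (δ / 2) (F.position '' B.Ω) := by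
    rintro _ ⟨x, hx, rfl⟩
    refine Metric.mem_cthickening_of_dist_le _ (F.position x) _ _ (mem_image_of_mem _ hx) ?_
    have e1 := hr x.1 hx.1
    have e2 := hu x.1 hx.1
    have e3 := hv' x.1 hx.1
    have hA := B.A_lt x.1 hx.1 x.2 hx.2
    rw [dist_comm, dist_eq_norm] at e1 e2 e3
    rw [dist_eq_norm, show (Fs n).position x - F.position x = ((Fs n).r x.1 - F.r x.1) +
      x.2.1 • ((Fs n).u x.1 - F.u x.1) + x.2.2 • ((Fs n).v x.1 - F.v x.1) by
        simp only [FramedCurve.position]; module]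
    refine (norm_add₃_le).trans ?_
    rw [norm_smul, norm_smul, Real.norm_eq_abs, Real.norm_eq_abs, ← hηδ]
    have e4 := mul_le_mul hA.1.le e2.le (norm_nonneg _) hR.le
    have e5 := mul_le_mul hA.2.le e3.le (norm_nonneg _) hR.le
    linarith
  have h2 := (measure_mono hsub).trans hv.le
  have h3 := ENNReal.toReal_mono (ENNReal.add_ne_top.2 ⟨hfin.ne, ENNReal.ofReal_ne_top⟩) h2
  rwa [ENNReal.toReal_add hfin.ne ENNReal.ofReal_ne_top, ENNReal.toReal_ofReal he.le] at h3

/-- An interior point of a cross-section of the tube is the position of an interior material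
point. -/
lemma mem_image_interior (h : IsFrame F B.ℓ k) {s : ℝ} (hs : s ∈ Ioo 0 B.ℓ) {P : E3}
    (hP : F.height s P = 0) (hε : ‖P - F.r s‖ < B.ε) : P ∈ F.position '' interior B.Ω := by
  have hs' := Ioo_subset_Icc_self hs
  refine ⟨(s, F.sectionCoord s P), ?_, h.position_sectionCoord hs' hP⟩
  set T : Set (ℝ × ℝ × ℝ) := Prod.fst ⁻¹' Ioo 0 B.ℓ ∩ {x | x.2.1 ^ 2 + x.2.2 ^ 2 < B.ε ^ 2} with hT
  have hopen : IsOpen T := (isOpen_Ioo.preimage continuous_fst).inter (isOpen_lt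
    (f := fun x : ℝ × ℝ × ℝ => x.2.1 ^ 2 + x.2.2 ^ 2) (by fun_prop) continuous_const)
  have hsub : T ⊆ B.Ω := fun x hx =>
    ⟨Ioo_subset_Icc_self hx.1, B.disc_subset (Ioo_subset_Icc_self hx.1) hx.2⟩
  refine interior_maximal hsub hopen ⟨hs, ?_⟩
  exact (h.sectionCoord_sq_le hs' P).trans_lt (pow_lt_pow_left₀ hε (norm_nonneg _) two_ne_zero)

lemma dense_height_ne_zero {s : ℝ} (hw : ‖F.w s‖ = 1) : Dense {P : E3 | F.height s P ≠ 0} := by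
  rw [Metric.dense_iff]
  intro P e he
  by_cases h : F.height s P = 0
  · refine ⟨P + (e / 2) • F.w s, ?_, ?_⟩
    · rw [mem_ball_iff_norm, add_sub_cancel_left, norm_smul, hw, Real.norm_eq_abs,
        abs_of_pos (half_pos he)]
      linarith
    · have : F.height s (P + (e / 2) • F.w s) = e / 2 := by
        rw [FramedCurve.height] at h ⊢
        rw [add_sub_right_comm, inner_add_left, h, inner_smul_left, real_inner_self_eq_norm_sq, hw]
        simp
      rw [mem_ofPred_eq, this]
      exact (half_pos he).ne'
  · exact ⟨P, Metric.mem_ball_self he, h⟩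

/-- The midlines of two rods that do not overlap are disjoint, and this also holds for limits of
such rods: otherwise the tubes around the approximating midlines have a common point off the two
end sections, which is the position of interior points of both rods. -/
lemma disjoint_midlines {B₁ B₂ : Rod p} {Fs₁ Fs₂ : ℕ → FramedCurve} {F₁ F₂ : FramedCurve}
    {ks₁ ks₂ : ℕ → ℝ → E3} {k₁ k₂ : ℝ → E3} (h₁ : B₁.Impenetrable F₁ k₁)
    (h₂ : B₂.Impenetrable F₂ k₂) (hF₁ : TendstoFrame Fs₁ atTop F₁ B₁.ℓ)
    (hF₂ : TendstoFrame Fs₂ atTop F₂ B₂.ℓ) (hs₁ : ∀ n, IsFrame (Fs₁ n) B₁.ℓ (ks₁ n))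
    (hs₂ : ∀ n, IsFrame (Fs₂ n) B₂.ℓ (ks₂ n))
    (hc₁ : ∀ n, (Fs₁ n).r 0 = (Fs₁ n).r B₁.ℓ ∧ (Fs₁ n).w 0 = (Fs₁ n).w B₁.ℓ)
    (hc₂ : ∀ n, (Fs₂ n).r 0 = (Fs₂ n).r B₂.ℓ ∧ (Fs₂ n).w 0 = (Fs₂ n).w B₂.ℓ)
    (hd : ∀ n, Disjoint ((Fs₁ n).position '' interior B₁.Ω) ((Fs₂ n).position '' interior B₂.Ω)) :
    Disjoint (F₁.r '' Icc 0 B₁.ℓ) (F₂.r '' Icc 0 B₂.ℓ) := by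
  rw [Set.disjoint_left]
  rintro q ⟨s, hs, hsq⟩ ⟨t, ht, htq⟩
  have lift : ∀ {B : Rod p} {Fs : ℕ → FramedCurve} {F : FramedCurve},
      TendstoFrame Fs atTop F B.ℓ →
      TendstoFrame (fun x : ℕ × E3 => Fs x.1) (atTop ×ˢ 𝓝 q) F B.ℓ := fun {B Fs F} h => by
    constructor <;> intro u hu
    · exact tendsto_fst.eventually (h.r u hu)
    · exact tendsto_fst.eventually (h.u u hu)
    · exact tendsto_fst.eventually (h.v u hu)
    · exact tendsto_fst.eventually (h.w u hu)
  have e₁ := eventually_mem_tube (lift hF₁) (tendsto_snd (f := atTop) (g := 𝓝 q)) h₁.isFrame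
    (fun i => hs₁ i.1) h₁.closed (fun i => hc₁ i.1) h₁.compression_le hs
    (by simp [FramedCurve.height, hsq]) (by simpa [hsq] using B₁.ε_pos) one_pos
  have e₂ := eventually_mem_tube (lift hF₂) (tendsto_snd (f := atTop) (g := 𝓝 q)) h₂.isFrame
    (fun i => hs₂ i.1) h₂.closed (fun i => hc₂ i.1) h₂.compression_le ht
    (by simp [FramedCurve.height, htq]) (by simpa [htq] using B₂.ε_pos) one_pos
  obtain ⟨n, hn⟩ := ((e₁.and e₂).curry).exists
  obtain ⟨U, hU, hUo, hqU⟩ := eventually_nhds_iff.1 hn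
  have ho : ∀ {F : FramedCurve} {s : ℝ}, IsOpen {P : E3 | F.height s P ≠ 0} := fun {F s} => by
    have hc : Continuous fun P : E3 => F.height s P := by
      unfold FramedCurve.height
      fun_prop
    exact isOpen_ne_fun hc continuous_const
  have hdense := (dense_height_ne_zero ((hs₁ n).norm_w B₁.zero_mem_Icc)).inter_of_isOpen_left
    (dense_height_ne_zero ((hs₂ n).norm_w B₂.zero_mem_Icc)) ho
  obtain ⟨P, hPU, hP₁, hP₂⟩ := hdense.inter_open_nonempty U hUo ⟨q, hqU⟩
  have mem : ∀ {B : Rod p} {F : FramedCurve} {k : ℝ → E3}, IsFrame F B.ℓ k →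
      (F.r 0 = F.r B.ℓ ∧ F.w 0 = F.w B.ℓ) → F.height 0 P ≠ 0 →
      ∀ s ∈ Icc 0 B.ℓ, F.height s P = 0 → ‖P - F.r s‖ < B.ε →
      P ∈ F.position '' interior B.Ω := by
    intro B F k h hc h0 s hs hsP hε
    refine mem_image_interior h ⟨lt_of_le_of_ne hs.1 ?_, lt_of_le_of_ne hs.2 ?_⟩ hsP hε
    · rintro rfl; exact h0 hsP
    · rintro rfl
      refine h0 ?_
      rw [FramedCurve.height] at hsP ⊢
      rw [hc.1, hc.2]
      exact hsP
  obtain ⟨⟨s', hs', -, hz₁, hε₁⟩, t', ht', -, hz₂, hε₂⟩ := hU P hPU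
  exact (hd n).ne_of_mem (mem (hs₁ n) (hc₁ n) hP₁ s' hs' hz₁ hε₁)
    (mem (hs₂ n) (hc₂ n) hP₂ t' ht' hz₂ hε₂) rfl

lemma disjoint_image_interior {B₁ B₂ : Rod p} {Fs₁ Fs₂ : ℕ → FramedCurve} {F₁ F₂ : FramedCurve}
    {ks₁ ks₂ : ℕ → ℝ → E3} {k₁ k₂ : ℝ → E3} (h₁ : B₁.Impenetrable F₁ k₁)
    (h₂ : B₂.Impenetrable F₂ k₂) (hF₁ : TendstoFrame Fs₁ atTop F₁ B₁.ℓ)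
    (hF₂ : TendstoFrame Fs₂ atTop F₂ B₂.ℓ) (hs₁ : ∀ n, IsFrame (Fs₁ n) B₁.ℓ (ks₁ n))
    (hs₂ : ∀ n, IsFrame (Fs₂ n) B₂.ℓ (ks₂ n))
    (hd : ∀ n, Disjoint ((Fs₁ n).position '' interior B₁.Ω) ((Fs₂ n).position '' interior B₂.Ω)) :
    Disjoint (F₁.position '' interior B₁.Ω) (F₂.position '' interior B₂.Ω) := by
  rw [Set.disjoint_left]
  rintro q ⟨x, hx, hxq⟩ ⟨y, hy, hyq⟩
  obtain ⟨n, h1, h2⟩ :=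
    ((eventually_mem_image_interior hF₁ h₁.isFrame hs₁ h₁.compression_le hx).and
    (eventually_mem_image_interior hF₂ h₂.isFrame hs₂ h₂.compression_le hy)).exists
  rw [hxq] at h1
  rw [hyq] at h2
  exact (hd n).ne_of_mem h1 h2 rfl

end Rod

/-! ### The closed up curve and self-linking -/

namespace IsPrimitive

variable {E : Type*} [NormedAddCommGroup E] [NormedSpace ℝ E] {ℓ m : ℝ} {x x' y y' : ℝ → E}

lemma integral_append {f g : ℝ → E} (hℓ : 0 ≤ ℓ) (hm : 0 ≤ m) (hf : IntervalIntegrable f volume 0 ℓ)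
    (hg : IntervalIntegrable g volume 0 m) :
    IntervalIntegrable (fun t => if t ≤ ℓ then f t else g (t - ℓ)) volume 0 (ℓ + m) ∧
      ∫ t in (0 : ℝ)..(ℓ + m), (if t ≤ ℓ then f t else g (t - ℓ)) =
        (∫ t in (0 : ℝ)..ℓ, f t) + ∫ t in (0 : ℝ)..m, g t := by
  have e1 : EqOn f (fun t => if t ≤ ℓ then f t else g (t - ℓ)) (uIoc 0 ℓ) := fun t ht => by
    rw [uIoc_of_le hℓ] at ht
    simp [ht.2]
  have e2 : EqOn (fun t => g (t - ℓ)) (fun t => if t ≤ ℓ then f t else g (t - ℓ))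
      (uIoc ℓ (ℓ + m)) := fun t ht => by
    rw [uIoc_of_le (by linarith)] at ht
    simp [ht.1.not_ge]
  have hg' : IntervalIntegrable (fun t => g (t - ℓ)) volume ℓ (ℓ + m) := by
    simpa [add_comm] using hg.comp_sub_right ℓ
  have i1 := hf.congr e1
  have i2 := hg'.congr e2
  refine ⟨i1.trans i2, ?_⟩
  rw [← intervalIntegral.integral_add_adjacent_intervals i1 i2]
  congr 1
  · exact intervalIntegral.integral_congr_ae (Eventually.of_forall fun t ht => (e1 ht).symm)
  · rw [intervalIntegral.integral_congr_ae (Eventually.of_forall fun t ht => (e2 ht).symm),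
      intervalIntegral.integral_comp_sub_right g ℓ]
    simp

/-- Concatenation of curves. -/
lemma append (hx : IsPrimitive ℓ x x') (hy : IsPrimitive m y y') (h : y 0 = x ℓ) :
    IsPrimitive (ℓ + m) (fun t => if t ≤ ℓ then x t else y (t - ℓ))
      (fun t => if t ≤ ℓ then x' t else y' (t - ℓ)) := by
  have hℓ := hx.nonneg
  refine ⟨add_nonneg hℓ hy.nonneg,
    (integral_append hℓ hy.nonneg hx.integrable hy.integrable).1, fun s hs => ?_⟩
  simp only [hℓ, if_true]
  rcases le_or_gt s ℓ with hsℓ | hsℓ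
  · rw [if_pos hsℓ, hx.eq_integral s ⟨hs.1, hsℓ⟩]
    congr 1
    refine intervalIntegral.integral_congr fun t ht => ?_
    rw [uIcc_of_le hs.1] at ht
    simp [ht.2.trans hsℓ]
  · have hsm : s - ℓ ∈ Icc 0 m := ⟨by linarith, by linarith [hs.2]⟩
    have := (integral_append hℓ hsm.1 hx.integrable
      (hy.intervalIntegrable hy.zero_mem hsm)).2
    rw [add_sub_cancel] at this
    rw [if_neg hsℓ.not_ge, this, hy.eq_integral _ hsm, h, hx.eq_integral ℓ ⟨hℓ, le_rfl⟩, add_assoc]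

end IsPrimitive

/-- The density of the closed up curve `r + τ u`. -/
noncomputable def nearbyDensity (F : FramedCurve) (k : ℝ → E3) (ℓ τ φ t : ℝ) : E3 :=
  if t ≤ ℓ then F.w t + τ • (-(k t 0) • F.w t - k t 2 • F.v t)
  else τ • ((-Real.sin (φ * (t - ℓ)) * φ) • F.u ℓ + (Real.cos (φ * (t - ℓ)) * φ) • F.v ℓ)

namespace IsFrame

variable {F : FramedCurve} {ℓ : ℝ} {k : ℝ → E3}

lemma arc_prim (F : FramedCurve) (ℓ τ φ : ℝ) :
    IsPrimitive 1 (fun t => F.r ℓ + τ • (Real.cos (φ * t) • F.u ℓ + Real.sin (φ * t) • F.v ℓ))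
      (fun t => τ • ((-Real.sin (φ * t) * φ) • F.u ℓ + (Real.cos (φ * t) * φ) • F.v ℓ)) := by
  have hc : Continuous fun t : ℝ =>
      τ • ((-Real.sin (φ * t) * φ) • F.u ℓ + (Real.cos (φ * t) * φ) • F.v ℓ) := by fun_prop
  refine ⟨zero_le_one, hc.intervalIntegrable _ _, fun s _ => ?_⟩
  rw [intervalIntegral.integral_eq_sub_of_hasDerivAt (f := fun t => F.r ℓ + τ •
    (Real.cos (φ * t) • F.u ℓ + Real.sin (φ * t) • F.v ℓ)) (fun t _ => ?_)
    (hc.intervalIntegrable _ _)]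
  · abel
  · have h1 : HasDerivAt (fun t : ℝ => φ * t) φ t := by
      simpa using (hasDerivAt_id t).const_mul φ
    exact (((h1.cos.smul_const (F.u ℓ)).add (h1.sin.smul_const (F.v ℓ))).const_smul τ).const_add _

lemma nearbyCurve_prim (h : IsFrame F ℓ k) (τ φ : ℝ) :
    IsPrimitive (ℓ + 1) (F.nearbyCurve ℓ τ φ) (nearbyDensity F k ℓ τ φ) := by
  have h1 : IsPrimitive ℓ (fun t => F.r t + τ • F.u t)
      (fun t => F.w t + τ • (-(k t 0) • F.w t - k t 2 • F.v t)) :=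
    h.r_prim.add (h.u_prim.comp_clm (τ • ContinuousLinearMap.id ℝ E3))
  exact h1.append (arc_prim F ℓ τ φ) (by simp)

lemma integral_norm_nearbyDensity_le (h : IsFrame F ℓ k) (hk : IntervalIntegrable k volume 0 ℓ)
    {τ φ : ℝ} (hτ : 0 ≤ τ) (hφ : |φ| ≤ Real.pi) :
    ∫ t in (0 : ℝ)..(ℓ + 1), ‖nearbyDensity F k ℓ τ φ t‖ ≤
      ℓ + 2 * τ * (∫ t in (0 : ℝ)..ℓ, ‖k t‖) + 2 * τ * Real.pi := by
  have hℓ := h.r_prim.nonneg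
  have i1 : IntervalIntegrable (fun t => 1 + 2 * τ * ‖k t‖) volume 0 ℓ :=
    (by simp : IntervalIntegrable (fun _ : ℝ => (1 : ℝ)) volume 0 ℓ).add (hk.norm.const_mul _)
  have i2 : IntervalIntegrable (fun _ : ℝ => 2 * τ * Real.pi) volume 0 1 := by simp
  obtain ⟨i3, e3⟩ := IsPrimitive.integral_append hℓ zero_le_one i1 i2
  refine (intervalIntegral.integral_mono_on (by linarith) (h.nearbyCurve_prim τ φ).integrable.norm i3
    fun t ht => ?_).trans (e3.trans ?_).le
  · rw [nearbyDensity]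
    split_ifs with htℓ
    · have ht' : t ∈ Icc 0 ℓ := ⟨ht.1, htℓ⟩
      refine (norm_add_le _ _).trans ?_
      rw [h.norm_w ht', norm_smul, Real.norm_eq_abs, abs_of_nonneg hτ]
      have := mul_le_mul_of_nonneg_left (h.norm_u_density_le ht') hτ
      linarith
    · have hm : ℓ ∈ Icc 0 ℓ := ⟨hℓ, le_rfl⟩
      rw [norm_smul, Real.norm_eq_abs, abs_of_nonneg hτ, mul_comm 2 τ, mul_assoc]
      refine mul_le_mul_of_nonneg_left ((norm_add_le _ _).trans ?_) hτ
      rw [norm_smul, norm_smul, h.norm_u ℓ hm, h.norm_v ℓ hm, norm_mul, norm_mul, norm_neg,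
        mul_one, mul_one, Real.norm_eq_abs, Real.norm_eq_abs, Real.norm_eq_abs]
      have e1 := mul_le_mul (Real.abs_sin_le_one (φ * (t - ℓ))) hφ (abs_nonneg _) zero_le_one
      have e2 := mul_le_mul (Real.abs_cos_le_one (φ * (t - ℓ))) hφ (abs_nonneg _) zero_le_one
      linarith
  · rw [intervalIntegral.integral_add (by simp) (hk.norm.const_mul _),
      intervalIntegral.integral_const_mul]
    simp

/-- Every point of the closed up curve `r + τ u` lies in a cross-section, at distance `τ` from the
midline. -/
lemma exists_height_nearbyCurve (h : IsFrame F ℓ k) {τ φ t : ℝ} (hτ : 0 ≤ τ) (ht : 0 ≤ t) :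
    ∃ s ∈ Icc 0 ℓ, F.height s (F.nearbyCurve ℓ τ φ t) = 0 ∧
      ‖F.nearbyCurve ℓ τ φ t - F.r s‖ = τ := by
  have hℓ := h.r_prim.nonneg
  have key : ∀ s ∈ Icc 0 ℓ, ∀ θ : ℝ, F.height s (F.position (s, (τ * Real.cos θ, τ * Real.sin θ))) = 0 ∧
      ‖F.position (s, (τ * Real.cos θ, τ * Real.sin θ)) - F.r s‖ = τ := fun s hs θ => by
    refine ⟨height_position _ _ _, ?_⟩
    rw [← sq_eq_sq₀ (norm_nonneg _) hτ, h.norm_position_sub_sq hs]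
    have := Real.sin_sq_add_cos_sq θ
    linear_combination τ ^ 2 * this
  rw [FramedCurve.nearbyCurve]
  split_ifs with htℓ
  · refine ⟨t, ⟨ht, htℓ⟩, ?_⟩
    have := key t ⟨ht, htℓ⟩ 0
    simpa [FramedCurve.position] using this
  · refine ⟨ℓ, ⟨hℓ, le_rfl⟩, ?_⟩
    have := key ℓ ⟨hℓ, le_rfl⟩ (φ * (t - ℓ))
    simpa [FramedCurve.position, smul_add, smul_smul, add_assoc] using this

end IsFrame

lemma TendstoFrame.tendstoUniformlyOn_nearbyCurve {Fs : ℕ → FramedCurve} {F : FramedCurve} {ℓ : ℝ}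
    (hF : TendstoFrame Fs atTop F ℓ) (hℓ : 0 ≤ ℓ) (τ : ℝ) {φs : ℕ → ℝ} {φ : ℝ}
    (hφ : Tendsto φs atTop (𝓝 φ)) :
    TendstoUniformlyOn (fun n => (Fs n).nearbyCurve ℓ τ (φs n)) (F.nearbyCurve ℓ τ φ) atTop
      (Icc 0 (ℓ + 1)) := by
  have hm : ℓ ∈ Icc 0 ℓ := ⟨hℓ, le_rfl⟩
  -- the two parts of the curve are images of uniformly convergent maps
  have h1 : TendstoUniformlyOn (fun n t => (Fs n).r t + τ • (Fs n).u t) (fun t => F.r t + τ • F.u t)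
      atTop (Icc 0 ℓ) := hF.r.add ((uniformContinuous_const_smul τ).comp_tendstoUniformlyOn hF.u)
  have h2 : TendstoUniformlyOn (fun n t => (Fs n).r ℓ + τ • (Real.cos (φs n * (t - ℓ)) • (Fs n).u ℓ +
      Real.sin (φs n * (t - ℓ)) • (Fs n).v ℓ)) (fun t => F.r ℓ + τ • (Real.cos (φ * (t - ℓ)) • F.u ℓ +
      Real.sin (φ * (t - ℓ)) • F.v ℓ)) atTop (Icc ℓ (ℓ + 1)) := by
    have hd : Tendsto (fun n => ((Fs n).r ℓ, (Fs n).u ℓ, (Fs n).v ℓ, φs n)) atTop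
        (𝓝 (F.r ℓ, F.u ℓ, F.v ℓ, φ)) :=
      (hF.r.tendsto_at hm).prodMk_nhds ((hF.u.tendsto_at hm).prodMk_nhds
        ((hF.v.tendsto_at hm).prodMk_nhds hφ))
    have hd' : TendstoUniformlyOn (fun n t => (((Fs n).r ℓ, (Fs n).u ℓ, (Fs n).v ℓ, φs n), t))
        (fun t => ((F.r ℓ, F.u ℓ, F.v ℓ, φ), t)) atTop (Icc ℓ (ℓ + 1)) := by
      rw [Metric.tendstoUniformlyOn_iff]
      intro e he
      filter_upwards [Metric.tendsto_nhds.1 hd e he] with n hn t _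
      rw [Prod.dist_eq, dist_self, dist_comm]
      exact max_lt hn he
    have hf : Continuous fun q : (E3 × E3 × E3 × ℝ) × ℝ => q.1.1 + τ •
        (Real.cos (q.1.2.2.2 * (q.2 - ℓ)) • q.1.2.1 + Real.sin (q.1.2.2.2 * (q.2 - ℓ)) • q.1.2.2.1) := by
      fun_prop
    have hK : IsCompact ((fun t : ℝ => ((F.r ℓ, F.u ℓ, F.v ℓ, φ), t)) '' Icc ℓ (ℓ + 1)) :=
      isCompact_Icc.image (by fun_prop)
    have h := TendstoUniformlyOn.comp_continuousAt hK (fun q _ => hf.continuousAt) hd'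
      fun t ht => mem_image_of_mem _ ht
    exact h
  rw [Metric.tendstoUniformlyOn_iff] at h1 h2 ⊢
  intro e he
  filter_upwards [h1 e he, h2 e he] with n e1 e2 t ht
  simp only [FramedCurve.nearbyCurve]
  split_ifs with htℓ
  · exact e1 t ⟨ht.1, htℓ⟩
  · exact e2 t ⟨(not_le.1 htℓ).le, ht.2⟩

namespace Rod

variable {p : ℝ} {B : Rod p} {Fs : ℕ → FramedCurve} {F : FramedCurve} {ks : ℕ → ℝ → E3}
  {k : ℝ → E3}

/-- In the limit of rods the self-linking number is preserved: the limit tube of radius `ε` is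
embedded, so that the curve at distance `τ < ε` stays away from the midline. -/
lemma selfLinking_of_tendstoFrame (h : B.Impenetrable F k) (hF : TendstoFrame Fs atTop F B.ℓ)
    (hs : ∀ n, IsFrame (Fs n) B.ℓ (ks n)) (hks : ∀ n, IntervalIntegrable (ks n) volume 0 B.ℓ) {C : ℝ}
    (hC : ∀ n, ∫ t in (0 : ℝ)..B.ℓ, ‖ks n t‖ ≤ C) {m : ℤ} {φs : ℕ → ℝ} {φ : ℝ}
    (hφ : Tendsto φs atTop (𝓝 φ)) (hφs : ∀ n, φs n ∈ Icc (-Real.pi) Real.pi)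
    (hclose : ∀ n, Real.cos (φs n) • (Fs n).u B.ℓ + Real.sin (φs n) • (Fs n).v B.ℓ = (Fs n).u 0)
    (hlink : ∀ n, HasLinkingNumber B.ℓ (B.ℓ + 1) (Fs n).r
      ((Fs n).nearbyCurve B.ℓ B.τ (φs n)) m) : F.SelfLinking B.ℓ B.τ m := by
  have hℓm := B.ℓ_mem_Icc
  have hdisj : Disjoint (F.r '' Icc 0 B.ℓ) (F.nearbyCurve B.ℓ B.τ φ '' Icc 0 (B.ℓ + 1)) := by
    rw [Set.disjoint_left]
    rintro _ ⟨s, hsI, rfl⟩ ⟨t, ht, hts⟩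
    obtain ⟨s', hs', h0, h1⟩ := h.isFrame.exists_height_nearbyCurve (φ := φ) B.τ_pos.le ht.1
    exact h.midline_ne hsI hs' h0 (by rw [h1]; exact B.τ_pos)
      (by rw [h1]; exact B.τ_lt) hts.symm
  refine ⟨φ, isClosed_Icc.mem_of_tendsto hφ (Eventually.of_forall hφs), ?_, hdisj, ?_⟩
  · refine tendsto_nhds_unique ?_ (hF.u.tendsto_at B.zero_mem_Icc)
    simp_rw [← hclose]
    exact (((Real.continuous_cos.tendsto _).comp hφ).smul (hF.u.tendsto_at hℓm)).add
      (((Real.continuous_sin.tendsto _).comp hφ).smul (hF.v.tendsto_at hℓm))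
  · refine tendsto_nhds_unique (tendsto_gaussIntegral (fun n => (hs n).r_prim) h.isFrame.r_prim
      (fun n => (hs n).w_prim.continuousOn) h.isFrame.w_prim.continuousOn
      (fun n => (hs n).nearbyCurve_prim B.τ (φs n)) (h.isFrame.nearbyCurve_prim B.τ φ)
      (C := B.ℓ + 2 * B.τ * C + 2 * B.τ * Real.pi) (fun n => ?_) hF.r hF.w
      (hF.tendstoUniformlyOn_nearbyCurve B.ℓ_pos.le B.τ hφ) (fun n => (hlink n).1) hdisj) ?_
    · refine ((hs n).integral_norm_nearbyDensity_le (hks n) B.τ_pos.le (abs_le.2 (hφs n))).trans ?_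
      have := B.τ_pos
      gcongr
      exact hC n
    · simp_rw [fun n => (hlink n).2]
      exact tendsto_const_nhds

end Rod

/-! ### Existence of a minimizer -/

namespace Rod

variable {p : ℝ} {B : Rod p}

section Limit

variable {z : ℕ → Density p B.ℓ} {b : ℕ → InitialValue} {Z : Density p B.ℓ} {b₀ : InitialValue}

/-- The constraints of non-interpenetration and of closedness are preserved in the limit. -/
lemma impenetrable_of_convexLimit (hp : 1 < p) (hb₀ : b₀.IsOrthonormal)
    (hF : TendstoFrame (fun n => B.frame (z n) (b n)) atTop (B.frame Z b₀) B.ℓ)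
    (hZ : ConvexLimit z Z) {m : ℤ} (hadm : ∀ n, B.Admissible (z n) (b n) m) :
    B.Impenetrable (B.frame Z b₀) Z := by
  have h0 := B.zero_mem_Icc
  have hℓ := B.ℓ_mem_Icc
  refine ⟨B.isFrame hp Z hb₀, intervalIntegrable_density hp B.ℓ_pos.le Z, ⟨?_, ?_⟩, ?_, ?_⟩
  · refine tendsto_nhds_unique (hF.r.tendsto_at h0) ?_
    simp_rw [fun n => (hadm n).closed]
    exact hF.r.tendsto_at hℓ
  · refine tendsto_nhds_unique (hF.w.tendsto_at h0) ?_
    simp_rw [fun n => (hadm n).tangent]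
    exact hF.w.tendsto_at hℓ
  · exact (ae_restrict_iff' measurableSet_Icc).1
      (B.ae_compression_le_of_convexLimit hZ fun n => (hadm n).local_noninterpenetration)
  · refine B.integral_jacobian_le_of_convexLimit hp hZ fun e he => ?_
    filter_upwards [eventually_volume_image_le hF (B.isFrame hp Z hb₀) he] with n hn
    exact (hadm n).global_noninterpenetration.trans hn

lemma admissible_of_convexLimit (hp : 1 < p) (hb : ∀ n, (b n).IsOrthonormal)
    (hb₀ : b₀.IsOrthonormal) {C : ℝ} (hz : ∀ n, ‖z n‖ ≤ C)
    (hF : TendstoFrame (fun n => B.frame (z n) (b n)) atTop (B.frame Z b₀) B.ℓ)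
    (hZ : ConvexLimit z Z) {m : ℤ} (hadm : ∀ n, B.Admissible (z n) (b n) m) {φs : ℕ → ℝ} {φ : ℝ}
    (hφ : Tendsto φs atTop (𝓝 φ)) (hφs : ∀ n, φs n ∈ Icc (-Real.pi) Real.pi)
    (hclose : ∀ n, Real.cos (φs n) • (B.frame (z n) (b n)).u B.ℓ +
      Real.sin (φs n) • (B.frame (z n) (b n)).v B.ℓ = (B.frame (z n) (b n)).u 0)
    (hlink : ∀ n, HasLinkingNumber B.ℓ (B.ℓ + 1) (B.frame (z n) (b n)).r
      ((B.frame (z n) (b n)).nearbyCurve B.ℓ B.τ (φs n)) m) : B.Admissible Z b₀ m := by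
  have h := impenetrable_of_convexLimit hp hb₀ hF hZ hadm
  exact ⟨h.closed.1, h.closed.2, (ae_restrict_iff' measurableSet_Icc).2 h.compression_le,
    h.volume_le, selfLinking_of_tendstoFrame h hF (fun n => B.isFrame hp (z n) (hb n))
      (fun n => intervalIntegrable_density hp B.ℓ_pos.le (z n))
      (fun n => integral_norm_density_le hp (hz n) le_rfl B.zero_mem_Icc B.ℓ_mem_Icc B.ℓ_pos.le)
      hφ hφs hclose hlink⟩

lemma abs_weightEnergy_le (hp : 1 < p) (grav : E3) (x : Density p B.ℓ) {b : InitialValue}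
    (hb : b.IsOrthonormal) {c : ℝ} (hc : ‖b.r‖ ≤ c) :
    |B.weightEnergy grav x b| ≤ (‖grav‖ * (c + B.ℓ)) * ∫ s in Icc 0 B.ℓ, ‖B.ρ s‖ := by
  rw [weightEnergy, abs_neg, ← Real.norm_eq_abs, ← integral_const_mul]
  refine norm_integral_le_of_norm_le (B.ρ_integrable.norm.const_mul _) ?_
  filter_upwards [ae_restrict_mem measurableSet_Icc] with s hs
  have h1 := B.norm_midline_sub_le hp x hb B.zero_mem_Icc hs hs.1
  rw [B.frame_r_zero hp x hb] at h1
  have h2 : ‖(B.frame x b).r s‖ ≤ c + B.ℓ := by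
    have := norm_le_norm_add_norm_sub' ((B.frame x b).r s) b.r
    linarith [hs.2]
  rw [norm_mul, mul_comm]
  gcongr
  exact (norm_inner_le_norm _ _).trans (by gcongr)

lemma tendsto_weightEnergy (hp : 1 < p) (grav : E3) (hb : ∀ n, (b n).IsOrthonormal) {c : ℝ}
    (hc : ∀ n, ‖(b n).r‖ ≤ c)
    (hF : TendstoFrame (fun n => B.frame (z n) (b n)) atTop (B.frame Z b₀) B.ℓ) :
    Tendsto (fun n => B.weightEnergy grav (z n) (b n)) atTop (𝓝 (B.weightEnergy grav Z b₀)) := by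
  simp only [weightEnergy]
  refine Tendsto.neg ?_
  refine tendsto_integral_of_dominated_convergence
    (fun s => (‖grav‖ * (c + B.ℓ)) * ‖B.ρ s‖) (fun n => ?_) (B.ρ_integrable.norm.const_mul _)
    (fun n => ?_) ?_
  · refine B.ρ_integrable.aestronglyMeasurable.mul ?_
    exact (continuousOn_const.inner (B.isFrame hp (z n) (hb n)).r_prim.continuousOn).aestronglyMeasurable
      measurableSet_Icc
  · filter_upwards [ae_restrict_mem measurableSet_Icc] with s hs
    have h1 := B.norm_midline_sub_le hp (z n) (hb n) B.zero_mem_Icc hs hs.1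
    rw [B.frame_r_zero hp (z n) (hb n)] at h1
    have h2 : ‖(B.frame (z n) (b n)).r s‖ ≤ c + B.ℓ := by
      have := norm_le_norm_add_norm_sub' ((B.frame (z n) (b n)).r s) (b n).r
      linarith [hs.2, hc n]
    rw [norm_mul, mul_comm]
    gcongr
    exact (norm_inner_le_norm _ _).trans (by gcongr)
  · filter_upwards [ae_restrict_mem measurableSet_Icc] with s hs
    exact (tendsto_const_nhds.inner (hF.r.tendsto_at hs)).const_mul _

end Limit

/-- Linked rods are near to each other, so that the position of the second rod is controlled by
that of the first one. -/
lemma norm_initial_le_of_linked (hp : 1 < p) {B₁ B₂ : Rod p} {z₁ : Density p B₁.ℓ}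
    {z₂ : Density p B₂.ℓ} {b₁ b₂ : InitialValue} (hb₁ : b₁.IsOrthonormal) (hb₂ : b₂.IsOrthonormal)
    (h : HasLinkingNumber B₁.ℓ B₂.ℓ (B₁.frame z₁ b₁).r (B₂.frame z₂ b₂).r 1) :
    ‖b₂.r‖ ≤ ‖b₁.r‖ + B₁.ℓ + √(B₁.ℓ * B₂.ℓ) + B₂.ℓ := by
  have h₁ := B₁.isFrame hp z₁ hb₁
  have h₂ := B₂.isFrame hp z₂ hb₂
  have hℓ : 0 < B₁.ℓ * B₂.ℓ := mul_pos B₁.ℓ_pos B₂.ℓ_pos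
  obtain ⟨s, hs, t, ht, hst⟩ : ∃ s ∈ Icc 0 B₁.ℓ, ∃ t ∈ Icc 0 B₂.ℓ,
      ‖(B₁.frame z₁ b₁).r s - (B₂.frame z₂ b₂).r t‖ < √(B₁.ℓ * B₂.ℓ) := by
    by_contra! hfar
    have := abs_gaussIntegral_le h₁.r_prim h₁.w_prim.continuousOn (fun s hs => h₁.norm_w hs)
      h₂.r_prim (fun t ht => h₂.norm_w ht) (Real.sqrt_pos.2 hℓ) hfar
    rw [h.2, Real.sq_sqrt hℓ.le, div_self hℓ.ne', mul_one, Int.cast_one, abs_one,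
      le_div_iff₀ (by positivity)] at this
    linarith [Real.pi_gt_three]
  have e1 := B₁.norm_midline_sub_le hp z₁ hb₁ B₁.zero_mem_Icc hs hs.1
  have e2 := B₂.norm_midline_sub_le hp z₂ hb₂ B₂.zero_mem_Icc ht ht.1
  rw [B₁.frame_r_zero hp z₁ hb₁] at e1
  rw [B₂.frame_r_zero hp z₂ hb₂] at e2
  have e3 : b₂.r = b₁.r + ((B₁.frame z₁ b₁).r s - b₁.r) -
    ((B₁.frame z₁ b₁).r s - (B₂.frame z₂ b₂).r t) - ((B₂.frame z₂ b₂).r t - b₂.r) := by abel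
  have e4 := norm_sub_le (b₁.r + ((B₁.frame z₁ b₁).r s - b₁.r) -
    ((B₁.frame z₁ b₁).r s - (B₂.frame z₂ b₂).r t)) ((B₂.frame z₂ b₂).r t - b₂.r)
  have e5 := norm_sub_le (b₁.r + ((B₁.frame z₁ b₁).r s - b₁.r))
    ((B₁.frame z₁ b₁).r s - (B₂.frame z₂ b₂).r t)
  have e6 := norm_add_le b₁.r ((B₁.frame z₁ b₁).r s - b₁.r)
  rw [← e3] at e4
  linarith [hs.2, ht.2]

end Rod

variable {p : ℝ} {B₁ B₂ : Rod p}

/-- The loop energy as a real number; a junk value where the elastic energy is infinite. -/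
noncomputable def realLoopEnergy (b₁ : InitialValue) (grav : E3) (z : Config B₁ B₂) : ℝ :=
  (B₁.elasticEnergy z.z₁).toReal + B₁.weightEnergy grav z.z₁ b₁ +
    (B₂.elasticEnergy z.z₂).toReal + B₂.weightEnergy grav z.z₂ z.b₂

lemma loopEnergy_eq_coe {b₁ : InitialValue} {grav : E3} {z : Config B₁ B₂}
    (h₁ : B₁.elasticEnergy z.z₁ ≠ ⊤) (h₂ : B₂.elasticEnergy z.z₂ ≠ ⊤) :
    loopEnergy b₁ grav z = (realLoopEnergy b₁ grav z : EReal) := by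
  have coe : ∀ e : ℝ≥0∞, e ≠ ⊤ → (e : EReal) = ((e.toReal : ℝ) : EReal) := fun e he => by
    lift e to ℝ≥0 using he
    rw [EReal.coe_nnreal_eq_coe_real, ENNReal.coe_toReal]
  rw [loopEnergy, realLoopEnergy, coe _ h₁, coe _ h₂]
  norm_cast

lemma elasticEnergy_ne_top_of_loopEnergy_lt {b₁ : InitialValue} {grav : E3} {z : Config B₁ B₂}
    {M : ℝ} (h : loopEnergy b₁ grav z < (M : EReal)) :
    B₁.elasticEnergy z.z₁ ≠ ⊤ ∧ B₂.elasticEnergy z.z₂ ≠ ⊤ := by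
  have hb : ∀ e : ℝ≥0∞, (e : EReal) ≠ ⊥ := fun e => EReal.coe_ennreal_ne_bot e
  constructor <;> intro he
  · rw [loopEnergy, he, EReal.coe_ennreal_top, EReal.top_add_coe,
      EReal.top_add_of_ne_bot (hb _), EReal.top_add_coe] at h
    exact not_top_lt h
  · rw [loopEnergy, he, EReal.coe_ennreal_top, EReal.add_top_of_ne_bot, EReal.top_add_coe] at h
    · exact not_top_lt h
    · exact EReal.add_ne_bot_iff.2 ⟨hb _, EReal.coe_ne_bot _⟩

section Minimizer

variable {p : ℝ} {B₁ B₂ : Rod p} {b₁ : InitialValue} {grav : E3} {M : ℝ} {n₁ n₂ : ℤ}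
  {η₁ η₂ : ℝ → E3}

/-- On the admissible class the elastic energies and the initial values are bounded, and the loop
energy is bounded below. -/
lemma exists_bound_of_mem_admissibleClass (hp : 1 < p) (hb₁ : b₁.IsOrthonormal) :
    ∃ K : ℝ, ∀ z : Config B₁ B₂, z ∈ admissibleClass b₁ grav M n₁ n₂ η₁ η₂ →
      -K ≤ realLoopEnergy b₁ grav z ∧ B₁.elasticEnergy z.z₁ ≤ ENNReal.ofReal K ∧
      B₂.elasticEnergy z.z₂ ≤ ENNReal.ofReal K ∧ ‖z.b₂.r‖ ≤ K := by
  set c := ‖b₁.r‖ + B₁.ℓ + √(B₁.ℓ * B₂.ℓ) + B₂.ℓ with hc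
  set W₁ := (‖grav‖ * (‖b₁.r‖ + B₁.ℓ)) * ∫ s in Icc 0 B₁.ℓ, ‖B₁.ρ s‖ with hW₁
  set W₂ := (‖grav‖ * (c + B₂.ℓ)) * ∫ s in Icc 0 B₂.ℓ, ‖B₂.ρ s‖ with hW₂
  refine ⟨|M| + W₁ + W₂ + c, fun z hz => ?_⟩
  obtain ⟨hb₂, hM, -, -, -, hlink, -⟩ := hz
  obtain ⟨h₁, h₂⟩ := elasticEnergy_ne_top_of_loopEnergy_lt hM
  rw [loopEnergy_eq_coe h₁ h₂, EReal.coe_lt_coe_iff] at hM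
  have hr := Rod.norm_initial_le_of_linked hp hb₁ hb₂ hlink
  have w₁ := abs_le.1 (B₁.abs_weightEnergy_le hp grav z.z₁ hb₁ le_rfl)
  have w₂ := abs_le.1 (B₂.abs_weightEnergy_le hp grav z.z₂ hb₂ hr)
  have hW₁0 : 0 ≤ W₁ := (abs_nonneg _).trans (B₁.abs_weightEnergy_le hp grav z.z₁ hb₁ le_rfl)
  have hW₂0 : 0 ≤ W₂ := (abs_nonneg _).trans (B₂.abs_weightEnergy_le hp grav z.z₂ hb₂ hr)
  have hc0 : 0 ≤ c := (norm_nonneg _).trans hr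
  have e₁ : 0 ≤ (B₁.elasticEnergy z.z₁).toReal := ENNReal.toReal_nonneg
  have e₂ : 0 ≤ (B₂.elasticEnergy z.z₂).toReal := ENNReal.toReal_nonneg
  have hMa := abs_nonneg M
  have hMa' := le_abs_self M
  rw [realLoopEnergy] at hM ⊢
  refine ⟨by linarith, ?_, ?_, by linarith⟩
  · exact (ENNReal.le_ofReal_iff_toReal_le h₁ (by linarith)).2 (by linarith)
  · exact (ENNReal.le_ofReal_iff_toReal_le h₂ (by linarith)).2 (by linarith)

/-- The loop energy does not increase in the limit of a suitable subsequence of an admissible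
sequence, and the limit is admissible. -/
theorem exists_admissible_realLoopEnergy_le (hp : 1 < p) (hb₁ : b₁.IsOrthonormal)
    {x : ℕ → Config B₁ B₂} (hx : ∀ n, x n ∈ admissibleClass b₁ grav M n₁ n₂ η₁ η₂) {I : ℝ}
    (hI : Tendsto (fun n => realLoopEnergy b₁ grav (x n)) atTop (𝓝 I)) (hIM : I < M) :
    ∃ z ∈ (admissibleClass b₁ grav M n₁ n₂ η₁ η₂ : Set (Config B₁ B₂)),
      loopEnergy b₁ grav z ≤ (I : EReal) := by
  have hfact : Fact (1 ≤ ENNReal.ofReal p) := ⟨by simpa using hp.le⟩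
  obtain ⟨K, hK⟩ := exists_bound_of_mem_admissibleClass (B₁ := B₁) (B₂ := B₂) (grav := grav)
    (M := M) (n₁ := n₁) (n₂ := n₂) (η₁ := η₁) (η₂ := η₂) hp hb₁
  obtain ⟨C₁, hC₁⟩ := B₁.exists_norm_le_of_elasticEnergy_le hp (c := ENNReal.ofReal K)
    ENNReal.ofReal_ne_top
  obtain ⟨C₂, hC₂⟩ := B₂.exists_norm_le_of_elasticEnergy_le hp (c := ENNReal.ofReal K)
    ENNReal.ofReal_ne_top
  -- a subsequence along which the rods, the elastic energies and the closing angles converge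
  obtain ⟨ψ₁, hψ₁, Y₁, F₁, hF₁⟩ := B₁.exists_subseq_tendstoRod hp (z := fun n => (x n).z₁)
    (b := fun _ => b₁) (fun _ => hb₁) (fun n => hC₁ _ (hK _ (hx n)).2.1) (fun _ => le_rfl)
  obtain ⟨ψ₂, hψ₂, Y₂, F₂, hF₂⟩ := B₂.exists_subseq_tendstoRod hp (z := fun n => (x (ψ₁ n)).z₂)
    (b := fun n => (x (ψ₁ n)).b₂) (fun n => (hx _).1) (fun n => hC₂ _ (hK _ (hx _)).2.2.1)
    (fun n => (hK _ (hx _)).2.2.2)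
  choose φ₁ hφ₁ hclose₁ hlink₁ using fun n => (hx n).2.2.1.selfLinking
  choose φ₂ hφ₂ hclose₂ hlink₂ using fun n => (hx n).2.2.2.1.selfLinking
  obtain ⟨⟨e₁, e₂, α₁, α₂⟩, -, ψ₃, hψ₃, hlim⟩ :=
    ((isCompact_univ (X := ℝ≥0∞)).prod ((isCompact_univ (X := ℝ≥0∞)).prod
      ((isCompact_Icc (a := -Real.pi) (b := Real.pi)).prod
        (isCompact_Icc (a := -Real.pi) (b := Real.pi))))).tendsto_subseq
      (x := fun n => (B₁.elasticEnergy (x (ψ₁ (ψ₂ n))).z₁, B₂.elasticEnergy (x (ψ₁ (ψ₂ n))).z₂,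
        φ₁ (ψ₁ (ψ₂ n)), φ₂ (ψ₁ (ψ₂ n))))
      fun n => ⟨mem_univ _, mem_univ _, hφ₁ _, hφ₂ _⟩
  set ψ : ℕ → ℕ := fun n => ψ₁ (ψ₂ (ψ₃ n)) with hψ
  have hψm : StrictMono ψ := hψ₁.comp (hψ₂.comp hψ₃)
  have he₁ : Tendsto (fun n => B₁.elasticEnergy (x (ψ n)).z₁) atTop (𝓝 e₁) :=
    (continuous_fst.tendsto _).comp hlim
  have he₂ : Tendsto (fun n => B₂.elasticEnergy (x (ψ n)).z₂) atTop (𝓝 e₂) :=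
    (continuous_snd.fst.tendsto _).comp hlim
  have hα₁ : Tendsto (fun n => φ₁ (ψ n)) atTop (𝓝 α₁) :=
    (continuous_snd.snd.fst.tendsto _).comp hlim
  have hα₂ : Tendsto (fun n => φ₂ (ψ n)) atTop (𝓝 α₂) :=
    (continuous_snd.snd.snd.tendsto _).comp hlim
  have hR₁ := hF₁.comp (hψ₂.comp hψ₃)
  have hR₂ := hF₂.comp hψ₃
  have hn₁ : ∀ n, ‖(x (ψ n)).z₁‖ ≤ C₁ := fun n => hC₁ _ (hK _ (hx _)).2.1
  have hn₂ : ∀ n, ‖(x (ψ n)).z₂‖ ≤ C₂ := fun n => hC₂ _ (hK _ (hx _)).2.2.1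
  obtain ⟨Z₁, hZ₁⟩ := exists_convexLimit hp hn₁
  obtain ⟨Z₂, hZ₂⟩ := exists_convexLimit hp hn₂
  obtain ⟨-, hT₁⟩ := hR₁.tendstoFrame hp (fun _ => hb₁) hn₁ hZ₁
  obtain ⟨hb₂, hT₂⟩ := hR₂.tendstoFrame hp (fun n => (hx _).1) hn₂ hZ₂
  -- the initial value of the first rod is kept
  have hinit : (⟨F₁.r 0, F₁.u 0, F₁.v 0⟩ : InitialValue) = b₁ := by
    have h0 := B₁.zero_mem_Icc
    have hr : F₁.r 0 = b₁.r := tendsto_nhds_unique (hR₁.r.tendsto_at h0) (by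
      simp_rw [B₁.frame_r_zero hp _ hb₁]; exact tendsto_const_nhds)
    have hu : F₁.u 0 = b₁.u := tendsto_nhds_unique (hR₁.u.tendsto_at h0) (by
      simp_rw [B₁.frame_u_zero hp _ hb₁]; exact tendsto_const_nhds)
    have hv : F₁.v 0 = b₁.v := tendsto_nhds_unique (hR₁.v.tendsto_at h0) (by
      simp_rw [B₁.frame_v_zero hp _ hb₁]; exact tendsto_const_nhds)
    rw [hr, hu, hv]
  rw [hinit] at hT₁
  set b₂ : InitialValue := ⟨F₂.r 0, F₂.u 0, F₂.v 0⟩ with hb₂def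
  have hfr₁ := fun n => B₁.isFrame hp (x (ψ n)).z₁ hb₁
  have hfr₂ := fun n => B₂.isFrame hp (x (ψ n)).z₂ (hx (ψ n)).1
  have him₁ : B₁.Impenetrable (B₁.frame Z₁ b₁) Z₁ :=
    Rod.impenetrable_of_convexLimit hp hb₁ hT₁ hZ₁ fun n => (hx (ψ n)).2.2.1
  have him₂ : B₂.Impenetrable (B₂.frame Z₂ b₂) Z₂ :=
    Rod.impenetrable_of_convexLimit hp hb₂ hT₂ hZ₂ fun n => (hx (ψ n)).2.2.2.1
  have hcl₁ := fun n => And.intro (hx (ψ n)).2.2.1.closed (hx (ψ n)).2.2.1.tangent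
  have hcl₂ := fun n => And.intro (hx (ψ n)).2.2.2.1.closed (hx (ψ n)).2.2.2.1.tangent
  have hdis := Rod.disjoint_midlines him₁ him₂ hT₁ hT₂ hfr₁ hfr₂ hcl₁ hcl₂
    fun n => (hx (ψ n)).2.2.2.2.1
  have hlk : HasLinkingNumber B₁.ℓ B₂.ℓ (B₁.frame Z₁ b₁).r (B₂.frame Z₂ b₂).r 1 := by
    refine ⟨hdis, tendsto_nhds_unique (tendsto_gaussIntegral (fun n => (hfr₁ n).r_prim)
      him₁.isFrame.r_prim (fun n => (hfr₁ n).w_prim.continuousOn) him₁.isFrame.w_prim.continuousOn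
      (fun n => (hfr₂ n).r_prim) him₂.isFrame.r_prim (C := B₂.ℓ) (fun n => ?_) hT₁.r hT₁.w hT₂.r
      (fun n => (hx (ψ n)).2.2.2.2.2.1.1) hdis) ?_⟩
    · rw [intervalIntegral.integral_congr (g := fun _ => (1 : ℝ)) fun t ht =>
        (hfr₂ n).norm_w (by rwa [uIcc_of_le B₂.ℓ_pos.le] at ht)]
      simp
    · simp_rw [fun n => (hx (ψ n)).2.2.2.2.2.1.2]
      exact tendsto_const_nhds
  have hiso : LinkIsotopic ((B₁.frame Z₁ b₁).r '' Icc 0 B₁.ℓ) ((B₂.frame Z₂ b₂).r '' Icc 0 B₂.ℓ)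
      (η₁ '' Icc 0 B₁.ℓ) (η₂ '' Icc 0 B₂.ℓ) := by
    obtain ⟨n, hn⟩ := (eventually_linkIsotopic him₁ him₂ hdis hT₁ hT₂ hfr₁ hfr₂
      (fun n => (hcl₁ n).1) fun n => (hcl₂ n).1).exists
    exact hn.trans (hx (ψ n)).2.2.2.2.2.2
  -- lower semicontinuity of the energy
  have hw₁ := Rod.tendsto_weightEnergy hp grav (fun _ => hb₁) (fun _ => le_rfl) hT₁
  have hw₂ := Rod.tendsto_weightEnergy hp grav (fun n => (hx (ψ n)).1)
    (fun n => (hK _ (hx (ψ n))).2.2.2) hT₂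
  have hfin₁ : e₁ ≠ ⊤ := ((le_of_tendsto' he₁ fun n => (hK _ (hx (ψ n))).2.1).trans_lt
    ENNReal.ofReal_lt_top).ne
  have hfin₂ : e₂ ≠ ⊤ := ((le_of_tendsto' he₂ fun n => (hK _ (hx (ψ n))).2.2.1).trans_lt
    ENNReal.ofReal_lt_top).ne
  have hle₁ := B₁.elasticEnergy_le_of_convexLimit hZ₁ he₁
  have hle₂ := B₂.elasticEnergy_le_of_convexLimit hZ₂ he₂
  have hlimE : I = e₁.toReal + B₁.weightEnergy grav Z₁ b₁ + e₂.toReal +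
      B₂.weightEnergy grav Z₂ b₂ :=
    tendsto_nhds_unique (hI.comp hψm.tendsto_atTop)
      (((((ENNReal.tendsto_toReal hfin₁).comp he₁).add hw₁).add
        ((ENNReal.tendsto_toReal hfin₂).comp he₂)).add hw₂)
  have hZI : loopEnergy b₁ grav (⟨Z₁, Z₂, b₂⟩ : Config B₁ B₂) ≤ (I : EReal) := by
    rw [loopEnergy_eq_coe (ne_top_of_le_ne_top hfin₁ hle₁) (ne_top_of_le_ne_top hfin₂ hle₂),
      EReal.coe_le_coe_iff, hlimE, realLoopEnergy]
    have := ENNReal.toReal_mono hfin₁ hle₁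
    have := ENNReal.toReal_mono hfin₂ hle₂
    gcongr
  refine ⟨⟨Z₁, Z₂, b₂⟩, ⟨hb₂, hZI.trans_lt (EReal.coe_lt_coe_iff.2 hIM), ?_, ?_, ?_, hlk, hiso⟩, hZI⟩
  · exact Rod.admissible_of_convexLimit hp (fun _ => hb₁) hb₁ hn₁ hT₁ hZ₁
      (fun n => (hx (ψ n)).2.2.1) hα₁ (fun n => hφ₁ _) (fun n => hclose₁ _) (fun n => hlink₁ _)
  · exact Rod.admissible_of_convexLimit hp (fun n => (hx (ψ n)).1) hb₂ hn₂ hT₂ hZ₂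
      (fun n => (hx (ψ n)).2.2.2.1) hα₂ (fun n => hφ₂ _) (fun n => hclose₂ _) (fun n => hlink₂ _)
  · exact Rod.disjoint_image_interior him₁ him₂ hT₁ hT₂ hfr₁ hfr₂ fun n => (hx (ψ n)).2.2.2.2.1

end Minimizer

end KirchhoffLink

theorem mainTheorem4 {p : ℝ} (hp : 1 < p) (B₁ B₂ : KirchhoffLink.Rod p)
    (b₁ : KirchhoffLink.InitialValue) (hb₁ : b₁.IsOrthonormal) (grav : KirchhoffLink.E3)
    (M : ℝ) (n₁ n₂ : ℤ) (η₁ η₂ : ℝ → KirchhoffLink.E3)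
    (hη₁ : ContinuousOn η₁ (Set.Icc 0 B₁.ℓ)) (hη₁c : η₁ 0 = η₁ B₁.ℓ)
    (hη₂ : ContinuousOn η₂ (Set.Icc 0 B₂.ℓ)) (hη₂c : η₂ 0 = η₂ B₂.ℓ)
    (hU : (KirchhoffLink.admissibleClass b₁ grav M n₁ n₂ η₁ η₂ :
      Set (KirchhoffLink.Config B₁ B₂)).Nonempty) :
    ∃ z ∈ (KirchhoffLink.admissibleClass b₁ grav M n₁ n₂ η₁ η₂ :
        Set (KirchhoffLink.Config B₁ B₂)),
      ∀ z' ∈ (KirchhoffLink.admissibleClass b₁ grav M n₁ n₂ η₁ η₂ :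
          Set (KirchhoffLink.Config B₁ B₂)),
        KirchhoffLink.loopEnergy b₁ grav z ≤ KirchhoffLink.loopEnergy b₁ grav z' := by
  set U : Set (KirchhoffLink.Config B₁ B₂) :=
    KirchhoffLink.admissibleClass b₁ grav M n₁ n₂ η₁ η₂ with hUdef
  obtain ⟨K, hK⟩ := KirchhoffLink.exists_bound_of_mem_admissibleClass (B₁ := B₁) (B₂ := B₂)
    (grav := grav) (M := M) (n₁ := n₁) (n₂ := n₂) (η₁ := η₁) (η₂ := η₂) hp hb₁
  set S : Set ℝ := KirchhoffLink.realLoopEnergy b₁ grav '' U with hS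
  have hbdd : BddBelow S := ⟨-K, by rintro _ ⟨z, hz, rfl⟩; exact (hK z hz).1⟩
  obtain ⟨e, -, he, heS⟩ := exists_seq_tendsto_sInf (hU.image _) hbdd
  choose x hxU hxe using heS
  have coe : ∀ z ∈ U, KirchhoffLink.loopEnergy b₁ grav z =
      (KirchhoffLink.realLoopEnergy b₁ grav z : EReal) := fun z hz => by
    obtain ⟨h₁, h₂⟩ := KirchhoffLink.elasticEnergy_ne_top_of_loopEnergy_lt hz.2.1
    exact KirchhoffLink.loopEnergy_eq_coe h₁ h₂
  have hlt : sInf S < M := by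
    obtain ⟨z, hz⟩ := hU
    have hzM : KirchhoffLink.loopEnergy b₁ grav z < (M : EReal) := hz.2.1
    rw [coe z hz, EReal.coe_lt_coe_iff] at hzM
    exact (csInf_le hbdd (Set.mem_image_of_mem _ hz)).trans_lt hzM
  obtain ⟨z, hz, hzI⟩ := KirchhoffLink.exists_admissible_realLoopEnergy_le hp hb₁ hxU
    (by simpa only [hxe] using he) hlt
  refine ⟨z, hz, fun z' hz' => hzI.trans ?_⟩
  rw [coe z' hz', EReal.coe_le_coe_iff]
  exact csInf_le hbdd (Set.mem_image_of_mem _ hz')
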